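/- Let $d\ge 3$ and let $\mathcal F=\bigoplus_{n\ge0}L^2_{\rm sym}((\mathbb R^d)^n)$ be the symmetric Fock space over $L^2(\mathbb R^d,d^dk)$, with vacuum $|0\rangle$, annihilation and creation operators $a(f),a^\dagger(f)$ satisfying $[a(f),a^\dagger(g)]=\langle f|g\rangle$, and field energy $E=\int|k|\,a^\dagger(k)a(k)\,d^dk$. On $\mathbb C^2\otimes\mathcal F$ consider the Dicke Hamiltonian $$H_D=H_D(m,d,f,\alpha)=\begin{pmatrix}\alpha^{-1}E&\sqrt\alpha\,a^\dagger(f)\\ \sqrt\alpha\,a(f)&m+\alpha^{-1}E\end{pmatrix}$$ (on the intersection of the natural domains of its terms), and the rotated family $H_D(s)=V(s)H_DV(s)^\dagger$ with $V(s)=\exp(is\sigma_x)\otimes 1$, $\sigma_x=\begin{pmatrix}0&1\\1&0\end{pmatrix}$. There is an absolute constant $c>0$ with the following property. Let $f\in L^2(\mathbb R^d)$ have at most a square-root singularity at $k=0$, i.e. $|f(k)|\le K|k|^{-1/2}$ for almost every $k$ in a neighbourhood of $0$, and put $\mathcal E=\langle f|\,|k|^{-1}|f\rangle=\int|f(k)|^2|k|^{-1}\,d^dk$.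 Then there is a constant $C>0$, depending only on $d$ and $f$, such that for all $\alpha>0$ and all $m>\alpha^2\mathcal E$: 1. For every $s\in\mathbb R$, $H_D(s)$ is self-adjoint and $H_D(s)\ge0$, and its kernel is the line spanned by $V(s)\binom{|0\rangle}{0}$. Let $P(s)$ be the orthogonal projection on this kernel (the ground state). 2. Kato's adiabatic evolution $U_A$, i.e. the solution of $\dot U_A(s)=[\dot P(s),P(s)]\,U_A(s)$, $U_A(0)=1$, $s\in[0,1]$, exists, and for every $\tau>0$ so does the unitary Schrödinger evolution $U_\tau$, i.e. the solution of $i\,\dot U_\tau(s)=\tau H_D(s)U_\tau(s)$, $U_\tau(0)=1$, $s\in[0,1]$ (the equation being understood on vectors of the domain of $H_D$). 3. For all such evolutions and all $s\in[0,1]$, $$\|(U_A(s)-U_\tau(s))P(0)\|\le\frac{c+C(\sqrt\alpha+\alpha^2)}{m-\alpha^2\mathcal E}\cdot\begin{cases}\dfrac1\tau,&d>3,\ \tau>0,\\[2mm]\dfrac{\sqrt{\log\tau}}{\tau},&d=3,\ \tau\ge2.\end{cases}$$ So the adiabatic time scale is set by $m-\alpha^2\mathcal E$: the gap $m$ of the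 two-level system without bosons, corrected by the Lamb shift $\alpha^2\mathcal E$. -/

import Mathlib

open MeasureTheory
open scoped ENNReal ComplexOrder

noncomputable section

namespace Dicke

/-! ### The symmetric Fock space over `L²(ℝᵈ)` -/

/-- The momentum space `ℝᵈ`, with its Euclidean norm and Lebesgue measure. -/
abbrev Momentum (d : ℕ) : Type := EuclideanSpace ℝ (Fin d)

/-- The one-boson space `L²(ℝᵈ, dᵈk)`. -/
abbrev OneParticle (d : ℕ) : Type := Lp ℂ 2 (volume : Measure (Momentum d))

/-- The space `L²((ℝᵈ)ⁿ)` of all (not necessarily symmetric) functions of `n` momenta. -/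
abbrev NBody (d n : ℕ) : Type := Lp ℂ 2 (volume : Measure (Fin n → Momentum d))

theorem measurePreserving_perm (d n : ℕ) (σ : Equiv.Perm (Fin n)) :
    MeasurePreserving (fun k : Fin n → Momentum d => k ∘ σ) volume volume := by
  convert volume_measurePreserving_piCongrLeft (fun _ : Fin n => Momentum d) σ.symm using 1
  funext k i
  have h := Equiv.piCongrLeft_apply_apply (fun _ : Fin n => Momentum d) σ.symm k (σ i)
  rw [Equiv.symm_apply_apply] at h
  exact h.symm

/-- The unitary `ψ ↦ ψ(k_{σ 1}, …, k_{σ n})` on `L²((ℝᵈ)ⁿ)`. -/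
def permute (d n : ℕ) (σ : Equiv.Perm (Fin n)) : NBody d n →ₗᵢ[ℂ] NBody d n :=
  Lp.compMeasurePreservingₗᵢ ℂ (fun k : Fin n → Momentum d => k ∘ σ)
    (measurePreserving_perm d n σ)

/-- The `n`-boson space: the symmetric functions in `L²((ℝᵈ)ⁿ)`. -/
def symmSubspace (d n : ℕ) : Submodule ℂ (NBody d n) :=
  ⨅ σ : Equiv.Perm (Fin n),
    LinearMap.eqLocus (permute d n σ).toLinearMap (LinearMap.id : NBody d n →ₗ[ℂ] NBody d n)

theorem isClosed_symmSubspace (d n : ℕ) : IsClosed (symmSubspace d n : Set (NBody d n)) := by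
  have h : (symmSubspace d n : Set (NBody d n)) =
      ⋂ σ : Equiv.Perm (Fin n), {ψ | permute d n σ ψ = ψ} := by
    ext ψ
    simp [symmSubspace, LinearMap.mem_eqLocus]
  rw [h]
  exact isClosed_iInter fun σ => isClosed_eq (permute d n σ).continuous continuous_id

instance (d n : ℕ) : CompleteSpace (symmSubspace d n) :=
  (isClosed_symmSubspace d n).completeSpace_coe

/-- The symmetric Fock space `𝓕 = ⨁ₙ L²_sym((ℝᵈ)ⁿ)` (Hilbert sum over `n ≥ 0`). -/
abbrev Fock (d : ℕ) : Type := lp (fun n : ℕ => symmSubspace d n) 2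

/-- The `n`-boson wave function `ψₙ(k₁, …, kₙ)` of a Fock space vector. -/
def wave {d : ℕ} (ψ : Fock d) (n : ℕ) : (Fin n → Momentum d) → ℂ :=
  ((ψ n : NBody d n) : (Fin n → Momentum d) → ℂ)

theorem wave_zero (d n : ℕ) : wave (0 : Fock d) n =ᵐ[volume] 0 := by
  simpa [wave] using Lp.coeFn_zero ℂ 2 (volume : Measure (Fin n → Momentum d))

theorem wave_add {d : ℕ} (ψ φ : Fock d) (n : ℕ) :
    wave (ψ + φ) n =ᵐ[volume] wave ψ n + wave φ n := by
  simpa [wave] using Lp.coeFn_add (ψ n : NBody d n) (φ n : NBody d n)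

theorem wave_smul {d : ℕ} (c : ℂ) (ψ : Fock d) (n : ℕ) :
    wave (c • ψ) n =ᵐ[volume] c • wave ψ n := by
  simpa [wave] using Lp.coeFn_smul c (ψ n : NBody d n)

theorem eq_zero_of_wave {d : ℕ} (ψ : Fock d) (h : ∀ n, wave ψ n =ᵐ[volume] 0) : ψ = 0 := by
  apply lp.ext
  funext n
  apply Subtype.ext
  exact (Lp.eq_zero_iff_ae_eq_zero).2 (h n)

/-- Forgetting one of the momenta pulls null sets back to null sets. -/
theorem quasiMeasurePreserving_removeNth (d n : ℕ) (i : Fin (n + 1)) :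
    Measure.QuasiMeasurePreserving
      (fun k : Fin (n + 1) → Momentum d => (i.removeNth k : Fin n → Momentum d))
      volume volume :=
  Measure.quasiMeasurePreserving_snd.comp
    (volume_preserving_piFinSuccAbove (fun _ : Fin (n + 1) => Momentum d) i).quasiMeasurePreserving

theorem volume_fin_zero (d : ℕ) :
    (volume : Measure (Fin 0 → Momentum d)) = Measure.dirac (fun i => i.elim0) := by
  rw [volume_pi]
  exact Measure.pi_of_empty _ _

theorem memLp_one (d : ℕ) :
    MemLp (fun _ : Fin 0 → Momentum d => (1 : ℂ)) 2 volume := by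
  rw [volume_fin_zero]
  exact memLp_const 1

/-- The zero-boson wave function `1`. -/
def vacuumZero (d : ℕ) : symmSubspace d 0 :=
  ⟨(memLp_one d).toLp _, by
    simp only [symmSubspace, Submodule.mem_iInf, LinearMap.mem_eqLocus]
    intro σ
    have h : σ = Equiv.refl _ := Subsingleton.elim _ _
    subst h
    exact Lp.compMeasurePreserving_id_apply _⟩

/-- The field vacuum `|0⟩`. -/
def vacuum (d : ℕ) : Fock d := lp.single 2 0 (vacuumZero d)

/-! ### Field energy, creation and annihilation operators -/

/-- The graph of the field energy `E = ∫ |k| a†(k) a(k) dᵈk`, which acts on the `n`-boson sector as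
multiplication by `|k₁| + ⋯ + |kₙ|`. -/
def energyGraph (d : ℕ) : Submodule ℂ (Fock d × Fock d) where
  carrier := {p | ∀ n, wave p.2 n =ᵐ[volume] fun k => ((∑ i, ‖k i‖ : ℝ) : ℂ) * wave p.1 n k}
  zero_mem' := by
    intro n
    filter_upwards [wave_zero d n] with k hk
    simp [hk]
  add_mem' := by
    intro p q hp hq n
    filter_upwards [hp n, hq n, wave_add p.1 q.1 n, wave_add p.2 q.2 n] with k h1 h2 h3 h4
    simp only [Prod.fst_add, Prod.snd_add, h3, h4, Pi.add_apply, h1, h2, mul_add]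
  smul_mem' := by
    intro c p hp n
    filter_upwards [hp n, wave_smul c p.1 n, wave_smul c p.2 n] with k h1 h3 h4
    simp only [Prod.smul_fst, Prod.smul_snd, h3, h4, Pi.smul_apply, h1, smul_eq_mul]
    ring

theorem energyGraph_functional (d : ℕ) (p : Fock d × Fock d) (hp : p ∈ energyGraph d)
    (h0 : p.1 = 0) : p.2 = 0 := by
  apply eq_zero_of_wave
  intro n
  filter_upwards [hp n, wave_zero d n] with k h1 h2
  rw [h1, h0, h2]
  simp

/-- The field energy `E`, on its maximal domain. -/
def fieldEnergy (d : ℕ) : Fock d →ₗ.[ℂ] Fock d := (energyGraph d).toLinearPMap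

/-- The graph of the creation operator
`(a†(f) ψ)ₙ₊₁(k₀, …, kₙ) = (n+1)^{-1/2} ∑ᵢ f(kᵢ) ψₙ(k₀, …, k̂ᵢ, …, kₙ)`, `(a†(f) ψ)₀ = 0`. -/
def creationGraph {d : ℕ} (f : OneParticle d) : Submodule ℂ (Fock d × Fock d) where
  carrier := {p | wave p.2 0 =ᵐ[volume] 0 ∧ ∀ n, wave p.2 (n + 1) =ᵐ[volume] fun k =>
    (((√((n : ℝ) + 1))⁻¹ : ℝ) : ℂ) * ∑ i : Fin (n + 1), f (k i) * wave p.1 n (i.removeNth k)}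
  zero_mem' := by
    refine ⟨wave_zero d 0, fun n => ?_⟩
    have h : ∀ᵐ k : Fin (n + 1) → Momentum d, ∀ i : Fin (n + 1),
        wave (0 : Fock d) n (i.removeNth k) = 0 :=
      ae_all_iff.2 fun i => (quasiMeasurePreserving_removeNth d n i).ae (wave_zero d n)
    filter_upwards [wave_zero d (n + 1), h] with k h1 h2
    simp [h1, h2]
  add_mem' := by
    rintro p q ⟨hp0, hp⟩ ⟨hq0, hq⟩
    refine ⟨?_, fun n => ?_⟩
    · filter_upwards [hp0, hq0, wave_add p.2 q.2 0] with k h1 h2 h3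
      simp [h3, h1, h2]
    · have h : ∀ᵐ k : Fin (n + 1) → Momentum d, ∀ i : Fin (n + 1),
          wave (p.1 + q.1) n (i.removeNth k) = (wave p.1 n + wave q.1 n) (i.removeNth k) :=
        ae_all_iff.2 fun i => (quasiMeasurePreserving_removeNth d n i).ae (wave_add p.1 q.1 n)
      filter_upwards [hp n, hq n, wave_add p.2 q.2 (n + 1), h] with k h1 h2 h3 h4
      simp only [Prod.fst_add, Prod.snd_add, h3, h4, Pi.add_apply, h1, h2, mul_add,
        Finset.sum_add_distrib]
  smul_mem' := by
    rintro c p ⟨hp0, hp⟩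
    refine ⟨?_, fun n => ?_⟩
    · filter_upwards [hp0, wave_smul c p.2 0] with k h1 h3
      simp [h3, h1]
    · have h : ∀ᵐ k : Fin (n + 1) → Momentum d, ∀ i : Fin (n + 1),
          wave (c • p.1) n (i.removeNth k) = (c • wave p.1 n) (i.removeNth k) :=
        ae_all_iff.2 fun i => (quasiMeasurePreserving_removeNth d n i).ae (wave_smul c p.1 n)
      filter_upwards [hp n, wave_smul c p.2 (n + 1), h] with k h1 h3 h4
      simp only [Prod.smul_fst, Prod.smul_snd, h3, h4, Pi.smul_apply, h1, smul_eq_mul,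
        Finset.mul_sum]
      refine Finset.sum_congr rfl fun i _ => ?_
      ring

theorem creationGraph_functional {d : ℕ} (f : OneParticle d) (p : Fock d × Fock d)
    (hp : p ∈ creationGraph f) (h0 : p.1 = 0) : p.2 = 0 := by
  apply eq_zero_of_wave
  intro n
  cases n with
  | zero => exact hp.1
  | succ n =>
    have h : ∀ᵐ k : Fin (n + 1) → Momentum d, ∀ i : Fin (n + 1),
        wave (0 : Fock d) n (i.removeNth k) = 0 :=
      ae_all_iff.2 fun i => (quasiMeasurePreserving_removeNth d n i).ae (wave_zero d n)
    filter_upwards [hp.2 n, h] with k h1 h2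
    rw [h1, h0]
    simp [h2]

/-- The creation operator `a†(f)`, on its maximal domain. -/
def creation {d : ℕ} (f : OneParticle d) : Fock d →ₗ.[ℂ] Fock d := (creationGraph f).toLinearPMap

/-- The annihilation operator `a(f)`, the adjoint of `a†(f)`. -/
def annihilation {d : ℕ} (f : OneParticle d) : Fock d →ₗ.[ℂ] Fock d := (creation f).adjoint

/-! ### The Dicke Hamiltonian -/

/-- `ℂ² ⊗ 𝓕`, written as `𝓕 ⊕ 𝓕`: the first component is the lower level `(1, 0)`, the second one
the upper level `(0, 1)`. -/
abbrev State (d : ℕ) : Type := WithLp 2 (Fock d × Fock d)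

/-- The natural domain `(D(A) ∩ D(C)) ⊕ (D(B) ∩ D(D))` of the block matrix `((A, B), (C, D))`. -/
def blockDomain {H : Type*} [NormedAddCommGroup H] [InnerProductSpace ℂ H]
    (A B C D : H →ₗ.[ℂ] H) : Submodule ℂ (WithLp 2 (H × H)) :=
  (A.domain ⊓ C.domain).comap (WithLp.fstₗ 2 ℂ H H) ⊓
    (B.domain ⊓ D.domain).comap (WithLp.sndₗ 2 ℂ H H)

/-- The operator on `H ⊕ H` with block matrix `((A, B), (C, D))`, on its natural domain. -/
def blockOperator {H : Type*} [NormedAddCommGroup H] [InnerProductSpace ℂ H]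
    (A B C D : H →ₗ.[ℂ] H) : WithLp 2 (H × H) →ₗ.[ℂ] WithLp 2 (H × H) where
  domain := blockDomain A B C D
  toFun := (WithLp.linearEquiv 2 ℂ (H × H)).symm.toLinearMap ∘ₗ LinearMap.prod
    (A.toFun ∘ₗ (WithLp.fstₗ 2 ℂ H H).restrict (p := blockDomain A B C D) (fun _ hψ => hψ.1.1)
      + B.toFun ∘ₗ (WithLp.sndₗ 2 ℂ H H).restrict (p := blockDomain A B C D) (fun _ hψ => hψ.2.1))
    (C.toFun ∘ₗ (WithLp.fstₗ 2 ℂ H H).restrict (p := blockDomain A B C D) (fun _ hψ => hψ.1.2)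
      + D.toFun ∘ₗ (WithLp.sndₗ 2 ℂ H H).restrict (p := blockDomain A B C D) (fun _ hψ => hψ.2.2))

theorem blockOperator_apply {H : Type*} [NormedAddCommGroup H] [InnerProductSpace ℂ H]
    (A B C D : H →ₗ.[ℂ] H) (ψ : (blockOperator A B C D).domain) :
    blockOperator A B C D ψ = WithLp.toLp 2
      (A ⟨ψ.1.fst, ψ.2.1.1⟩ + B ⟨ψ.1.snd, ψ.2.2.1⟩,
        C ⟨ψ.1.fst, ψ.2.1.2⟩ + D ⟨ψ.1.snd, ψ.2.2.2⟩) :=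
  rfl

/-- The Dicke Hamiltonian
`m (1 - P) ⊗ 1 + α⁻¹ 1 ⊗ E + √α σ₊ ⊗ a†(f) + √α σ₋ ⊗ a(f)` on `ℂ² ⊗ 𝓕`, i.e. the block matrix
`((α⁻¹ E, √α a†(f)), (√α a(f), m + α⁻¹ E))`, on the intersection of the domains of its terms. -/
def hamiltonian {d : ℕ} (m : ℝ) (f : OneParticle d) (α : ℝ) : State d →ₗ.[ℂ] State d :=
  blockOperator
    (((α⁻¹ : ℝ) : ℂ) • fieldEnergy d) (((√α : ℝ) : ℂ) • creation f)
    (((√α : ℝ) : ℂ) • annihilation f)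
    (((m : ℂ) • (LinearMap.id : Fock d →ₗ[ℂ] Fock d)).toPMap ⊤ + ((α⁻¹ : ℝ) : ℂ) • fieldEnergy d)

/-- `σ = σₓ ⊗ 1`, which exchanges the two levels. -/
def sigmaX (d : ℕ) : State d →L[ℂ] State d :=
  (LinearIsometryEquiv.withLpProdComm 2 ℂ (Fock d) (Fock d)).toContinuousLinearEquiv

/-- `exp(i s A)` for a bounded operator `A`. -/
def expI {H : Type*} [NormedAddCommGroup H] [InnerProductSpace ℂ H] (A : H →L[ℂ] H) (s : ℝ) :
    H →L[ℂ] H :=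
  NormedSpace.exp ((Complex.I * (s : ℂ)) • A)

/-- The rotation `V(s) = exp(i s σₓ) ⊗ 1 = exp(i s σ)`. -/
def rotation (d : ℕ) (s : ℝ) : State d →L[ℂ] State d :=
  expI (sigmaX d) s

/-- `V A V†` for bounded `V` and unbounded `A`, with domain `{ψ | V† ψ ∈ D(A)}`. -/
def conjugate {H : Type*} [NormedAddCommGroup H] [InnerProductSpace ℂ H] [CompleteSpace H]
    (V : H →L[ℂ] H) (A : H →ₗ.[ℂ] H) : H →ₗ.[ℂ] H where
  domain := A.domain.comap (ContinuousLinearMap.adjoint V).toLinearMap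
  toFun := V.toLinearMap ∘ₗ A.toFun ∘ₗ
    (ContinuousLinearMap.adjoint V).toLinearMap.restrict (fun _ hψ => hψ)

/-- The rotated Hamiltonian `H_D(s) = V(s) H_D V(s)†`. -/
def rotatedHamiltonian {d : ℕ} (m : ℝ) (f : OneParticle d) (α s : ℝ) :
    State d →ₗ.[ℂ] State d :=
  conjugate (rotation d s) (hamiltonian m f α)

/-- The kernel of an unbounded operator, as a subspace of the whole space. -/
def kernel {H : Type*} [NormedAddCommGroup H] [InnerProductSpace ℂ H] (A : H →ₗ.[ℂ] H) :
    Submodule ℂ H :=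
  (LinearMap.ker A.toFun).map A.domain.subtype

/-- `P(s)`, the orthogonal projection on the kernel of `H_D(s)` (which is closed, since `H_D(s)` is
self-adjoint). -/
def groundProjection {d : ℕ} (m : ℝ) (f : OneParticle d) (α s : ℝ) : State d →L[ℂ] State d :=
  (kernel (rotatedHamiltonian m f α s)).topologicalClosure.starProjection

/-! ### The two evolutions -/

/-- Kato's adiabatic evolution of a family of projections `P(s)`, `0 ≤ s ≤ 1`:
`U̇_A = [Ṗ, P] U_A`, `U_A(0) = 1`. -/
def IsAdiabaticEvolution {H : Type*} [NormedAddCommGroup H] [InnerProductSpace ℂ H]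
    (P U : ℝ → H →L[ℂ] H) : Prop :=
  U 0 = 1 ∧ ∀ s ∈ Set.Icc (0 : ℝ) 1, DifferentiableAt ℝ P s ∧
    HasDerivWithinAt U ((deriv P s * P s - P s * deriv P s) * U s) (Set.Icc 0 1) s

/-- The unitary Schrödinger evolution generated by the Hamiltonians `A(s)`, `0 ≤ s ≤ 1`:
`i U̇_τ = τ A(s) U_τ`, `U_τ(0) = 1`, where the equation holds on every vector of the domain of
`A(0)`. -/
def IsSchrodingerEvolution {H : Type*} [NormedAddCommGroup H] [InnerProductSpace ℂ H]
    [CompleteSpace H] (A : ℝ → H →ₗ.[ℂ] H) (τ : ℝ) (U : ℝ → H →L[ℂ] H) : Prop :=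
  U 0 = 1 ∧ ∀ s ∈ Set.Icc (0 : ℝ) 1, U s ∈ unitary (H →L[ℂ] H) ∧
    ∀ ψ ∈ (A 0).domain, ∃ h : U s ψ ∈ (A s).domain,
      HasDerivWithinAt (fun r => U r ψ) ((-Complex.I * (τ : ℂ)) • A s ⟨U s ψ, h⟩)
        (Set.Icc 0 1) s

/-! ### The coupling function -/

/-- `f` has (at most) a square-root singularity at `k = 0`: `|f(k)| ≤ K |k|^{-1/2}` near `0`. -/
def SqrtSingularity {d : ℕ} (f : OneParticle d) : Prop :=
  ∃ K r : ℝ, 0 < r ∧ ∀ᵐ k : Momentum d, ‖k‖ < r → ‖f k‖ ≤ K / √‖k‖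

/-- `𝓔 = ⟨f | 1/|k| | f⟩`. -/
def infraredEnergy {d : ℕ} (f : OneParticle d) : ℝ := ∫ k : Momentum d, ‖f k‖ ^ 2 / ‖k‖

/-- The Lamb shift `α² 𝓔`. -/
def lambShift {d : ℕ} (f : OneParticle d) (α : ℝ) : ℝ := α ^ 2 * infraredEnergy f

/-- The decay rate of the adiabatic error: `1/τ` for `d > 3`, and `√(log τ)/τ` for `d = 3`. -/
def adiabaticRate (d : ℕ) (τ : ℝ) : ℝ := if 3 < d then 1 / τ else √(Real.log τ) / τ

end Dicke

end

/-!
The Dicke Hamiltonian has no spectral gap above its ground state, so the adiabatic theorem is proved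
by a first-order correction of the ground state rather than by inverting `H_D` on the complement of
its kernel.

*The Hamiltonians.* The creation operator satisfies `‖a†(f) φ‖² ≤ ‖f‖² ‖φ‖² + 𝓔 ‖E^{1/2} φ‖²` and
`|⟨ψ, a†(f) φ⟩| ≤ 𝓔^{1/2} ‖E^{1/2} ψ‖ ‖φ‖`; both come from the Cauchy–Schwarz inequality with weights
`|kᵢ|` (`norm_creationWave_sq_le`). The first bound makes the coupling infinitesimally small relative
to `E`, hence `H_D` self-adjoint (`IsFieldCoupling.hasImaginaryResolvents`). The second allows one to
complete the square in the quadratic form (`IsFieldCoupling.le_form`), with `m - α²𝓔 > 0` left over on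
the upper level. So `H_D ≥ 0`, and its kernel is spanned by `Ω = (|0⟩, 0)`.

*The evolutions.* Both evolution equations become autonomous in the frame rotated by
`V(s) = exp(isσ)`. Since `⟨Ω, σΩ⟩ = 0`, Kato's generator `[Ṗ, P]` is `V(s) (iσP + P iσ) V(s)†`, which
gives the adiabatic evolution and, by uniqueness for linear differential equations, `U_A(s) Ω = V(s) Ω`
(`IsAdiabaticEvolution.apply_eq`). The Schrödinger evolution is `V(s) G(s)`, where `G` is the unitary
group generated by `τ H_D + σ`; it is provided by Stone's theorem, in the direction proved through
Yosida approximations (`HasImaginaryResolvents.exists_unitary_group`).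

*The estimate.* If `H_D Ξ = -σΩ + err`, then `V(s) (Ω + Ξ/τ)` solves the Schrödinger equation up to a
residual of norm at most `‖Ξ‖/τ + ‖err‖`, and the symmetry of the Hamiltonians turns this into
`‖V(s) Ω - U_τ(s) Ω‖ ≤ 3 ‖Ξ‖/τ + ‖err‖` (`IsSchrodingerEvolution.norm_sub_le`). For
`Ξ = (m - α²𝓔)⁻¹ (α^{3/2} a†(g) |0⟩, -|0⟩)` the error is controlled by `f - |k| g` and `𝓔 - ⟨f|g⟩`
(`exists_hamiltonian_correction`); it vanishes for `g = f/|k|`. This function is square integrable if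
`d > 3`. For `d = 3` its singularity is cut off at `|k| ~ 1/τ`, at the price of `‖g‖² ~ log τ`
(`exists_adapted_cutoff`), which is where the logarithm in the rate comes from.
-/

open MeasureTheory
open scoped ENNReal ComplexOrder

noncomputable section

namespace Dicke

open Filter Topology

/-! ### Symmetric operators with imaginary resolvents -/

section Abstract

variable {H : Type*} [NormedAddCommGroup H] [InnerProductSpace ℂ H]

/-- A symmetric operator `T` such that `T + i l` is onto for every real `l` with large enough `|l|`.
This is the form in which self-adjointness is checked and used. -/
structure HasImaginaryResolvents (T : H →ₗ.[ℂ] H) : Prop where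
  symm : T.IsFormalAdjoint T
  surj : ∃ Λ : ℝ, 0 < Λ ∧ ∀ l : ℝ, Λ ≤ |l| → ∀ y : H, ∃ x : T.domain,
    T x + (Complex.I * (l : ℂ)) • (x : H) = y

theorem inner_self_im_eq_zero {T : H →ₗ.[ℂ] H} (hT : T.IsFormalAdjoint T) (x : T.domain) :
    (inner ℂ (x : H) (T x)).im = 0 := by
  have h : (starRingEnd ℂ) (inner ℂ (x : H) (T x)) = inner ℂ (x : H) (T x) := by
    rw [inner_conj_symm, hT x x]
  exact Complex.conj_eq_iff_im.1 h

theorem norm_sq_add_imaginary {T : H →ₗ.[ℂ] H} (hT : T.IsFormalAdjoint T) (l : ℝ) (x : T.domain) :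
    ‖T x + (Complex.I * (l : ℂ)) • (x : H)‖ ^ 2 = ‖T x‖ ^ 2 + l ^ 2 * ‖(x : H)‖ ^ 2 := by
  have h := @norm_add_sq ℂ H _ _ _ (T x) ((Complex.I * (l : ℂ)) • (x : H))
  have h2 := inner_self_im_eq_zero hT x
  rw [h, inner_smul_right, hT x x, norm_smul]
  have h3 : RCLike.re (Complex.I * (l : ℂ) * inner ℂ (x : H) (T x)) = 0 := by
    simp [h2]
  rw [h3]
  simp [mul_pow]

theorem eq_zero_of_add_imaginary {T : H →ₗ.[ℂ] H} (hT : T.IsFormalAdjoint T) {l : ℝ} (hl : l ≠ 0)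
    (x : T.domain) (hx : T x + (Complex.I * (l : ℂ)) • (x : H) = 0) : x = 0 := by
  have h := norm_sq_add_imaginary hT l x
  rw [hx, norm_zero] at h
  have h1 : l ^ 2 * ‖(x : H)‖ ^ 2 = 0 := by
    have := mul_nonneg (sq_nonneg l) (sq_nonneg ‖(x : H)‖)
    nlinarith [sq_nonneg ‖T x‖]
  have h2 : ‖(x : H)‖ = 0 := by simpa [hl] using h1
  exact Subtype.ext (norm_eq_zero.1 h2)

/-- `T + i l` has a linear right inverse as soon as it is onto. -/
theorem exists_linear_resolvent {T : H →ₗ.[ℂ] H} (hT : T.IsFormalAdjoint T) {l : ℝ} (hl : l ≠ 0)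
    (hs : ∀ y : H, ∃ x : T.domain, T x + (Complex.I * (l : ℂ)) • (x : H) = y) :
    ∃ R : H →ₗ[ℂ] T.domain,
      (∀ y, T (R y) + (Complex.I * (l : ℂ)) • (R y : H) = y) ∧
      ∀ x : T.domain, R (T x + (Complex.I * (l : ℂ)) • (x : H)) = x := by
  let L : T.domain →ₗ[ℂ] H := T.toFun + (Complex.I * (l : ℂ)) • T.domain.subtype
  have hL : ∀ x, L x = T x + (Complex.I * (l : ℂ)) • (x : H) := fun x => rfl
  have hinj : Function.Injective L := by
    rw [injective_iff_map_eq_zero]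
    intro x hx
    exact eq_zero_of_add_imaginary hT hl x hx
  let e := LinearEquiv.ofBijective L ⟨hinj, fun y => hs y⟩
  refine ⟨e.symm.toLinearMap, fun y => ?_, fun x => ?_⟩
  · exact e.apply_symm_apply y
  · exact e.symm_apply_apply x

/-- The resolvents `(T + i l)⁻¹` as bounded operators. -/
theorem exists_bounded_resolvent {T : H →ₗ.[ℂ] H} (hT : T.IsFormalAdjoint T) {l : ℝ} (hl : l ≠ 0)
    (hs : ∀ y : H, ∃ x : T.domain, T x + (Complex.I * (l : ℂ)) • (x : H) = y) :
    ∃ R : H →L[ℂ] H, (∀ y, ∃ h : R y ∈ T.domain,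
        T ⟨R y, h⟩ + (Complex.I * (l : ℂ)) • R y = y) ∧
      (∀ x : T.domain, R (T x + (Complex.I * (l : ℂ)) • (x : H)) = x) ∧
      ∀ y, ‖R y‖ ≤ ‖y‖ / |l| := by
  obtain ⟨R, h1, h2⟩ := exists_linear_resolvent hT hl hs
  have hl' : 0 < |l| := abs_pos.2 hl
  have hb : ∀ y, ‖(R y : H)‖ ≤ |l|⁻¹ * ‖y‖ := by
    intro y
    have h := norm_sq_add_imaginary hT l (R y)
    rw [h1] at h
    have h3 : (|l| * ‖(R y : H)‖) ^ 2 ≤ ‖y‖ ^ 2 := by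
      rw [mul_pow, sq_abs]; nlinarith [sq_nonneg ‖T (R y)‖]
    rw [inv_mul_eq_div, le_div_iff₀ hl', mul_comm]
    exact (sq_le_sq₀ (by positivity) (norm_nonneg y)).1 h3
  refine ⟨(T.domain.subtype ∘ₗ R).mkContinuous _ hb, fun y => ⟨(R y).2, h1 y⟩, fun x => ?_,
    fun y => ?_⟩
  · change ((R _ : T.domain) : H) = x
    rw [h2]
  · rw [← inv_mul_eq_div]; exact hb y

variable [CompleteSpace H]

theorem HasImaginaryResolvents.dense {T : H →ₗ.[ℂ] H} (hT : HasImaginaryResolvents T) :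
    Dense (T.domain : Set H) := by
  obtain ⟨Λ, hΛ, hs⟩ := hT.surj
  rw [Submodule.dense_iff_topologicalClosure_eq_top, Submodule.topologicalClosure_eq_top_iff,
    Submodule.eq_bot_iff]
  intro y hy
  obtain ⟨x, hx⟩ := hs Λ (le_abs_self Λ) y
  have h1 : inner ℂ (x : H) y = 0 := hy x x.2
  rw [← hx, inner_add_right, inner_smul_right, inner_self_eq_norm_sq_to_K] at h1
  have h2 : Λ * ‖(x : H)‖ ^ 2 = 0 := by
    have h3 := congrArg Complex.im h1
    simpa [inner_self_im_eq_zero hT.symm x, ← Complex.ofReal_pow] using h3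
  have h3 : (x : H) = 0 := by simpa [hΛ.ne'] using h2
  have h4 : x = 0 := Subtype.ext h3
  rw [← hx, h4]
  simp

/-- The basic criterion of self-adjointness. -/
theorem HasImaginaryResolvents.isSelfAdjoint {T : H →ₗ.[ℂ] H} (hT : HasImaginaryResolvents T) :
    IsSelfAdjoint T := by
  have hd := hT.dense
  rw [LinearPMap.isSelfAdjoint_def]
  have hle : T ≤ T.adjoint := hT.symm.le_adjoint hd
  refine (LinearPMap.eq_of_le_of_domain_eq hle (le_antisymm hle.1 ?_)).symm
  intro y hy
  obtain ⟨Λ, hΛ, hs⟩ := hT.surj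
  obtain ⟨x, hx⟩ := hs Λ (le_abs_self Λ) (T.adjoint ⟨y, hy⟩ + (Complex.I * (Λ : ℂ)) • y)
  have key : y - x = 0 := by
    obtain ⟨v, hv⟩ := hs (-Λ) (by rw [abs_neg]; exact le_abs_self Λ) (y - x)
    have h1 := LinearPMap.adjoint_isFormalAdjoint hd ⟨y, hy⟩ v
    have h2 := hT.symm x v
    have h3 : T.adjoint ⟨y, hy⟩ - T x = - ((Complex.I * (Λ : ℂ)) • (y - x)) := by
      rw [smul_sub, eq_sub_of_add_eq hx]; abel
    have h4 : inner ℂ (y - x) (y - (x : H)) = 0 := by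
      nth_rewrite 2 [← hv]
      rw [inner_add_right, inner_sub_left]
      simp only at h1
      rw [← h1, ← h2, ← inner_sub_left, h3, inner_neg_left, inner_smul_left, inner_smul_right]
      simp
    exact inner_self_eq_zero.1 h4
  rw [sub_eq_zero.1 key]
  exact x.2

/-- A Kato–Rellich criterion: if each `S + i l` with large `|l|` has an approximate linear right
inverse, with an error of norm less than one, then `S` has imaginary resolvents. -/
theorem hasImaginaryResolvents_of_approx {S : H →ₗ.[ℂ] H} (hS : S.IsFormalAdjoint S)
    {Λ : ℝ} (hΛ : 0 < Λ)
    (h : ∀ l : ℝ, Λ ≤ |l| → ∃ R : H →ₗ[ℂ] S.domain, ∃ q : ℝ, q < 1 ∧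
      ∀ y, ‖S (R y) + (Complex.I * (l : ℂ)) • (R y : H) - y‖ ≤ q * ‖y‖) :
    HasImaginaryResolvents S := by
  refine ⟨hS, Λ, hΛ, fun l hl y => ?_⟩
  obtain ⟨R, q, hq, hR⟩ := h l hl
  let K : H →L[ℂ] H := (LinearMap.id - (S.toFun ∘ₗ R + (Complex.I * (l : ℂ)) •
    (S.domain.subtype ∘ₗ R))).mkContinuous (max q 0) (fun y => by
      have h1 := hR y
      rw [norm_sub_rev] at h1
      exact h1.trans (mul_le_mul_of_nonneg_right (le_max_left _ _) (norm_nonneg _)))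
  have hK : ∀ y, K y = y - (S (R y) + (Complex.I * (l : ℂ)) • (R y : H)) := fun y => rfl
  have hn : ‖K‖ < 1 := lt_of_le_of_lt (LinearMap.mkContinuous_norm_le _ (le_max_right _ _) _)
    (max_lt hq one_pos)
  let u := Units.oneSub K hn
  let z := (↑u⁻¹ : H →L[ℂ] H) y
  have hz : z - K z = y := by
    have h1 : (u : H →L[ℂ] H) * (↑u⁻¹ : H →L[ℂ] H) = 1 := u.mul_inv
    have h2 := congrArg (fun A : H →L[ℂ] H => A y) h1
    simpa [u, z] using h2
  refine ⟨R z, ?_⟩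
  rw [← hz, hK]
  abel

end Abstract

/-! ### The unitary group of an operator with imaginary resolvents -/

section Stone

variable {H : Type*} [NormedAddCommGroup H] [InnerProductSpace ℂ H]

/-- A bounded family of operators that tends to zero on a dense set tends to zero strongly. -/
theorem tendsto_zero_of_dense {ι : Type*} {l : Filter ι} {B : ι → H →L[ℂ] H} {C : ℝ}
    (hB : ∀ i y, ‖B i y‖ ≤ C * ‖y‖) {D : Set H} (hD : Dense D)
    (h : ∀ x ∈ D, Tendsto (fun i => B i x) l (𝓝 0)) (y : H) :
    Tendsto (fun i => B i y) l (𝓝 0) := by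
  rw [Metric.tendsto_nhds]
  intro ε hε
  have hC : 0 < |C| + 1 := by positivity
  obtain ⟨x, hx, hxy⟩ := Metric.dense_iff.1 hD y (ε / 2 / (|C| + 1)) (by positivity)
  filter_upwards [(Metric.tendsto_nhds.1 (h x hxy)) (ε / 2) (by positivity)] with i hi
  rw [dist_zero_right] at hi ⊢
  rw [Metric.mem_ball, dist_eq_norm, lt_div_iff₀ hC] at hx
  have h1 : B i y = B i x - B i (x - y) := by rw [map_sub]; abel
  have h2 : ‖B i (x - y)‖ ≤ ‖x - y‖ * (|C| + 1) := (hB i _).trans (by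
    rw [mul_comm]
    exact mul_le_mul_of_nonneg_left ((le_abs_self C).trans (by linarith)) (norm_nonneg _))
  rw [h1]
  linarith [norm_sub_le (B i x) (B i (x - y))]

/-- `R` is the bounded inverse of `T + i l`. -/
structure IsResolvent (T : H →ₗ.[ℂ] H) (l : ℝ) (R : H →L[ℂ] H) : Prop where
  right : ∀ y, ∃ h : R y ∈ T.domain, T ⟨R y, h⟩ + (Complex.I * (l : ℂ)) • R y = y
  left : ∀ x : T.domain, R (T x + (Complex.I * (l : ℂ)) • (x : H)) = x
  bound : ∀ y, ‖R y‖ ≤ ‖y‖ / |l|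

/-- The resolvent identity. -/
theorem IsResolvent.sub_apply {T : H →ₗ.[ℂ] H} {l m : ℝ} {R S : H →L[ℂ] H}
    (hR : IsResolvent T l R) (hS : IsResolvent T m S) (y : H) :
    R y - S y = (Complex.I * ((m : ℂ) - l)) • R (S y) := by
  obtain ⟨h1, h2⟩ := hR.right y
  obtain ⟨h3, h4⟩ := hS.right y
  have h5 := hR.left (⟨R y, h1⟩ - ⟨S y, h3⟩)
  rw [LinearPMap.map_sub, eq_sub_of_add_eq h2, eq_sub_of_add_eq h4] at h5
  simp only [AddSubgroupClass.coe_sub] at h5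
  refine h5.symm.trans ?_
  rw [← map_smul R (Complex.I * ((m : ℂ) - l)) (S y)]
  congr 1
  module

/-- Resolvents of the same operator commute. -/
theorem IsResolvent.commute {T : H →ₗ.[ℂ] H} {l m : ℝ} {R S : H →L[ℂ] H}
    (hR : IsResolvent T l R) (hS : IsResolvent T m S) : Commute R S := by
  refine ContinuousLinearMap.ext fun y => ?_
  change R (S y) = S (R y)
  have h1 := hR.sub_apply hS y
  have h2 := hS.sub_apply hR y
  by_cases hlm : l = m
  · subst hlm
    have h3 : ∀ z, R z = S z := fun z => by
      have := hR.sub_apply hS z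
      rwa [sub_self, mul_zero, zero_smul, sub_eq_zero] at this
    rw [h3, h3]
  · have h3 : (Complex.I * ((m : ℂ) - l)) • R (S y) = (Complex.I * ((m : ℂ) - l)) • S (R y) := by
      rw [← h1, ← neg_sub (S y), h2, ← neg_smul]
      congr 1; ring
    refine smul_right_injective H ?_ h3
    refine mul_ne_zero Complex.I_ne_zero (sub_ne_zero.2 ?_)
    exact Complex.ofReal_injective.ne (Ne.symm hlm)

theorem IsResolvent.inner_apply {T : H →ₗ.[ℂ] H} (hT : T.IsFormalAdjoint T) {l : ℝ}
    {R R' : H →L[ℂ] H} (hR : IsResolvent T l R) (hR' : IsResolvent T (-l) R') (y z : H) :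
    inner ℂ (R' y) z = inner ℂ y (R z) := by
  obtain ⟨h1, h2⟩ := hR.right z
  obtain ⟨h3, h4⟩ := hR'.right y
  nth_rewrite 1 [← h2]
  nth_rewrite 2 [← h4]
  have h5 := hT ⟨R' y, h3⟩ ⟨R z, h1⟩
  rw [inner_add_right, inner_add_left, h5, inner_smul_left, inner_smul_right]
  simp

/-- `i l (T + i l)⁻¹ x - x = - (T + i l)⁻¹ T x`. -/
theorem IsResolvent.smul_apply_sub {T : H →ₗ.[ℂ] H} {l : ℝ} {R : H →L[ℂ] H}
    (hR : IsResolvent T l R) (x : T.domain) :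
    (x : H) - (Complex.I * (l : ℂ)) • R x = R (T x) := by
  have h := hR.left x
  rw [map_add, map_smul] at h
  rw [sub_eq_iff_eq_add]
  exact h.symm

/-- `i l (T + i l)⁻¹` tends strongly to `1` as `|l| → ∞`. -/
theorem IsResolvent.tendsto {T : H →ₗ.[ℂ] H} (hd : Dense (T.domain : Set H)) {l : ℕ → ℝ}
    (hl : Tendsto (fun n => |l n|) atTop atTop) (hl0 : ∀ n, l n ≠ 0) {R : ℕ → H →L[ℂ] H}
    (hR : ∀ n, IsResolvent T (l n) (R n)) (y : H) :
    Tendsto (fun n => y - (Complex.I * (l n : ℂ)) • R n y) atTop (𝓝 0) := by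
  refine tendsto_zero_of_dense (B := fun n => 1 - (Complex.I * (l n : ℂ)) • R n) (C := 2) ?_ hd ?_ y
  · intro n y
    have h1 : ‖(Complex.I * (l n : ℂ)) • R n y‖ ≤ ‖y‖ := by
      rw [norm_smul]
      have h2 := (hR n).bound y
      rw [le_div_iff₀ (abs_pos.2 (hl0 n))] at h2
      simpa [mul_comm] using h2
    refine (norm_sub_le y ((Complex.I * (l n : ℂ)) • R n y)).trans ?_
    linarith
  · intro x hx
    have h1 : ∀ n, (1 - (Complex.I * (l n : ℂ)) • R n : H →L[ℂ] H) x = R n (T ⟨x, hx⟩) :=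
      fun n => (hR n).smul_apply_sub ⟨x, hx⟩
    simp only [h1]
    refine squeeze_zero_norm (fun n => (hR n).bound _) ?_
    exact tendsto_const_nhds.div_atTop hl

/-- The Yosida approximation `l² (T - i l)⁻¹ T (T + i l)⁻¹`, for `R = (T + i l)⁻¹` and
`R' = (T - i l)⁻¹`. -/
def yosida (l : ℝ) (R R' : H →L[ℂ] H) : H →L[ℂ] H :=
  ((l : ℂ) ^ 2) • (R' * (1 - (Complex.I * (l : ℂ)) • R))

theorem yosida_apply {T : H →ₗ.[ℂ] H} {l : ℝ} {R R' : H →L[ℂ] H} (hR : IsResolvent T l R)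
    (x : T.domain) : yosida l R R' x = ((l : ℂ) ^ 2) • R' (R (T x)) := by
  rw [← hR.smul_apply_sub x]
  rfl

theorem commute_yosida {A R R' : H →L[ℂ] H} (l : ℝ) (h : Commute A R) (h' : Commute A R') :
    Commute A (yosida l R R') :=
  (h'.mul_right ((Commute.one_right A).sub_right (h.smul_right _))).smul_right _

variable [CompleteSpace H]

theorem norm_unitary_apply {U : H →L[ℂ] H} (hU : U ∈ unitary (H →L[ℂ] H)) (x : H) :
    ‖U x‖ = ‖x‖ :=
  (ContinuousLinearMap.norm_map_iff_adjoint_comp_self U).2 (Unitary.mem_iff.1 hU).1 x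

theorem exp_smul_mem_unitary {A : H →L[ℂ] H} (hA : A ∈ skewAdjoint (H →L[ℂ] H)) (s : ℝ) :
    NormedSpace.exp (s • A) ∈ unitary (H →L[ℂ] H) := by
  let +nondep : NormedAlgebra ℚ (H →L[ℂ] H) := .restrictScalars ℚ ℂ _
  exact NormedSpace.exp_mem_unitary_of_mem_skewAdjoint (skewAdjoint.smul_mem s hA)

theorem hasDerivAt_exp_smul_apply (A : H →L[ℂ] H) (x : H) (s : ℝ) :
    HasDerivAt (fun r : ℝ => NormedSpace.exp (r • A) x) (NormedSpace.exp (s • A) (A x)) s := by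
  exact (((ContinuousLinearMap.apply ℂ H x).restrictScalars ℝ).hasFDerivAt.comp_hasDerivAt s
    (hasDerivAt_exp_smul_const (𝕂 := ℝ) A s))

theorem norm_exp_sub_le {A : H →L[ℂ] H} (hA : A ∈ skewAdjoint (H →L[ℂ] H)) (x : H) (s : ℝ) :
    ‖NormedSpace.exp (s • A) x - x‖ ≤ |s| * ‖A x‖ := by
  have h := Convex.norm_image_sub_le_of_norm_hasDerivWithin_le (𝕜 := ℝ)
    (f := fun r : ℝ => NormedSpace.exp (r • A) x) (C := ‖A x‖) (s := Set.univ) (x := 0) (y := s)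
    (fun r _ => (hasDerivAt_exp_smul_apply A x r).hasDerivWithinAt)
    (fun r _ => (norm_unitary_apply (exp_smul_mem_unitary hA r) _).le) convex_univ
    (Set.mem_univ _) (Set.mem_univ _)
  simpa [mul_comm] using h

/-- For commuting skew-adjoint `A` and `B` the difference of the two groups is controlled by the
difference of the generators, on each vector separately. -/
theorem norm_exp_sub_exp_le {A B : H →L[ℂ] H} (hA : A ∈ skewAdjoint (H →L[ℂ] H))
    (hB : B ∈ skewAdjoint (H →L[ℂ] H)) (hAB : Commute A B) (x : H) (s : ℝ) :
    ‖NormedSpace.exp (s • A) x - NormedSpace.exp (s • B) x‖ ≤ |s| * ‖A x - B x‖ := by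
  let +nondep : NormedAlgebra ℚ (H →L[ℂ] H) := .restrictScalars ℚ ℂ _
  have h1 : NormedSpace.exp (s • A) =
      NormedSpace.exp (s • B) * NormedSpace.exp (s • (A - B)) := by
    rw [← NormedSpace.exp_add_of_commute]
    · rw [← smul_add]; congr 2; abel
    · exact ((hAB.symm.sub_right (Commute.refl B)).smul_left s).smul_right s
  have h2 := norm_exp_sub_le (sub_mem hA hB) x s
  have h3 : NormedSpace.exp (s • A) x - NormedSpace.exp (s • B) x =
      NormedSpace.exp (s • B) (NormedSpace.exp (s • (A - B)) x - x) := by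
    rw [h1, map_sub]; rfl
  rw [h3, norm_unitary_apply (exp_smul_mem_unitary hB s)]
  exact h2

theorem yosida_mem_skewAdjoint {T : H →ₗ.[ℂ] H} (hT : T.IsFormalAdjoint T) {l : ℝ}
    {R R' : H →L[ℂ] H} (hR : IsResolvent T l R) (hR' : IsResolvent T (-l) R') :
    (-Complex.I) • yosida l R R' ∈ skewAdjoint (H →L[ℂ] H) := by
  have h1 : ContinuousLinearMap.adjoint (yosida l R R') = yosida l R R' := by
    symm
    rw [ContinuousLinearMap.eq_adjoint_iff]
    intro y z
    obtain ⟨h1, h2⟩ := hR.right y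
    obtain ⟨h3, h4⟩ := hR.right z
    have h5 := hT ⟨R y, h1⟩ ⟨R z, h3⟩
    have h6 : inner ℂ z (R' (T ⟨R y, h1⟩)) = inner ℂ (R z) (T ⟨R y, h1⟩) := by
      rw [← inner_conj_symm, hR.inner_apply hT hR', inner_conj_symm]
    have h7 : inner ℂ (R' (T ⟨R z, h3⟩)) y = inner ℂ (T ⟨R z, h3⟩) (R y) :=
      hR.inner_apply hT hR' _ _
    have h8 : yosida l R R' y = ((l : ℂ) ^ 2) • R' (T ⟨R y, h1⟩) := by
      rw [eq_sub_of_add_eq h2]; rfl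
    have h9 : yosida l R R' z = ((l : ℂ) ^ 2) • R' (T ⟨R z, h3⟩) := by
      rw [eq_sub_of_add_eq h4]; rfl
    rw [h8, h9, inner_smul_left, inner_smul_right, hR.inner_apply hT hR', h5,
      ← inner_conj_symm y, h7, inner_conj_symm]
    simp [← Complex.ofReal_pow]
  rw [skewAdjoint.mem_iff, star_smul, ContinuousLinearMap.star_eq_adjoint, h1]
  simp

/-- Stone's theorem, existence part: an operator with imaginary resolvents generates a unitary group
which preserves its domain. The group is the strong limit of the exponentials of the Yosida
approximations. -/
theorem HasImaginaryResolvents.exists_unitary_group {T : H →ₗ.[ℂ] H}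
    (hT : HasImaginaryResolvents T) :
    ∃ U : ℝ → H →L[ℂ] H, U 0 = 1 ∧ (∀ s, U s ∈ unitary (H →L[ℂ] H)) ∧
      ∀ s, ∀ x : T.domain, ∃ h : U s x ∈ T.domain,
        HasDerivAt (fun r => U r x) ((-Complex.I) • T ⟨U s x, h⟩) s := by
  have hd := hT.dense
  have hsymm := hT.symm
  obtain ⟨Λ, hΛ, hs⟩ := hT.surj
  have hex : ∀ l : ℝ, Λ ≤ |l| → ∃ R, IsResolvent T l R := by
    intro l hl
    obtain ⟨R, h1, h2, h3⟩ := exists_bounded_resolvent hsymm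
      (abs_pos.1 (hΛ.trans_le hl)) (hs l hl)
    exact ⟨R, h1, h2, h3⟩
  let l : ℕ → ℝ := fun n => Λ + n
  have hlpos : ∀ n, 0 < l n := fun n => by positivity
  have hl1 : ∀ n, Λ ≤ |l n| := fun n => by
    rw [abs_of_pos (hlpos n)]; simp [l]
  choose R hR using fun n => hex (l n) (hl1 n)
  choose R' hR' using fun n => hex (-l n) (by rw [abs_neg]; exact hl1 n)
  have hlim : Tendsto (fun n => |l n|) atTop atTop := by
    simp only [fun n => abs_of_pos (hlpos n)]
    exact tendsto_atTop_add_const_left _ _ tendsto_natCast_atTop_atTop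
  have hlim' : Tendsto (fun n => |-l n|) atTop atTop := by simpa using hlim
  let A : ℕ → H →L[ℂ] H := fun n => (-Complex.I) • yosida (l n) (R n) (R' n)
  have hA : ∀ n, A n ∈ skewAdjoint (H →L[ℂ] H) :=
    fun n => yosida_mem_skewAdjoint hsymm (hR n) (hR' n)
  have hcR : ∀ n, Commute (R 0) (A n) := fun n =>
    (commute_yosida _ ((hR 0).commute (hR n)) ((hR 0).commute (hR' n))).smul_right _
  have hcA : ∀ m n, Commute (A m) (A n) := fun m n => by
    refine (commute_yosida _ ?_ ?_).smul_right _ <;> refine Commute.smul_left ?_ _ <;>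
      refine (commute_yosida _ ?_ ?_).symm
    · exact (hR n).commute (hR m)
    · exact (hR n).commute (hR' m)
    · exact (hR' n).commute (hR m)
    · exact (hR' n).commute (hR' m)
  -- the Yosida approximations converge to `T` on its domain
  have hAT : ∀ x : T.domain, Tendsto (fun n => A n x) atTop (𝓝 ((-Complex.I) • T x)) := by
    intro x
    have h1 := IsResolvent.tendsto hd hlim (fun n => (hlpos n).ne') hR (T x)
    have h2 := IsResolvent.tendsto hd hlim' (fun n => neg_ne_zero.2 (hlpos n).ne') hR' (T x)
    have h3 : Tendsto (fun n => (Complex.I * ((-l n : ℝ) : ℂ)) •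
        R' n (T x - (Complex.I * (l n : ℂ)) • R n (T x))) atTop (𝓝 0) := by
      refine squeeze_zero_norm (fun n => ?_) (tendsto_zero_iff_norm_tendsto_zero.1 h1)
      rw [norm_smul]
      have h4 := (hR' n).bound (T x - (Complex.I * (l n : ℂ)) • R n (T x))
      rw [le_div_iff₀ (by rw [abs_neg]; exact abs_pos.2 (hlpos n).ne'), mul_comm] at h4
      simpa using h4
    refine Tendsto.const_smul ?_ (-Complex.I)
    have h5 := (tendsto_const_nhds (x := T x)).sub (h2.add h3)
    rw [add_zero, sub_zero] at h5
    refine h5.congr fun n => ?_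
    change _ = yosida (l n) (R n) (R' n) (x : H)
    rw [yosida_apply (hR n) x, map_sub, map_smul, smul_sub, smul_smul]
    have h6 : Complex.I * ((-l n : ℝ) : ℂ) * (Complex.I * (l n : ℂ)) = (l n : ℂ) ^ 2 := by
      push_cast; linear_combination (-(l n : ℂ) ^ 2) * Complex.I_sq
    rw [h6]
    abel
  let V : ℕ → ℝ → H →L[ℂ] H := fun n s => NormedSpace.exp (s • A n)
  have hV : ∀ n s, V n s ∈ unitary (H →L[ℂ] H) := fun n s => exp_smul_mem_unitary (hA n) s
  have hVn : ∀ n s x, ‖V n s x‖ = ‖x‖ := fun n s x => norm_unitary_apply (hV n s) x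
  have hcauchy : ∀ s y, CauchySeq (fun n => V n s y) := by
    intro s y
    rw [cauchySeq_iff_tendsto_dist_atTop_0]
    have h1 := tendsto_zero_of_dense (l := (atTop : Filter (ℕ × ℕ)))
      (B := fun p => V p.1 s - V p.2 s) (C := 2) ?_ hd ?_ y
    · simpa [dist_eq_norm] using h1.norm
    · intro p y
      refine (norm_sub_le (V p.1 s y) (V p.2 s y)).trans ?_
      rw [hVn, hVn]; linarith
    · intro x hx
      have h2 := (hAT ⟨x, hx⟩).cauchySeq
      rw [cauchySeq_iff_tendsto_dist_atTop_0] at h2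
      have h3 := h2.const_mul |s|
      rw [mul_zero] at h3
      refine squeeze_zero_norm (fun p => ?_) h3
      rw [dist_eq_norm]
      exact norm_exp_sub_exp_le (hA _) (hA _) (hcA _ _) x s
  choose u hu using fun s y => cauchySeq_tendsto_of_complete (hcauchy s y)
  let U : ℝ → H →L[ℂ] H := fun s =>
    continuousLinearMapOfTendsto (fun n => V n s) (tendsto_pi_nhds.2 (hu s))
  have hU : ∀ s y, Tendsto (fun n => V n s y) atTop (𝓝 (U s y)) := hu
  have hUn : ∀ s y, ‖U s y‖ = ‖y‖ := fun s y => by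
    refine tendsto_nhds_unique (hU s y).norm ?_
    simp only [hVn]
    exact tendsto_const_nhds
  have hinv : ∀ s, U s * U (-s) = 1 := by
    intro s
    let +nondep : NormedAlgebra ℚ (H →L[ℂ] H) := .restrictScalars ℚ ℂ _
    refine ContinuousLinearMap.ext fun y => ?_
    change U s (U (-s) y) = y
    have h1 : ∀ n, V n s (V n (-s) y) = y := fun n => by
      have : V n s * V n (-s) = 1 := by
        change NormedSpace.exp (s • A n) * NormedSpace.exp (-s • A n) = 1
        rw [← NormedSpace.exp_add_of_commute, ← add_smul, add_neg_cancel, zero_smul,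
          NormedSpace.exp_zero]
        exact ((Commute.refl (A n)).smul_left s).smul_right _
      exact congrArg (fun B : H →L[ℂ] H => B y) this
    have h2 : Tendsto (fun n => V n s (V n (-s) y - U (-s) y)) atTop (𝓝 0) := by
      refine squeeze_zero_norm (fun n => (hVn n s _).le) ?_
      exact tendsto_zero_iff_norm_tendsto_zero.1
        (by simpa using (hU (-s) y).sub_const (U (-s) y))
    have h3 := h2.add (hU s (U (-s) y))
    simp only [map_sub, h1, sub_add_cancel, zero_add] at h3
    exact tendsto_nhds_unique h3 tendsto_const_nhds
  have hunit : ∀ s, U s ∈ unitary (H →L[ℂ] H) := by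
    intro s
    have h1 : star (U s) * U s = 1 :=
      (ContinuousLinearMap.norm_map_iff_adjoint_comp_self (U s)).1 (hUn s)
    have h2 : star (U s) = U (-s) := by
      rw [← mul_one (star (U s)), ← hinv s, ← mul_assoc, h1, one_mul]
    exact Unitary.mem_iff.2 ⟨h1, by rw [h2, hinv]⟩
  have hUR : ∀ s y, U s (R 0 y) = R 0 (U s y) := by
    intro s y
    have h1 : ∀ n, V n s (R 0 y) = R 0 (V n s y) := fun n => by
      let +nondep : NormedAlgebra ℚ (H →L[ℂ] H) := .restrictScalars ℚ ℂ _
      have h2 : Commute (V n s) (R 0) := (((hcR n).smul_right s).exp_right).symm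
      exact congrArg (fun B : H →L[ℂ] H => B y) h2.eq
    have h3 := hU s (R 0 y)
    simp only [h1] at h3
    exact tendsto_nhds_unique h3 (((R 0).continuous.tendsto _).comp (hU s y))
  have hUT : ∀ s (x : T.domain), ∃ h : U s x ∈ T.domain, T ⟨U s x, h⟩ = U s (T x) := by
    intro s x
    have h1 : U s x = R 0 (U s (T x + (Complex.I * (l 0 : ℂ)) • (x : H))) := by
      rw [← hUR, (hR 0).left x]
    obtain ⟨h2, h3⟩ := (hR 0).right (U s (T x + (Complex.I * (l 0 : ℂ)) • (x : H)))
    simp only [← h1] at h2 h3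
    refine ⟨h2, ?_⟩
    refine add_right_cancel (h3.trans ?_)
    rw [map_add, map_smul]
  -- the exponentials converge locally uniformly in time
  have hunif : ∀ r y, TendstoUniformlyOn (fun n s => V n s y) (fun s => U s y) atTop
      (Metric.ball 0 r) := by
    intro r y
    rw [Metric.tendstoUniformlyOn_iff]
    intro ε hε
    obtain ⟨x, hx, hxy⟩ := Metric.dense_iff.1 hd y (ε / 3) (by positivity)
    rw [Metric.mem_ball, dist_eq_norm] at hx
    have h1 := (hAT ⟨x, hxy⟩)
    rw [tendsto_iff_norm_sub_tendsto_zero] at h1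
    have h2 := h1.const_mul |r|
    rw [mul_zero] at h2
    filter_upwards [h2.eventually (gt_mem_nhds (show (0 : ℝ) < ε / 3 by positivity))] with n hn
    intro s hs
    have h3 : ‖V n s x - U s x‖ ≤ |s| * ‖A n x - (-Complex.I) • T ⟨x, hxy⟩‖ :=
      le_of_tendsto_of_tendsto ((tendsto_const_nhds.sub (hU s x)).norm)
        ((tendsto_const_nhds.sub (hAT ⟨x, hxy⟩)).norm.const_mul _)
        (Eventually.of_forall fun m => norm_exp_sub_exp_le (hA n) (hA m) (hcA n m) x s)
    have h4 : |s| ≤ |r| := by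
      rw [mem_ball_zero_iff, Real.norm_eq_abs] at hs
      exact hs.le.trans (le_abs_self r)
    have h5 := h3.trans (mul_le_mul_of_nonneg_right h4 (norm_nonneg _))
    have h6 : U s y - V n s y = -(U s (x - y)) + V n s (x - y) - (V n s x - U s x) := by
      simp only [map_sub]; abel
    rw [dist_eq_norm, h6]
    have h7 := norm_sub_le (-(U s (x - y)) + V n s (x - y)) (V n s x - U s x)
    have h8 := norm_add_le (-(U s (x - y))) (V n s (x - y))
    rw [norm_neg, hUn, hVn] at h8
    linarith
  refine ⟨U, ?_, hunit, fun s x => ?_⟩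
  · refine ContinuousLinearMap.ext fun y => ?_
    have h1 := hU 0 y
    simp only [V, zero_smul, NormedSpace.exp_zero] at h1
    exact tendsto_nhds_unique h1 tendsto_const_nhds
  · obtain ⟨h1, h2⟩ := hUT s x
    refine ⟨h1, ?_⟩
    rw [h2, ← map_smul]
    refine hasDerivAt_of_tendstoUniformlyOn (l := atTop) (s := Metric.ball 0 (|s| + 1))
      (f := fun n r => V n r x) (f' := fun n r => V n r (A n x))
      (g' := fun r => U r ((-Complex.I) • T x)) Metric.isOpen_ball ?_
      (Eventually.of_forall fun n r _ => hasDerivAt_exp_smul_apply (A n) x r)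
      (fun r _ => hU r x) (by simp)
    rw [Metric.tendstoUniformlyOn_iff]
    intro ε hε
    filter_upwards [Metric.tendstoUniformlyOn_iff.1 (hunif (|s| + 1) ((-Complex.I) • T x)) (ε / 2)
      (by positivity), Metric.tendsto_nhds.1 (hAT x) (ε / 2) (by positivity)] with n h3 h4 r hr
    refine (dist_triangle _ (V n r ((-Complex.I) • T x)) _).trans_lt ?_
    have h5 := h3 r hr
    have h6 : dist (V n r ((-Complex.I) • T x)) (V n r (A n x)) = dist (A n x) ((-Complex.I) • T x) := by
      rw [dist_eq_norm, ← map_sub, hVn, ← dist_eq_norm, dist_comm]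
    linarith

end Stone

/-! ### Conjugation by a unitary and bounded perturbations -/

section Perturbation

variable {H : Type*} [NormedAddCommGroup H] [InnerProductSpace ℂ H] [CompleteSpace H]

theorem unitary_apply_adjoint {V : H →L[ℂ] H} (hV : V ∈ unitary (H →L[ℂ] H)) (x : H) :
    V (ContinuousLinearMap.adjoint V x) = x :=
  congrArg (fun B : H →L[ℂ] H => B x) (Unitary.mem_iff.1 hV).2

theorem unitary_adjoint_apply {V : H →L[ℂ] H} (hV : V ∈ unitary (H →L[ℂ] H)) (x : H) :
    ContinuousLinearMap.adjoint V (V x) = x :=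
  congrArg (fun B : H →L[ℂ] H => B x) (Unitary.mem_iff.1 hV).1

theorem conjugate_apply (V : H →L[ℂ] H) (A : H →ₗ.[ℂ] H) (x : (conjugate V A).domain) :
    conjugate V A x = V (A ⟨ContinuousLinearMap.adjoint V x, x.2⟩) := rfl

theorem mem_domain_conjugate {V : H →L[ℂ] H} {A : H →ₗ.[ℂ] H} {x : H} :
    x ∈ (conjugate V A).domain ↔ ContinuousLinearMap.adjoint V x ∈ A.domain := Iff.rfl

/-- `V A V†` acts on `V x` as `V A x`. -/
theorem exists_conjugate_apply {V : H →L[ℂ] H} (hV : V ∈ unitary (H →L[ℂ] H)) (A : H →ₗ.[ℂ] H)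
    (x : A.domain) : ∃ h : V x ∈ (conjugate V A).domain, conjugate V A ⟨V x, h⟩ = V (A x) := by
  have h1 := unitary_adjoint_apply hV (x : H)
  have h : V x ∈ (conjugate V A).domain := by rw [mem_domain_conjugate, h1]; exact x.2
  refine ⟨h, ?_⟩
  rw [conjugate_apply]
  congr 2
  exact Subtype.ext h1

theorem HasImaginaryResolvents.conjugate {A : H →ₗ.[ℂ] H} (hA : HasImaginaryResolvents A)
    {V : H →L[ℂ] H} (hV : V ∈ unitary (H →L[ℂ] H)) :
    HasImaginaryResolvents (conjugate V A) := by
  constructor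
  · intro x y
    have h := hA.symm ⟨_, x.2⟩ ⟨_, y.2⟩
    rw [conjugate_apply, conjugate_apply]
    exact (ContinuousLinearMap.adjoint_inner_right V _ _).symm.trans
      (h.trans (ContinuousLinearMap.adjoint_inner_left V _ _))
  · obtain ⟨Λ, hΛ, hs⟩ := hA.surj
    refine ⟨Λ, hΛ, fun l hl y => ?_⟩
    obtain ⟨x, hx⟩ := hs l hl (ContinuousLinearMap.adjoint V y)
    obtain ⟨h1, h2⟩ := exists_conjugate_apply hV A x
    refine ⟨⟨V x, h1⟩, ?_⟩
    rw [h2, ← map_smul, ← map_add, hx, unitary_apply_adjoint hV]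

theorem kernel_conjugate {A : H →ₗ.[ℂ] H} {V : H →L[ℂ] H} (hV : V ∈ unitary (H →L[ℂ] H)) {Ω : H}
    (hA : kernel A = Submodule.span ℂ {Ω}) :
    kernel (conjugate V A) = Submodule.span ℂ {V Ω} := by
  have hmem : ∀ (B : H →ₗ.[ℂ] H) (x : H), x ∈ kernel B ↔ ∃ h : x ∈ B.domain, B ⟨x, h⟩ = 0 := by
    intro B x
    constructor
    · rintro ⟨z, hz, rfl⟩
      exact ⟨z.2, hz⟩
    · rintro ⟨h, hx⟩
      exact ⟨⟨x, h⟩, hx, rfl⟩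
  have h1 : Submodule.span ℂ {V Ω} = (Submodule.span ℂ {Ω}).map V.toLinearMap := by
    rw [Submodule.map_span, Set.image_singleton]; rfl
  rw [h1, ← hA]
  ext x
  rw [hmem]
  constructor
  · rintro ⟨h, hx⟩
    refine ⟨ContinuousLinearMap.adjoint V x, (hmem A _).2 ⟨h, ?_⟩, unitary_apply_adjoint hV x⟩
    rw [conjugate_apply] at hx
    have h2 := norm_unitary_apply hV (A ⟨ContinuousLinearMap.adjoint V x, h⟩)
    rw [hx, norm_zero] at h2
    exact norm_eq_zero.1 h2.symm
  · rintro ⟨z, hz, rfl⟩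
    obtain ⟨h, hz⟩ := (hmem A z).1 hz
    obtain ⟨h2, h3⟩ := exists_conjugate_apply hV A ⟨z, h⟩
    refine ⟨h2, h3.trans ?_⟩
    rw [hz, map_zero]

/-- `τ A + B`, for a bounded symmetric `B` and a real `τ ≠ 0`, has imaginary resolvents if `A`
does. -/
theorem HasImaginaryResolvents.smul_add_bounded {A : H →ₗ.[ℂ] H} (hA : HasImaginaryResolvents A)
    {τ : ℝ} (hτ : τ ≠ 0) {B : H →L[ℂ] H} (hB : ∀ x y, inner ℂ (B x) y = inner ℂ x (B y)) :
    HasImaginaryResolvents ((τ : ℂ) • A + B.toLinearMap.toPMap ⊤) := by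
  have happ : ∀ x : ((τ : ℂ) • A + B.toLinearMap.toPMap ⊤).domain,
      ((τ : ℂ) • A + B.toLinearMap.toPMap ⊤) x = (τ : ℂ) • A ⟨x, x.2.1⟩ + B x := fun x => rfl
  obtain ⟨Λ, hΛ, hs⟩ := hA.surj
  have hτ' := abs_pos.2 hτ
  refine hasImaginaryResolvents_of_approx (Λ := |τ| * Λ + ‖B‖ + 1) ?_ (by positivity) ?_
  · intro x y
    have h := hA.symm ⟨x, x.2.1⟩ ⟨y, y.2.1⟩
    simp only at h
    rw [happ, happ, inner_add_left, inner_add_right, hB, inner_smul_left, inner_smul_right, h,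
      Complex.conj_ofReal]
  · intro l hl
    have hl0 : 0 < |l| := lt_of_lt_of_le (by positivity) hl
    have hl' : l / τ ≠ 0 := div_ne_zero (abs_pos.1 hl0) hτ
    have hl1 : Λ ≤ |l / τ| := by
      rw [abs_div, le_div_iff₀ hτ']; nlinarith [norm_nonneg B]
    obtain ⟨R, hR1, hR2, hR3⟩ := exists_bounded_resolvent hA.symm hl' (hs _ hl1)
    have hτc : (τ : ℂ) ≠ 0 := by exact_mod_cast hτ
    let R' : H →ₗ[ℂ] ((τ : ℂ) • A + B.toLinearMap.toPMap ⊤).domain :=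
      ((τ : ℂ)⁻¹ • R).toLinearMap.codRestrict _ (fun y =>
        ⟨Submodule.smul_mem _ _ (hR1 y).1, trivial⟩)
    have hR' : ∀ y, (R' y : H) = (τ : ℂ)⁻¹ • R y := fun y => rfl
    refine ⟨R', ‖B‖ / |l|, ?_, fun y => ?_⟩
    · rw [div_lt_one hl0]; nlinarith
    · obtain ⟨h1, h2⟩ := hR1 y
      have h3 : A ⟨(R' y : H), (R' y).2.1⟩ = (τ : ℂ)⁻¹ • A ⟨R y, h1⟩ := by
        rw [← LinearPMap.map_smul]; rfl
      have h4 : ((τ : ℂ) • A + B.toLinearMap.toPMap ⊤) (R' y) +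
          (Complex.I * (l : ℂ)) • (R' y : H) - y = B ((τ : ℂ)⁻¹ • R y) := by
        rw [happ, h3, hR', smul_smul, mul_inv_cancel₀ hτc, one_smul, eq_sub_of_add_eq h2]
        push_cast
        rw [smul_smul, div_eq_mul_inv]
        module
      rw [h4]
      refine (B.le_opNorm _).trans ?_
      rw [norm_smul, norm_inv, Complex.norm_real, Real.norm_eq_abs, div_mul_eq_mul_div,
        mul_div_assoc]
      refine mul_le_mul_of_nonneg_left ?_ (norm_nonneg _)
      have h5 := hR3 y
      rw [inv_mul_le_iff₀ hτ']
      refine h5.trans (le_of_eq ?_)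
      rw [abs_div]
      field_simp

end Perturbation

/-! ### Fock space vectors and their wave functions -/

section FockSpace

variable {d : ℕ}

theorem measurable_wave (ψ : Fock d) (n : ℕ) : Measurable (wave ψ n) :=
  (Lp.stronglyMeasurable (ψ n : NBody d n)).measurable

theorem fock_ext {ψ φ : Fock d} (h : ∀ n, wave ψ n =ᵐ[volume] wave φ n) : ψ = φ := by
  apply lp.ext
  funext n
  exact Subtype.ext (Lp.ext (h n))

theorem enorm_sq_Lp {X : Type*} [MeasurableSpace X] {μ : Measure X} (g : Lp ℂ 2 μ) :
    ‖g‖ₑ ^ 2 = ∫⁻ k, ‖g k‖ₑ ^ 2 ∂μ := by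
  have h := eLpNorm_nnreal_pow_eq_lintegral (f := g) (μ := μ) (p := 2) (by norm_num)
  rw [Lp.enorm_def]
  simpa using h

theorem enorm_sq_eq (ψ : Fock d) :
    ‖ψ‖ₑ ^ 2 = ∑' n, ∫⁻ k, ‖wave ψ n k‖ₑ ^ 2 := by
  have h := lp.hasSum_norm (p := 2) (by norm_num) ψ
  have h1 : HasSum (fun n => ‖ψ n‖ ^ 2) (‖ψ‖ ^ 2) := by simpa using h
  have h2 : ENNReal.ofReal (‖ψ‖ ^ 2) = ∑' n, ENNReal.ofReal (‖ψ n‖ ^ 2) := by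
    rw [← h1.tsum_eq, ENNReal.ofReal_tsum_of_nonneg (fun n => by positivity) h1.summable]
  have h3 : ∀ n, ENNReal.ofReal (‖ψ n‖ ^ 2) = ∫⁻ k, ‖wave ψ n k‖ₑ ^ 2 := by
    intro n
    rw [ENNReal.ofReal_pow (norm_nonneg _), ofReal_norm]
    exact enorm_sq_Lp (ψ n : NBody d n)
  rw [← ofReal_norm, ← ENNReal.ofReal_pow (norm_nonneg _), h2]
  exact tsum_congr h3

theorem norm_sq_le_of_lintegral_le {ψ : Fock d} {C : ℝ} (hC : 0 ≤ C)
    (h : ∑' n, ∫⁻ k, ‖wave ψ n k‖ₑ ^ 2 ≤ ENNReal.ofReal C) : ‖ψ‖ ^ 2 ≤ C := by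
  rw [← enorm_sq_eq, ← ofReal_norm, ← ENNReal.ofReal_pow (norm_nonneg _)] at h
  exact (ENNReal.ofReal_le_ofReal_iff hC).1 h

theorem permute_apply_ae (n : ℕ) (σ : Equiv.Perm (Fin n)) (g : NBody d n) :
    permute d n σ g =ᵐ[volume] fun k => g (k ∘ σ) :=
  Lp.coeFn_compMeasurePreserving g (measurePreserving_perm d n σ)

theorem wave_comp_perm (ψ : Fock d) (n : ℕ) (σ : Equiv.Perm (Fin n)) :
    (fun k => wave ψ n (k ∘ σ)) =ᵐ[volume] wave ψ n := by
  have h : permute d n σ (ψ n) = ψ n := by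
    have h1 := (ψ n).2
    simp only [symmSubspace, Submodule.mem_iInf, LinearMap.mem_eqLocus] at h1
    exact h1 σ
  have h2 := permute_apply_ae n σ (ψ n : NBody d n)
  rw [h] at h2
  exact h2.symm

/-- Symmetric square integrable functions with summable norms are the wave functions of a Fock space
vector. -/
theorem exists_fock (u : ∀ n, (Fin n → Momentum d) → ℂ)
    (hm : ∀ n, AEStronglyMeasurable (u n) volume)
    (hs : ∀ n (σ : Equiv.Perm (Fin n)), (fun k => u n (k ∘ σ)) =ᵐ[volume] u n)
    (hfin : ∑' n, ∫⁻ k, ‖u n k‖ₑ ^ 2 ≠ ∞) :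
    ∃ ψ : Fock d, ∀ n, wave ψ n =ᵐ[volume] u n := by
  have hn : ∀ n, ∫⁻ k, ‖u n k‖ₑ ^ 2 ≠ ∞ := fun n => ENNReal.ne_top_of_tsum_ne_top hfin n
  have hL : ∀ n, MemLp (u n) 2 volume := by
    intro n
    refine ⟨hm n, ?_⟩
    have h := eLpNorm_nnreal_pow_eq_lintegral (f := u n) (μ := volume) (p := 2) (by norm_num)
    have h1 : eLpNorm (u n) 2 volume ^ 2 = ∫⁻ k, ‖u n k‖ₑ ^ 2 := by simpa using h
    have h2 := hn n
    rw [← h1] at h2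
    exact lt_top_iff_ne_top.2 fun h3 => h2 (by rw [h3]; simp)
  let v : ∀ n, symmSubspace d n := fun n => ⟨(hL n).toLp, by
    simp only [symmSubspace, Submodule.mem_iInf, LinearMap.mem_eqLocus]
    intro σ
    refine Lp.ext ?_
    have h1 := permute_apply_ae n σ (hL n).toLp
    have h2 := (measurePreserving_perm d n σ).quasiMeasurePreserving.ae_eq_comp (hL n).coeFn_toLp
    exact h1.trans (h2.trans ((hs n σ).trans (hL n).coeFn_toLp.symm))⟩
  have hv : ∀ n, ENNReal.ofReal (‖v n‖ ^ 2) = ∫⁻ k, ‖u n k‖ₑ ^ 2 := by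
    intro n
    rw [ENNReal.ofReal_pow (norm_nonneg _), ofReal_norm]
    refine (enorm_sq_Lp (v n : NBody d n)).trans (lintegral_congr_ae ?_)
    filter_upwards [(hL n).coeFn_toLp] with k hk
    change ‖(hL n).toLp (u n) k‖ₑ ^ 2 = _
    rw [hk]
  have hmem : Memℓp v 2 := by
    refine memℓp_gen ?_
    have h1 : Summable fun n => (∫⁻ k, ‖u n k‖ₑ ^ 2).toReal := ENNReal.summable_toReal hfin
    refine h1.congr fun n => ?_
    rw [← hv n, ENNReal.toReal_ofReal (by positivity)]
    simp
  exact ⟨⟨v, hmem⟩, fun n => (hL n).coeFn_toLp⟩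

theorem inner_eq_tsum_integral (ψ φ : Fock d) :
    inner ℂ ψ φ = ∑' n, ∫ k, inner ℂ (wave ψ n k) (wave φ n k) := by
  rw [lp.inner_eq_tsum]
  exact tsum_congr fun n => L2.inner_def (𝕜 := ℂ) (ψ n : NBody d n) (φ n : NBody d n)

theorem inner_congr_wave {ψ φ ψ' φ' : Fock d}
    (h : ∀ n, ∀ᵐ k, inner ℂ (wave ψ n k) (wave φ n k) = inner ℂ (wave ψ' n k) (wave φ' n k)) :
    inner ℂ ψ φ = inner ℂ ψ' φ' := by
  rw [inner_eq_tsum_integral, inner_eq_tsum_integral]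
  exact tsum_congr fun n => integral_congr_ae (h n)

/-! ### The field energy -/

/-- The energy `|k₁| + ⋯ + |kₙ|` of `n` bosons. -/
def bosonEnergy {n : ℕ} (k : Fin n → Momentum d) : ℝ := ∑ i, ‖k i‖

theorem bosonEnergy_nonneg {n : ℕ} (k : Fin n → Momentum d) : 0 ≤ bosonEnergy k :=
  Finset.sum_nonneg fun _ _ => norm_nonneg _

theorem measurable_bosonEnergy (n : ℕ) :
    Measurable (bosonEnergy : (Fin n → Momentum d) → ℝ) := by
  unfold bosonEnergy
  fun_prop

theorem bosonEnergy_comp_perm {n : ℕ} (σ : Equiv.Perm (Fin n)) (k : Fin n → Momentum d) :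
    bosonEnergy (k ∘ σ) = bosonEnergy k :=
  Equiv.sum_comp σ fun i => ‖k i‖

/-- Multiplication of all wave functions by a function of the field energy. -/
theorem exists_energy_mul {h : ℝ → ℂ} (hh : Measurable h) (ψ : Fock d)
    (hfin : ∑' n, ∫⁻ k : Fin n → Momentum d, ‖h (bosonEnergy k) * wave ψ n k‖ₑ ^ 2 ≠ ∞) :
    ∃ χ : Fock d, ∀ n, wave χ n =ᵐ[volume] fun k => h (bosonEnergy k) * wave ψ n k := by
  refine exists_fock _ (fun n => ?_) (fun n σ => ?_) hfin
  · exact ((hh.comp (measurable_bosonEnergy n)).mul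
      (measurable_wave ψ n)).aestronglyMeasurable
  · filter_upwards [wave_comp_perm ψ n σ] with k hk
    rw [hk, bosonEnergy_comp_perm]

theorem exists_energy_mul_of_bounded {h : ℝ → ℂ} (hh : Measurable h) {C : ℝ}
    (hC : ∀ t, 0 ≤ t → ‖h t‖ ≤ C) (ψ : Fock d) :
    ∃ χ : Fock d, ∀ n, wave χ n =ᵐ[volume] fun k => h (bosonEnergy k) * wave ψ n k := by
  refine exists_energy_mul hh ψ (ne_top_of_le_ne_top (b := ENNReal.ofReal C ^ 2 * ‖ψ‖ₑ ^ 2) ?_ ?_)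
  · exact ENNReal.mul_ne_top (by finiteness) (by finiteness)
  · rw [enorm_sq_eq, ← ENNReal.tsum_mul_left]
    refine ENNReal.tsum_le_tsum fun n => ?_
    rw [← lintegral_const_mul' _ _ (by finiteness)]
    refine lintegral_mono fun k => ?_
    simp only [enorm_mul, mul_pow]
    gcongr
    rw [← ofReal_norm]
    exact ENNReal.ofReal_le_ofReal (hC _ (bosonEnergy_nonneg k))

theorem mem_energyGraph (ψ : (fieldEnergy d).domain) :
    ((ψ : Fock d), fieldEnergy d ψ) ∈ energyGraph d :=
  Submodule.mem_graph_toLinearPMap (energyGraph_functional d) ψ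

theorem wave_fieldEnergy (ψ : (fieldEnergy d).domain) (n : ℕ) :
    wave (fieldEnergy d ψ) n =ᵐ[volume] fun k => (bosonEnergy k : ℂ) * wave (ψ : Fock d) n k :=
  mem_energyGraph ψ n

theorem exists_fieldEnergy_eq {ψ χ : Fock d}
    (h : ∀ n, wave χ n =ᵐ[volume] fun k => (bosonEnergy k : ℂ) * wave ψ n k) :
    ∃ hψ : ψ ∈ (fieldEnergy d).domain, fieldEnergy d ⟨ψ, hψ⟩ = χ := by
  have hg : (ψ, χ) ∈ energyGraph d := h
  have hψ : ψ ∈ (fieldEnergy d).domain := ⟨(ψ, χ), hg, rfl⟩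
  refine ⟨hψ, fock_ext fun n => ?_⟩
  filter_upwards [wave_fieldEnergy ⟨ψ, hψ⟩ n, h n] with k h1 h2
  rw [h1, h2]

theorem norm_ofReal_add_imaginary_sq (t l : ℝ) :
    ‖(t : ℂ) + Complex.I * (l : ℂ)‖ ^ 2 = t ^ 2 + l ^ 2 := by
  rw [← Complex.normSq_eq_norm_sq, Complex.normSq_apply]
  simp; ring

theorem fieldEnergy_surj {l : ℝ} (hl : l ≠ 0) (y : Fock d) :
    ∃ x : (fieldEnergy d).domain, fieldEnergy d x + (Complex.I * (l : ℂ)) • (x : Fock d) = y := by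
  have hl' := abs_pos.2 hl
  have hne : ∀ t : ℝ, (t : ℂ) + Complex.I * (l : ℂ) ≠ 0 := fun t h => by
    have h1 := norm_ofReal_add_imaginary_sq t l
    rw [h, norm_zero] at h1
    nlinarith [sq_nonneg t, pow_pos hl' 2, sq_abs l]
  have hpos : ∀ t : ℝ, 0 < ‖(t : ℂ) + Complex.I * (l : ℂ)‖ := fun t => norm_pos_iff.2 (hne t)
  have h1 : Measurable fun t : ℝ => ((t : ℂ) + Complex.I * (l : ℂ))⁻¹ := by fun_prop
  obtain ⟨x, hx⟩ := exists_energy_mul_of_bounded h1 (C := |l|⁻¹) (fun t _ => by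
    rw [norm_inv]
    refine inv_anti₀ hl' (abs_le_of_sq_le_sq ?_ (norm_nonneg _))
    rw [norm_ofReal_add_imaginary_sq]
    nlinarith [sq_nonneg t]) y
  obtain ⟨z, hz⟩ := exists_energy_mul_of_bounded (h1.const_mul 1 |>.mul Complex.measurable_ofReal)
    (C := 1) (fun t _ => by
      rw [Pi.mul_apply, one_mul, norm_mul, norm_inv, inv_mul_le_iff₀ (hpos t), mul_one,
        Complex.norm_real, Real.norm_eq_abs]
      refine abs_le_of_sq_le_sq ?_ (norm_nonneg _)
      rw [norm_ofReal_add_imaginary_sq]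
      nlinarith [sq_nonneg l]) y
  obtain ⟨h2, h3⟩ := exists_fieldEnergy_eq (ψ := x) (χ := z) (fun n => by
    filter_upwards [hx n, hz n] with k h4 h5
    rw [h4, h5, Pi.mul_apply]
    ring)
  refine ⟨⟨x, h2⟩, fock_ext fun n => ?_⟩
  rw [h3]
  filter_upwards [hx n, hz n, wave_add z ((Complex.I * (l : ℂ)) • x) n,
    wave_smul (Complex.I * (l : ℂ)) x n] with k h4 h5 h6 h7
  rw [h6, Pi.add_apply, h7, Pi.smul_apply, smul_eq_mul, h4, h5, Pi.mul_apply]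
  have h8 := hne (bosonEnergy k)
  field_simp

theorem fieldEnergy_symm : (fieldEnergy d).IsFormalAdjoint (fieldEnergy d) := by
  intro x y
  refine inner_congr_wave fun n => ?_
  filter_upwards [wave_fieldEnergy x n, wave_fieldEnergy y n] with k h1 h2
  rw [h1, h2]
  simp only [RCLike.inner_apply, map_mul, Complex.conj_ofReal]
  ring

theorem fieldEnergy_hasImaginaryResolvents : HasImaginaryResolvents (fieldEnergy d) :=
  ⟨fieldEnergy_symm, 1, one_pos, fun _ hl y =>
    fieldEnergy_surj (abs_pos.1 (one_pos.trans_le hl)) y⟩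

theorem exists_sqrtEnergy (ψ : (fieldEnergy d).domain) :
    ∃ χ : Fock d, ∀ n, wave χ n =ᵐ[volume] fun k =>
      ((√(bosonEnergy k) : ℝ) : ℂ) * wave (ψ : Fock d) n k := by
  refine exists_energy_mul (h := fun t => ((√t : ℝ) : ℂ)) (by fun_prop) _
    (ne_top_of_le_ne_top (b := ‖(ψ : Fock d)‖ₑ ^ 2 + ‖fieldEnergy d ψ‖ₑ ^ 2) (by finiteness) ?_)
  rw [enorm_sq_eq, enorm_sq_eq, ← ENNReal.tsum_add]
  refine ENNReal.tsum_le_tsum fun n => ?_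
  rw [← lintegral_add_left ((measurable_wave _ n).enorm.pow_const 2)]
  refine lintegral_mono_ae ?_
  filter_upwards [wave_fieldEnergy ψ n] with k hk
  have h0 := bosonEnergy_nonneg k
  rw [hk, enorm_mul, enorm_mul, mul_pow, mul_pow, ← one_add_mul]
  gcongr
  rw [← ofReal_norm, ← ofReal_norm, ← ENNReal.ofReal_pow (norm_nonneg _),
    ← ENNReal.ofReal_pow (norm_nonneg _), ← ENNReal.ofReal_one,
    ← ENNReal.ofReal_add zero_le_one (by positivity)]
  refine ENNReal.ofReal_le_ofReal ?_
  rw [Complex.norm_real, Complex.norm_real, Real.norm_eq_abs, Real.norm_eq_abs, sq_abs, sq_abs,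
    Real.sq_sqrt h0]
  nlinarith [sq_nonneg (bosonEnergy k - 1)]

/-- The vector `E^{1/2} ψ`, for `ψ` in the domain of the field energy. -/
def sqrtEnergy (ψ : (fieldEnergy d).domain) : Fock d := (exists_sqrtEnergy ψ).choose

theorem wave_sqrtEnergy (ψ : (fieldEnergy d).domain) (n : ℕ) :
    wave (sqrtEnergy ψ) n =ᵐ[volume] fun k =>
      ((√(bosonEnergy k) : ℝ) : ℂ) * wave (ψ : Fock d) n k :=
  (exists_sqrtEnergy ψ).choose_spec n

theorem inner_fieldEnergy (ψ φ : (fieldEnergy d).domain) :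
    inner ℂ (ψ : Fock d) (fieldEnergy d φ) = inner ℂ (sqrtEnergy ψ) (sqrtEnergy φ) := by
  refine inner_congr_wave fun n => ?_
  filter_upwards [wave_fieldEnergy φ n, wave_sqrtEnergy φ n, wave_sqrtEnergy ψ n] with k h1 h2 h3
  rw [h1, h2, h3]
  simp only [RCLike.inner_apply, map_mul, Complex.conj_ofReal]
  have h : ((√(bosonEnergy k) : ℝ) : ℂ) * ((√(bosonEnergy k) : ℝ) : ℂ) = (bosonEnergy k : ℂ) := by
    rw [← Complex.ofReal_mul, Real.mul_self_sqrt (bosonEnergy_nonneg k)]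
  rw [← h]
  ring

end FockSpace

/-! ### Creation operators on the domain of the field energy -/

section Creation

variable {d : ℕ}

/-- Removing the `i`-th entry of a permuted tuple permutes what remains of the original tuple once
its `σ i`-th entry is removed. -/
theorem exists_perm_removeNth {X : Type*} {n : ℕ} (i : Fin (n + 1)) (σ : Equiv.Perm (Fin (n + 1))) :
    ∃ σ' : Equiv.Perm (Fin n), ∀ k : Fin (n + 1) → X,
      (i.removeNth (k ∘ σ) : Fin n → X) = ((σ i).removeNth k : Fin n → X) ∘ σ' := by
  refine ⟨(finSuccAboveEquiv i).trans ((σ.subtypeEquiv fun a => by simp).trans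
    (finSuccAboveEquiv (σ i)).symm), fun k => funext fun j => ?_⟩
  simp only [Fin.removeNth_apply, Function.comp_apply, Equiv.trans_apply]
  congr 1
  have h := (finSuccAboveEquiv (σ i)).apply_symm_apply
    ((σ.subtypeEquiv fun a => by simp : {x // x ≠ i} ≃ {x // x ≠ σ i}) (finSuccAboveEquiv i j))
  have h1 := congrArg Subtype.val h
  rw [finSuccAboveEquiv_apply] at h1
  exact h1.symm

theorem lintegral_mul_removeNth {n : ℕ} (i : Fin (n + 1)) {A : Momentum d → ℝ≥0∞}
    {B : (Fin n → Momentum d) → ℝ≥0∞} (hA : Measurable A) (hB : Measurable B) :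
    ∫⁻ k : Fin (n + 1) → Momentum d, A (k i) * B (i.removeNth k) =
      (∫⁻ k, A k) * ∫⁻ k, B k := by
  have h := (volume_preserving_piFinSuccAbove (fun _ : Fin (n + 1) => Momentum d) i).lintegral_comp
    (f := fun z => A z.1 * B z.2) (by fun_prop)
  rw [← lintegral_prod_mul hA.aemeasurable hB.aemeasurable]
  exact h

/-- Averaging over the boson that is split off. -/
theorem lintegral_average_removeNth {n : ℕ} {a : Momentum d → ℝ} {b : (Fin n → Momentum d) → ℝ}
    (ha : Measurable a) (hb : Measurable b) (ha0 : ∀ k, 0 ≤ a k) (hb0 : ∀ k, 0 ≤ b k) :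
    ∫⁻ k : Fin (n + 1) → Momentum d,
        ENNReal.ofReal (((n : ℝ) + 1)⁻¹ * ∑ i, a (k i) * b (i.removeNth k)) =
      (∫⁻ k, ENNReal.ofReal (a k)) * ∫⁻ k, ENNReal.ofReal (b k) := by
  have hmeas : ∀ i : Fin (n + 1), Measurable fun k : Fin (n + 1) → Momentum d =>
      (i.removeNth k : Fin n → Momentum d) := fun i =>
    measurable_pi_lambda _ fun j => measurable_pi_apply _
  have h1 : ∀ k : Fin (n + 1) → Momentum d,
      ENNReal.ofReal (((n : ℝ) + 1)⁻¹ * ∑ i, a (k i) * b (i.removeNth k)) =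
      ENNReal.ofReal ((n : ℝ) + 1)⁻¹ *
        ∑ i, ENNReal.ofReal (a (k i)) * ENNReal.ofReal (b (i.removeNth k)) := by
    intro k
    rw [ENNReal.ofReal_mul (by positivity),
      ENNReal.ofReal_sum_of_nonneg fun i _ => mul_nonneg (ha0 _) (hb0 _)]
    simp only [ENNReal.ofReal_mul (ha0 _)]
  simp only [h1]
  rw [lintegral_const_mul' _ _ ENNReal.ofReal_ne_top, lintegral_finsetSum _ (fun i _ => by
    have := hmeas i
    fun_prop)]
  simp only [fun i : Fin (n + 1) => lintegral_mul_removeNth i (A := fun k => ENNReal.ofReal (a k))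
    (B := fun k => ENNReal.ofReal (b k)) (by fun_prop) (by fun_prop)]
  rw [Finset.sum_const, Finset.card_univ, Fintype.card_fin, nsmul_eq_mul, ← mul_assoc]
  have h2 : ENNReal.ofReal ((n : ℝ) + 1)⁻¹ * ((n + 1 : ℕ) : ℝ≥0∞) = 1 := by
    rw [← ENNReal.ofReal_natCast, ← ENNReal.ofReal_mul (by positivity)]
    push_cast
    rw [inv_mul_cancel₀ (by positivity), ENNReal.ofReal_one]
  rw [h2, one_mul]

/-- The wave functions of `a†(f) ψ`. -/
def creationWave (f : OneParticle d) (ψ : Fock d) : ∀ n, (Fin n → Momentum d) → ℂ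
  | 0 => 0
  | n + 1 => fun k =>
    (((√((n : ℝ) + 1))⁻¹ : ℝ) : ℂ) * ∑ i : Fin (n + 1), f (k i) * wave ψ n (i.removeNth k)

theorem measurable_oneParticle (f : OneParticle d) : Measurable f :=
  (Lp.stronglyMeasurable f).measurable

theorem measurable_creationWave (f : OneParticle d) (ψ : Fock d) (n : ℕ) :
    Measurable (creationWave f ψ n) := by
  cases n with
  | zero => exact measurable_const
  | succ n =>
    have hmeas : ∀ i : Fin (n + 1), Measurable fun k : Fin (n + 1) → Momentum d =>
        (i.removeNth k : Fin n → Momentum d) := fun i =>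
      measurable_pi_lambda _ fun j => measurable_pi_apply _
    refine Measurable.const_mul (Finset.measurable_sum _ fun i _ => ?_) _
    exact ((measurable_oneParticle f).comp (measurable_pi_apply i)).mul
      ((measurable_wave ψ n).comp (hmeas i))

theorem creationWave_comp_perm (f : OneParticle d) (ψ : Fock d) (n : ℕ)
    (σ : Equiv.Perm (Fin n)) :
    (fun k => creationWave f ψ n (k ∘ σ)) =ᵐ[volume] creationWave f ψ n := by
  cases n with
  | zero => rfl
  | succ n =>
    choose σ' hσ' using fun i => exists_perm_removeNth (X := Momentum d) i σ
    have h : ∀ᵐ k : Fin (n + 1) → Momentum d, ∀ i : Fin (n + 1),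
        wave ψ n (((σ i).removeNth k : Fin n → Momentum d) ∘ σ' i) =
          wave ψ n ((σ i).removeNth k) :=
      ae_all_iff.2 fun i => (quasiMeasurePreserving_removeNth d n (σ i)).ae
        (wave_comp_perm ψ n (σ' i))
    filter_upwards [h] with k hk
    simp only [creationWave]
    congr 1
    rw [← Equiv.sum_comp σ fun i => f (k i) * wave ψ n (i.removeNth k)]
    refine Finset.sum_congr rfl fun i _ => ?_
    rw [hσ', hk, Function.comp_apply]

theorem mem_creationGraph (f : OneParticle d) (ψ : (creation f).domain) :
    ((ψ : Fock d), creation f ψ) ∈ creationGraph f :=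
  Submodule.mem_graph_toLinearPMap (creationGraph_functional f) ψ

theorem wave_creation (f : OneParticle d) (ψ : (creation f).domain) (n : ℕ) :
    wave (creation f ψ) n =ᵐ[volume] creationWave f ψ n := by
  cases n with
  | zero => exact (mem_creationGraph f ψ).1
  | succ n => exact (mem_creationGraph f ψ).2 n

theorem exists_creation_eq {f : OneParticle d} {ψ χ : Fock d}
    (h : ∀ n, wave χ n =ᵐ[volume] creationWave f ψ n) :
    ∃ hψ : ψ ∈ (creation f).domain, creation f ⟨ψ, hψ⟩ = χ := by
  have hg : (ψ, χ) ∈ creationGraph f := ⟨h 0, fun n => h (n + 1)⟩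
  have hψ : ψ ∈ (creation f).domain := ⟨(ψ, χ), hg, rfl⟩
  refine ⟨hψ, fock_ext fun n => ?_⟩
  filter_upwards [wave_creation f ⟨ψ, hψ⟩ n, h n] with k h1 h2
  rw [h1, h2]

theorem mem_domain_creation {f : OneParticle d} {ψ : Fock d}
    (hfin : ∑' n, ∫⁻ k, ‖creationWave f ψ n k‖ₑ ^ 2 ≠ ∞) : ψ ∈ (creation f).domain := by
  obtain ⟨χ, hχ⟩ := exists_fock (creationWave f ψ)
    (fun n => (measurable_creationWave f ψ n).aestronglyMeasurable)
    (creationWave_comp_perm f ψ) hfin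
  exact (exists_creation_eq hχ).1

theorem ae_forall_ne_zero [NeZero d] (n : ℕ) :
    ∀ᵐ k : Fin n → Momentum d, ∀ i, k i ≠ 0 := by
  refine ae_all_iff.2 fun i => ?_
  have h : ∀ᵐ x : Momentum d, x ≠ 0 := Measure.ae_ne volume 0
  exact (Measure.quasiMeasurePreserving_eval (fun _ : Fin n => (volume : Measure (Momentum d)))
    i).ae h

theorem bosonEnergy_succ {n : ℕ} (i : Fin (n + 1)) (k : Fin (n + 1) → Momentum d) :
    bosonEnergy k = ‖k i‖ + bosonEnergy (i.removeNth k : Fin n → Momentum d) :=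
  Fin.sum_univ_succAbove _ i

/-- The pointwise bound behind all estimates of creation operators: the Cauchy–Schwarz inequality
with weights `|kᵢ|`. -/
theorem norm_creationWave_sq_le (f : OneParticle d) (ψ : Fock d) {n : ℕ}
    {k : Fin (n + 1) → Momentum d} (hk : ∀ i, k i ≠ 0) :
    ‖creationWave f ψ (n + 1) k‖ ^ 2 ≤ bosonEnergy k * (((n : ℝ) + 1)⁻¹ *
      ∑ i, (‖f (k i)‖ ^ 2 / ‖k i‖) * ‖wave ψ n (i.removeNth k)‖ ^ 2) := by
  have h1 : ‖∑ i : Fin (n + 1), f (k i) * wave ψ n (i.removeNth k)‖ ^ 2 ≤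
      (∑ i, ‖k i‖) * ∑ i, (‖f (k i)‖ ^ 2 / ‖k i‖) * ‖wave ψ n (i.removeNth k)‖ ^ 2 := by
    refine (pow_le_pow_left₀ (norm_nonneg _) (norm_sum_le _ _) 2).trans ?_
    refine Finset.sum_sq_le_sum_mul_sum_of_sq_le_mul _ (fun i _ => norm_nonneg _)
      (fun i _ => by positivity) (fun i _ => le_of_eq ?_)
    have := norm_pos_iff.2 (hk i)
    rw [norm_mul]
    field_simp
  rw [creationWave, norm_mul, mul_pow, Complex.norm_real, Real.norm_eq_abs, sq_abs, inv_pow,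
    Real.sq_sqrt (by positivity), bosonEnergy, mul_left_comm]
  exact mul_le_mul_of_nonneg_left h1 (by positivity)

theorem enorm_sq_eq_ofReal (z : ℂ) : ‖z‖ₑ ^ 2 = ENNReal.ofReal (‖z‖ ^ 2) := by
  rw [← ofReal_norm, ENNReal.ofReal_pow (norm_nonneg _)]

/-- The coupling function `|f(k)|² / |k|` is integrable, i.e. `𝓔` is finite. -/
def FiniteInfraredEnergy (f : OneParticle d) : Prop :=
  Integrable fun k : Momentum d => ‖f k‖ ^ 2 / ‖k‖

theorem infraredEnergy_nonneg (f : OneParticle d) : 0 ≤ infraredEnergy f :=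
  integral_nonneg fun k => by positivity

theorem lintegral_infrared {f : OneParticle d} (hf : FiniteInfraredEnergy f) :
    ∫⁻ k : Momentum d, ENNReal.ofReal (‖f k‖ ^ 2 / ‖k‖) = ENNReal.ofReal (infraredEnergy f) :=
  (ofReal_integral_eq_lintegral_ofReal hf (Eventually.of_forall fun k => by positivity)).symm

/-- `‖a†(f) ψ‖² ≤ ‖f‖² ‖ψ‖² + 𝓔 ‖E^{1/2} ψ‖²`, before `ψ` is known to lie in the domain of
`a†(f)`. In the pointwise bound the energy of the `n + 1` bosons splits into that of the created one,
which gives the first term, and that of the others, which gives the second. -/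
theorem tsum_lintegral_creationWave_le [NeZero d] {f : OneParticle d}
    (hf : FiniteInfraredEnergy f) (ψ : (fieldEnergy d).domain) :
    ∑' n, ∫⁻ k, ‖creationWave f ψ n k‖ₑ ^ 2 ≤
      ENNReal.ofReal (‖f‖ ^ 2 * ‖(ψ : Fock d)‖ ^ 2 + infraredEnergy f * ‖sqrtEnergy ψ‖ ^ 2) := by
  have hE := infraredEnergy_nonneg f
  have hfm := measurable_oneParticle f
  have hlevel : ∀ n, ∫⁻ k, ‖creationWave f ψ (n + 1) k‖ₑ ^ 2 ≤
      (‖f‖ₑ ^ 2 * ∫⁻ k, ‖wave (ψ : Fock d) n k‖ₑ ^ 2) +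
        ENNReal.ofReal (infraredEnergy f) * ∫⁻ k, ‖wave (sqrtEnergy ψ) n k‖ₑ ^ 2 := by
    intro n
    have hwm := measurable_wave (ψ : Fock d) n
    have hem := measurable_bosonEnergy (d := d) n
    have h1 := lintegral_average_removeNth (n := n) (a := fun k => ‖f k‖ ^ 2)
      (b := fun k => ‖wave (ψ : Fock d) n k‖ ^ 2) (by fun_prop) (by fun_prop)
      (fun k => by positivity) (fun k => by positivity)
    have h2 := lintegral_average_removeNth (n := n) (a := fun k => ‖f k‖ ^ 2 / ‖k‖)
      (b := fun k => bosonEnergy k * ‖wave (ψ : Fock d) n k‖ ^ 2) (by fun_prop) (by fun_prop)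
      (fun k => by positivity) (fun k => mul_nonneg (bosonEnergy_nonneg k) (by positivity))
    have h3 : ∫⁻ k, ENNReal.ofReal (bosonEnergy k * ‖wave (ψ : Fock d) n k‖ ^ 2) =
        ∫⁻ k, ‖wave (sqrtEnergy ψ) n k‖ₑ ^ 2 := by
      refine lintegral_congr_ae ?_
      filter_upwards [wave_sqrtEnergy ψ n] with k hk
      rw [hk, enorm_sq_eq_ofReal, norm_mul, mul_pow, Complex.norm_real, Real.norm_eq_abs, sq_abs,
        Real.sq_sqrt (bosonEnergy_nonneg k)]
    have h4 : ∫⁻ k, ENNReal.ofReal (‖f k‖ ^ 2) = ‖f‖ₑ ^ 2 := by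
      rw [enorm_sq_Lp]
      exact lintegral_congr fun k => (enorm_sq_eq_ofReal _).symm
    simp only [← enorm_sq_eq_ofReal (wave (ψ : Fock d) n _)] at h1
    rw [h4] at h1
    rw [lintegral_infrared hf, h3] at h2
    rw [← h1, ← h2, ← lintegral_add_left]
    · refine lintegral_mono_ae ?_
      filter_upwards [ae_forall_ne_zero (n + 1)] with k hk
      have h5 := norm_creationWave_sq_le f (ψ : Fock d) hk
      rw [enorm_sq_eq_ofReal, ← ENNReal.ofReal_add]
      · refine ENNReal.ofReal_le_ofReal (h5.trans (le_of_eq ?_))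
        rw [mul_left_comm, ← mul_add, Finset.mul_sum, ← Finset.sum_add_distrib]
        congr 1
        refine Finset.sum_congr rfl fun i _ => ?_
        have := norm_pos_iff.2 (hk i)
        rw [bosonEnergy_succ i k]
        field_simp
      · exact mul_nonneg (by positivity) (Finset.sum_nonneg fun i _ => by positivity)
      · exact mul_nonneg (by positivity) (Finset.sum_nonneg fun i _ =>
          mul_nonneg (by positivity) (mul_nonneg (bosonEnergy_nonneg _) (by positivity)))
    · have hmeas : ∀ i : Fin (n + 1), Measurable fun k : Fin (n + 1) → Momentum d =>
          (i.removeNth k : Fin n → Momentum d) := fun i =>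
        measurable_pi_lambda _ fun j => measurable_pi_apply _
      refine (Measurable.const_mul (Finset.measurable_sum _ fun i _ => ?_) _).ennreal_ofReal
      have := hmeas i
      fun_prop
  rw [tsum_eq_zero_add' ENNReal.summable]
  have h0 : ∫⁻ k, ‖creationWave f (ψ : Fock d) 0 k‖ₑ ^ 2 = 0 := by simp [creationWave]
  rw [h0, zero_add, ENNReal.ofReal_add (by positivity) (by positivity),
    ENNReal.ofReal_mul (by positivity), ENNReal.ofReal_mul hE, ENNReal.ofReal_pow (norm_nonneg _),
    ENNReal.ofReal_pow (norm_nonneg _), ENNReal.ofReal_pow (norm_nonneg _), ofReal_norm, ofReal_norm,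
    ofReal_norm, enorm_sq_eq (ψ : Fock d), enorm_sq_eq (sqrtEnergy ψ), ← ENNReal.tsum_mul_left,
    ← ENNReal.tsum_mul_left, ← ENNReal.tsum_add]
  exact ENNReal.tsum_le_tsum hlevel

theorem fieldEnergy_domain_le_creation [NeZero d] {f : OneParticle d}
    (hf : FiniteInfraredEnergy f) : (fieldEnergy d).domain ≤ (creation f).domain := fun ψ hψ =>
  mem_domain_creation (ne_top_of_le_ne_top ENNReal.ofReal_ne_top
    (tsum_lintegral_creationWave_le hf ⟨ψ, hψ⟩))

theorem norm_creation_sq_le [NeZero d] {f : OneParticle d} (hf : FiniteInfraredEnergy f)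
    (ψ : (fieldEnergy d).domain) (h : (ψ : Fock d) ∈ (creation f).domain) :
    ‖creation f ⟨ψ, h⟩‖ ^ 2 ≤
      ‖f‖ ^ 2 * ‖(ψ : Fock d)‖ ^ 2 + infraredEnergy f * ‖sqrtEnergy ψ‖ ^ 2 := by
  have hE := infraredEnergy_nonneg f
  refine norm_sq_le_of_lintegral_le (by positivity) (le_trans (le_of_eq ?_)
    (tsum_lintegral_creationWave_le hf ψ))
  refine tsum_congr fun n => lintegral_congr_ae ?_
  filter_upwards [wave_creation f ⟨ψ, h⟩ n] with k hk
  rw [hk]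

/-- The vector `E^{-1/2} a†(f) φ`; its norm is at most `𝓔^{1/2} ‖φ‖`. -/
theorem exists_invSqrtEnergy_creation [NeZero d] {f : OneParticle d}
    (hf : FiniteInfraredEnergy f) (φ : (creation f).domain) :
    ∃ χ : Fock d, (∀ n, wave χ n =ᵐ[volume] fun k =>
      (((√(bosonEnergy k))⁻¹ : ℝ) : ℂ) * wave (creation f φ) n k) ∧
      ‖χ‖ ^ 2 ≤ infraredEnergy f * ‖(φ : Fock d)‖ ^ 2 := by
  have hE := infraredEnergy_nonneg f
  have hfm := measurable_oneParticle f
  have hlevel : ∀ n, ∫⁻ k : Fin (n + 1) → Momentum d,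
      ‖(((√(bosonEnergy k))⁻¹ : ℝ) : ℂ) * wave (creation f φ) (n + 1) k‖ₑ ^ 2 ≤
        ENNReal.ofReal (infraredEnergy f) * ∫⁻ k, ‖wave (φ : Fock d) n k‖ₑ ^ 2 := by
    intro n
    have hwm := measurable_wave (φ : Fock d) n
    have h1 := lintegral_average_removeNth (n := n) (a := fun k => ‖f k‖ ^ 2 / ‖k‖)
      (b := fun k => ‖wave (φ : Fock d) n k‖ ^ 2) (by fun_prop) (by fun_prop)
      (fun k => by positivity) (fun k => by positivity)
    simp only [← enorm_sq_eq_ofReal (wave (φ : Fock d) n _)] at h1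
    rw [lintegral_infrared hf] at h1
    rw [← h1]
    refine lintegral_mono_ae ?_
    filter_upwards [ae_forall_ne_zero (n + 1), wave_creation f φ (n + 1)] with k hk hk'
    have h2 := norm_creationWave_sq_le f (φ : Fock d) hk
    have h3 : 0 < bosonEnergy k := by
      rw [bosonEnergy_succ 0 k]
      exact add_pos_of_pos_of_nonneg (norm_pos_iff.2 (hk 0)) (bosonEnergy_nonneg _)
    rw [enorm_sq_eq_ofReal, hk', norm_mul, mul_pow, Complex.norm_real, Real.norm_eq_abs, sq_abs,
      inv_pow, Real.sq_sqrt h3.le]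
    refine ENNReal.ofReal_le_ofReal ?_
    rwa [inv_mul_le_iff₀ h3]
  have hsum : ∑' n, ∫⁻ k : Fin n → Momentum d,
      ‖(((√(bosonEnergy k))⁻¹ : ℝ) : ℂ) * wave (creation f φ) n k‖ₑ ^ 2 ≤
        ENNReal.ofReal (infraredEnergy f * ‖(φ : Fock d)‖ ^ 2) := by
    rw [tsum_eq_zero_add' ENNReal.summable]
    have h0 : ∫⁻ k : Fin 0 → Momentum d,
        ‖(((√(bosonEnergy k))⁻¹ : ℝ) : ℂ) * wave (creation f φ) 0 k‖ₑ ^ 2 = 0 := by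
      simp [bosonEnergy]
    rw [h0, zero_add, ENNReal.ofReal_mul hE, ENNReal.ofReal_pow (norm_nonneg _), ofReal_norm,
      enorm_sq_eq (φ : Fock d), ← ENNReal.tsum_mul_left]
    exact ENNReal.tsum_le_tsum hlevel
  obtain ⟨χ, hχ⟩ := exists_energy_mul (h := fun t => (((√t)⁻¹ : ℝ) : ℂ)) (by fun_prop)
    (creation f φ) (ne_top_of_le_ne_top ENNReal.ofReal_ne_top hsum)
  refine ⟨χ, hχ, norm_sq_le_of_lintegral_le (by positivity) (le_trans (le_of_eq ?_) hsum)⟩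
  refine tsum_congr fun n => lintegral_congr_ae ?_
  filter_upwards [hχ n] with k hk
  rw [hk]

/-- The sharp form bound `|⟨ψ, a†(f) φ⟩| ≤ 𝓔^{1/2} ‖E^{1/2} ψ‖ ‖φ‖`. -/
theorem norm_inner_creation_le [NeZero d] {f : OneParticle d} (hf : FiniteInfraredEnergy f)
    (ψ : (fieldEnergy d).domain) (φ : (creation f).domain) :
    ‖inner ℂ (ψ : Fock d) (creation f φ)‖ ≤
      √(infraredEnergy f) * ‖sqrtEnergy ψ‖ * ‖(φ : Fock d)‖ := by
  obtain ⟨χ, h1, h2⟩ := exists_invSqrtEnergy_creation hf φ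
  have h3 : inner ℂ (ψ : Fock d) (creation f φ) = inner ℂ (sqrtEnergy ψ) χ := by
    refine inner_congr_wave fun n => ?_
    filter_upwards [h1 n, wave_sqrtEnergy ψ n, wave_creation f φ n, ae_forall_ne_zero n]
      with k h4 h5 h6 h7
    rw [h4, h5]
    cases n with
    | zero => rw [h6]; simp [creationWave]
    | succ n =>
      have h8 : 0 < bosonEnergy k := by
        rw [bosonEnergy_succ 0 k]
        exact add_pos_of_pos_of_nonneg (norm_pos_iff.2 (h7 0)) (bosonEnergy_nonneg _)
      have h9 : ((√(bosonEnergy k) : ℝ) : ℂ) ≠ 0 := by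
        exact_mod_cast (Real.sqrt_pos.2 h8).ne'
      simp only [RCLike.inner_apply, map_mul, Complex.conj_ofReal, Complex.ofReal_inv]
      field_simp
  have h4 : ‖χ‖ ≤ √(infraredEnergy f) * ‖(φ : Fock d)‖ := by
    refine abs_le_of_sq_le_sq ?_ (by positivity) |> (le_abs_self _).trans
    rw [mul_pow, Real.sq_sqrt (infraredEnergy_nonneg f)]
    exact h2
  rw [h3]
  refine (norm_inner_le_norm _ _).trans ?_
  calc ‖sqrtEnergy ψ‖ * ‖χ‖ ≤ ‖sqrtEnergy ψ‖ * (√(infraredEnergy f) * ‖(φ : Fock d)‖) :=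
        mul_le_mul_of_nonneg_left h4 (norm_nonneg _)
    _ = _ := by ring

end Creation

/-! ### Annihilation operators on the domain of the field energy -/

section Annihilation

variable {d : ℕ} [NeZero d]

theorem dense_creation {f : OneParticle d} (hf : FiniteInfraredEnergy f) :
    Dense ((creation f).domain : Set (Fock d)) :=
  fieldEnergy_hasImaginaryResolvents.dense.mono (fieldEnergy_domain_le_creation hf)

theorem inner_annihilation {f : OneParticle d} (hf : FiniteInfraredEnergy f)
    (ψ : (annihilation f).domain) (φ : (creation f).domain) :
    inner ℂ (annihilation f ψ) (φ : Fock d) = inner ℂ (ψ : Fock d) (creation f φ) :=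
  LinearPMap.adjoint_isFormalAdjoint (dense_creation hf) ψ φ

/-- `φ ↦ ⟨ψ, a†(f) φ⟩` is bounded for `ψ` in the domain of `E`, by the form bound. -/
theorem fieldEnergy_domain_le_annihilation {f : OneParticle d} (hf : FiniteInfraredEnergy f) :
    (fieldEnergy d).domain ≤ (annihilation f).domain := by
  intro ψ hψ
  refine (LinearPMap.mem_adjoint_domain_iff _ _).2 ?_
  exact AddMonoidHomClass.continuous_of_bound _ _ fun φ => norm_inner_creation_le hf ⟨ψ, hψ⟩ φ

theorem norm_le_of_inner_le {H : Type*} [NormedAddCommGroup H] [InnerProductSpace ℂ H] {D : Set H}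
    (hD : Dense D) {w : H} {C : ℝ} (hC : 0 ≤ C) (h : ∀ φ ∈ D, ‖inner ℂ w φ‖ ≤ C * ‖φ‖) : ‖w‖ ≤ C := by
  have hcl : IsClosed {φ : H | ‖inner ℂ w φ‖ ≤ C * ‖φ‖} :=
    isClosed_le (by fun_prop) (by fun_prop)
  have hw : w ∈ {φ : H | ‖inner ℂ w φ‖ ≤ C * ‖φ‖} :=
    hcl.closure_subset_iff.2 h (hD w)
  rw [Set.mem_ofPred_eq, inner_self_eq_norm_sq_to_K] at hw
  rcases (norm_nonneg w).eq_or_lt with h0 | h0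
  · rwa [← h0]
  · refine le_of_mul_le_mul_right ?_ h0
    simpa [sq] using hw

theorem norm_annihilation_sq_le {f : OneParticle d} (hf : FiniteInfraredEnergy f)
    (ψ : (fieldEnergy d).domain) (h : (ψ : Fock d) ∈ (annihilation f).domain) :
    ‖annihilation f ⟨ψ, h⟩‖ ^ 2 ≤ infraredEnergy f * ‖sqrtEnergy ψ‖ ^ 2 := by
  have h1 : ‖annihilation f ⟨ψ, h⟩‖ ≤ √(infraredEnergy f) * ‖sqrtEnergy ψ‖ := by
    refine norm_le_of_inner_le (dense_creation hf) (by positivity) (fun φ hφ => ?_)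
    have h2 := inner_annihilation hf ⟨ψ, h⟩ ⟨φ, hφ⟩
    simp only at h2
    rw [h2]
    exact norm_inner_creation_le hf ψ ⟨φ, hφ⟩
  refine (pow_le_pow_left₀ (norm_nonneg _) h1 2).trans (le_of_eq ?_)
  rw [mul_pow, Real.sq_sqrt (infraredEnergy_nonneg f)]

end Annihilation

/-! ### The vacuum and one-boson states -/

section OneBoson

variable {d : ℕ}

theorem wave_vacuum_zero : wave (vacuum d) 0 =ᵐ[volume] fun _ => 1 := by
  have h : vacuum d 0 = vacuumZero d := lp.single_apply_self _ _ _
  have h1 := (memLp_one d).coeFn_toLp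
  have h2 : wave (vacuum d) 0 = ((memLp_one d).toLp _ : NBody d 0) := by
    rw [wave, h]; rfl
  rw [h2]
  exact h1

theorem wave_vacuum_succ (n : ℕ) : wave (vacuum d) (n + 1) =ᵐ[volume] 0 := by
  have h : vacuum d (n + 1) = 0 := lp.single_apply_ne _ _ _ (Nat.succ_ne_zero n)
  have h2 : wave (vacuum d) (n + 1) = ((0 : NBody d (n + 1)) : (Fin (n + 1) → Momentum d) → ℂ) := by
    rw [wave, h]; rfl
  rw [h2]
  exact Lp.coeFn_zero ℂ 2 _

instance isProbabilityMeasure_volume_fin_zero :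
    IsProbabilityMeasure (volume : Measure (Fin 0 → Momentum d)) := by
  rw [volume_fin_zero]; infer_instance

theorem norm_vacuum : ‖vacuum d‖ = 1 := by
  have h : ‖vacuum d‖ₑ ^ 2 = 1 := by
    rw [enorm_sq_eq, tsum_eq_single 0]
    · have h1 : ∫⁻ k, ‖wave (vacuum d) 0 k‖ₑ ^ 2 = ∫⁻ _ : Fin 0 → Momentum d, 1 := by
        refine lintegral_congr_ae ?_
        filter_upwards [wave_vacuum_zero] with k hk
        rw [hk]; simp
      rw [h1]; simp
    · intro n hn
      obtain ⟨n, rfl⟩ := Nat.exists_eq_succ_of_ne_zero hn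
      rw [lintegral_eq_zero_iff ((measurable_wave _ _).enorm.pow_const 2)]
      filter_upwards [wave_vacuum_succ n] with k hk
      simp [hk]
  rw [← ofReal_norm, ← ENNReal.ofReal_pow (norm_nonneg _), ENNReal.ofReal_eq_one] at h
  exact (pow_eq_one_iff_of_nonneg (norm_nonneg _) two_ne_zero).1 h

theorem exists_fieldEnergy_vacuum :
    ∃ h : vacuum d ∈ (fieldEnergy d).domain, fieldEnergy d ⟨vacuum d, h⟩ = 0 := by
  refine exists_fieldEnergy_eq fun n => ?_
  cases n with
  | zero =>
    filter_upwards [wave_zero d 0] with k hk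
    simp [hk, bosonEnergy]
  | succ n =>
    filter_upwards [wave_zero d (n + 1), wave_vacuum_succ n] with k hk h2
    simp [hk, h2]

/-- The wave functions of the one-boson state with momentum wave function `g`. -/
def oneBosonWave (g : OneParticle d) : ∀ n, (Fin n → Momentum d) → ℂ
  | 1 => fun k => g (k 0)
  | _ => 0

theorem lintegral_fin_one {F : Momentum d → ℝ≥0∞} (hF : Measurable F) :
    ∫⁻ k : Fin 1 → Momentum d, F (k 0) = ∫⁻ x, F x :=
  (volume_preserving_funUnique (Fin 1) (Momentum d)).lintegral_comp hF

theorem tsum_lintegral_oneBosonWave (g : OneParticle d) :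
    ∑' n, ∫⁻ k, ‖oneBosonWave g n k‖ₑ ^ 2 = ‖g‖ₑ ^ 2 := by
  have hg := measurable_oneParticle g
  rw [tsum_eq_single 1]
  · rw [enorm_sq_Lp]
    exact lintegral_fin_one (F := fun x => ‖g x‖ₑ ^ 2) (by fun_prop)
  · intro n hn
    match n, hn with
    | 0, _ => simp [oneBosonWave]
    | n + 2, _ => simp [oneBosonWave]

theorem exists_oneBoson (g : OneParticle d) :
    ∃ ψ : Fock d, ∀ n, wave ψ n =ᵐ[volume] oneBosonWave g n := by
  have hg := measurable_oneParticle g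
  refine exists_fock _ (fun n => ?_) (fun n σ => ?_) ?_
  · match n with
    | 0 => exact aestronglyMeasurable_const
    | 1 => exact (hg.comp (measurable_pi_apply 0)).aestronglyMeasurable
    | n + 2 => exact aestronglyMeasurable_const
  · match n with
    | 0 => rfl
    | 1 =>
      rw [Subsingleton.elim σ 1]
      rfl
    | n + 2 => rfl
  · rw [tsum_lintegral_oneBosonWave]
    finiteness

/-- The one-boson state `a†(g) |0⟩`. -/
def oneBoson (g : OneParticle d) : Fock d := (exists_oneBoson g).choose

theorem wave_oneBoson (g : OneParticle d) (n : ℕ) :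
    wave (oneBoson g) n =ᵐ[volume] oneBosonWave g n :=
  (exists_oneBoson g).choose_spec n

theorem norm_oneBoson (g : OneParticle d) : ‖oneBoson g‖ = ‖g‖ := by
  have h : ‖oneBoson g‖ₑ ^ 2 = ‖g‖ₑ ^ 2 := by
    rw [enorm_sq_eq, ← tsum_lintegral_oneBosonWave]
    refine tsum_congr fun n => lintegral_congr_ae ?_
    filter_upwards [wave_oneBoson g n] with k hk
    rw [hk]
  rw [← ofReal_norm, ← ofReal_norm, ← ENNReal.ofReal_pow (norm_nonneg _),
    ← ENNReal.ofReal_pow (norm_nonneg _),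
    ENNReal.ofReal_eq_ofReal_iff (by positivity) (by positivity)] at h
  exact (pow_left_inj₀ (norm_nonneg _) (norm_nonneg _) two_ne_zero).1 h

theorem ae_fin_one {p : Momentum d → Prop} (hp : ∀ᵐ x, p x) :
    ∀ᵐ k : Fin 1 → Momentum d, p (k 0) :=
  (volume_preserving_funUnique (Fin 1) (Momentum d)).quasiMeasurePreserving.ae hp

theorem oneBoson_sub (g h : OneParticle d) : oneBoson (g - h) = oneBoson g - oneBoson h := by
  rw [eq_sub_iff_add_eq]
  have h0 : ∀ᵐ x : Momentum d, (g - h) x + h x = g x := by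
    filter_upwards [Lp.coeFn_sub g h] with x hx
    rw [hx, Pi.sub_apply, sub_add_cancel]
  refine fock_ext fun n => ?_
  have h5 : ∀ᵐ k, oneBosonWave (g - h) n k + oneBosonWave h n k = oneBosonWave g n k := by
    match n with
    | 0 => simp [oneBosonWave]
    | 1 => exact ae_fin_one h0
    | n + 2 => simp [oneBosonWave]
  filter_upwards [wave_add (oneBoson (g - h)) (oneBoson h) n, wave_oneBoson (g - h) n,
    wave_oneBoson h n, wave_oneBoson g n, h5] with k h1 h2 h3 h4 h5
  rw [h1, Pi.add_apply, h2, h3, h4, h5]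

theorem exists_fieldEnergy_oneBoson {g h : OneParticle d}
    (hgh : ∀ᵐ x : Momentum d, h x = (‖x‖ : ℂ) * g x) :
    ∃ hg : oneBoson g ∈ (fieldEnergy d).domain,
      fieldEnergy d ⟨oneBoson g, hg⟩ = oneBoson h := by
  refine exists_fieldEnergy_eq fun n => ?_
  match n with
  | 0 =>
    filter_upwards [wave_oneBoson h 0, wave_oneBoson g 0] with k h1 h2
    rw [h1, h2]; simp [oneBosonWave]
  | 1 =>
    filter_upwards [wave_oneBoson h 1, wave_oneBoson g 1, ae_fin_one hgh] with k h1 h2 h3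
    rw [h1, h2]; simp [oneBosonWave, bosonEnergy, h3]
  | n + 2 =>
    filter_upwards [wave_oneBoson h (n + 2), wave_oneBoson g (n + 2)] with k h1 h2
    rw [h1, h2]; simp [oneBosonWave]

theorem exists_creation_vacuum (f : OneParticle d) :
    ∃ h : vacuum d ∈ (creation f).domain, creation f ⟨vacuum d, h⟩ = oneBoson f := by
  refine exists_creation_eq fun n => ?_
  match n with
  | 0 => exact wave_oneBoson f 0
  | 1 =>
    filter_upwards [wave_oneBoson f 1,
      (quasiMeasurePreserving_removeNth d 0 0).ae wave_vacuum_zero] with k h1 h2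
    rw [Fin.removeNth_zero] at h2
    rw [h1]
    simp [oneBosonWave, creationWave, h2]
  | n + 2 =>
    have h : ∀ᵐ k : Fin (n + 2) → Momentum d, ∀ i : Fin (n + 2),
        wave (vacuum d) (n + 1) (i.removeNth k) = 0 :=
      ae_all_iff.2 fun i => (quasiMeasurePreserving_removeNth d (n + 1) i).ae (wave_vacuum_succ n)
    filter_upwards [wave_oneBoson f (n + 2), h] with k h1 h2
    rw [h1]
    simp [oneBosonWave, creationWave, h2]

theorem inner_vacuum (φ : Fock d) (c : ℂ) (hc : wave φ 0 =ᵐ[volume] fun _ => c) :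
    inner ℂ (vacuum d) φ = c := by
  rw [inner_eq_tsum_integral, tsum_eq_single 0]
  · have h : ∫ k, inner ℂ (wave (vacuum d) 0 k) (wave φ 0 k) = ∫ _ : Fin 0 → Momentum d, c := by
      refine integral_congr_ae ?_
      filter_upwards [hc, wave_vacuum_zero] with k h1 h2
      rw [h1, h2]; simp
    rw [h]; simp
  · intro n hn
    obtain ⟨n, rfl⟩ := Nat.exists_eq_succ_of_ne_zero hn
    refine integral_eq_zero_of_ae ?_
    filter_upwards [wave_vacuum_succ n] with k hk
    rw [hk]; simp

/-- The adjoint relation that identifies `a(f) a†(g) |0⟩` as `⟨f|g⟩ |0⟩`. -/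
theorem inner_oneBoson_creation (f g : OneParticle d) (φ : (creation f).domain) :
    inner ℂ (oneBoson g) (creation f φ) = inner ℂ g f * inner ℂ (vacuum d) (φ : Fock d) := by
  let c := wave (φ : Fock d) 0 (fun i => i.elim0)
  have hc : ∀ k, wave (φ : Fock d) 0 k = c := fun k => congrArg _ (Subsingleton.elim _ _)
  rw [inner_vacuum (φ : Fock d) c (Eventually.of_forall hc), inner_eq_tsum_integral,
    tsum_eq_single 1]
  · have h : ∫ k, inner ℂ (wave (oneBoson g) 1 k) (wave (creation f φ) 1 k) =
        ∫ k : Fin 1 → Momentum d, inner ℂ (g (k 0)) (f (k 0)) * c := by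
      refine integral_congr_ae ?_
      filter_upwards [wave_oneBoson g 1, wave_creation f φ 1] with k h1 h2
      rw [h1, h2]
      simp only [oneBosonWave, creationWave, RCLike.inner_apply]
      simp [hc]
      ring
    have h1 := (volume_preserving_funUnique (Fin 1) (Momentum d)).integral_comp'
      (fun x => inner ℂ (g x) (f x) * c)
    rw [h]
    refine h1.trans ?_
    rw [integral_mul_const, L2.inner_def]
  · intro n hn
    refine integral_eq_zero_of_ae ?_
    match n, hn with
    | 0, _ =>
      filter_upwards [wave_oneBoson g 0] with k hk
      rw [hk]; simp [oneBosonWave]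
    | n + 2, _ =>
      filter_upwards [wave_oneBoson g (n + 2)] with k hk
      rw [hk]; simp [oneBosonWave]

theorem exists_annihilation_oneBoson [NeZero d] {f : OneParticle d} (hf : FiniteInfraredEnergy f)
    (g : OneParticle d) :
    ∃ h : oneBoson g ∈ (annihilation f).domain,
      annihilation f ⟨oneBoson g, h⟩ = (inner ℂ f g : ℂ) • vacuum d := by
  have h1 : ∀ φ : (creation f).domain, inner ℂ ((inner ℂ f g : ℂ) • vacuum d) (φ : Fock d) =
      inner ℂ (oneBoson g) (creation f φ) := fun φ => by
    rw [inner_oneBoson_creation, inner_smul_left, inner_conj_symm]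
  have h : oneBoson g ∈ (annihilation f).domain :=
    LinearPMap.mem_adjoint_domain_of_exists _ ⟨_, h1⟩
  exact ⟨h, LinearPMap.adjoint_apply_eq (dense_creation hf) _ h1⟩

theorem exists_annihilation_vacuum [NeZero d] {f : OneParticle d} (hf : FiniteInfraredEnergy f) :
    ∃ h : vacuum d ∈ (annihilation f).domain, annihilation f ⟨vacuum d, h⟩ = 0 := by
  have h1 : ∀ φ : (creation f).domain, inner ℂ (0 : Fock d) (φ : Fock d) =
      inner ℂ (vacuum d) (creation f φ) := fun φ => by
    rw [inner_zero_left, inner_vacuum _ 0 (wave_creation f φ 0)]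
  have h : vacuum d ∈ (annihilation f).domain :=
    LinearPMap.mem_adjoint_domain_of_exists _ ⟨_, h1⟩
  exact ⟨h, LinearPMap.adjoint_apply_eq (dense_creation hf) _ h1⟩

/-- Only multiples of the vacuum have zero field energy. -/
theorem mem_span_vacuum_of_sqrtEnergy_eq_zero [NeZero d] {ψ : (fieldEnergy d).domain}
    (h : sqrtEnergy ψ = 0) : (ψ : Fock d) ∈ Submodule.span ℂ {vacuum d} := by
  let c := wave (ψ : Fock d) 0 (fun i => i.elim0)
  have hc : ∀ k, wave (ψ : Fock d) 0 k = c := fun k => congrArg _ (Subsingleton.elim _ _)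
  refine Submodule.mem_span_singleton.2 ⟨c, fock_ext fun n => ?_⟩
  cases n with
  | zero =>
    filter_upwards [wave_smul c (vacuum d) 0, wave_vacuum_zero] with k h1 h2
    rw [h1, Pi.smul_apply, h2, hc]; simp
  | succ n =>
    have h0 := wave_sqrtEnergy ψ (n + 1)
    rw [h] at h0
    filter_upwards [wave_smul c (vacuum d) (n + 1), wave_vacuum_succ n, h0, wave_zero d (n + 1),
      ae_forall_ne_zero (n + 1)] with k h1 h2 h3 h4 h5
    have h8 : 0 < bosonEnergy k := by
      rw [bosonEnergy_succ 0 k]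
      exact add_pos_of_pos_of_nonneg (norm_pos_iff.2 (h5 0)) (bosonEnergy_nonneg _)
    have h9 : ((√(bosonEnergy k) : ℝ) : ℂ) ≠ 0 := by
      exact_mod_cast (Real.sqrt_pos.2 h8).ne'
    rw [h1, Pi.smul_apply, h2]
    rw [h4] at h3
    have h10 := (mul_eq_zero.1 h3.symm).resolve_left h9
    rw [h10]; simp

end OneBoson

/-! ### A two-level system coupled to a field -/

section Coupling

variable {H : Type*} [NormedAddCommGroup H] [InnerProductSpace ℂ H]

theorem inner_toLp (a b c e : H) :
    inner ℂ (WithLp.toLp 2 (a, b) : WithLp 2 (H × H)) (WithLp.toLp 2 (c, e)) =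
      inner ℂ a c + inner ℂ b e :=
  WithLp.prod_inner_apply _ _

theorem norm_toLp_sq {H : Type*} [NormedAddCommGroup H] (a b : H) :
    ‖(WithLp.toLp 2 (a, b) : WithLp 2 (H × H))‖ ^ 2 = ‖a‖ ^ 2 + ‖b‖ ^ 2 :=
  WithLp.prod_norm_sq_eq_of_L2 _

/-- What the block matrix `((E/α, √α C), (√α A, m + E/α))` needs to be a self-adjoint operator:
`E ≥ 0` is self-adjoint with square root `S`, the operators `C` and `A` are formally adjoint, and
both are bounded by `S`. For the Dicke model `b = ‖f‖²` and `e = 𝓔`. -/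
structure IsFieldCoupling (E C A : H →ₗ.[ℂ] H) (S : E.domain → H) (b e : ℝ) : Prop where
  symm : E.IsFormalAdjoint E
  surj : ∀ l : ℝ, l ≠ 0 → ∀ y : H, ∃ x : E.domain, E x + (Complex.I * (l : ℂ)) • (x : H) = y
  leC : E.domain ≤ C.domain
  leA : E.domain ≤ A.domain
  adj : A.IsFormalAdjoint C
  inner_sqrt : ∀ ψ φ : E.domain, inner ℂ (ψ : H) (E φ) = inner ℂ (S ψ) (S φ)
  b_nonneg : 0 ≤ b
  e_nonneg : 0 ≤ e
  normC : ∀ φ : E.domain, ‖C ⟨φ, leC φ.2⟩‖ ^ 2 ≤ b * ‖(φ : H)‖ ^ 2 + e * ‖S φ‖ ^ 2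
  normA : ∀ ψ : E.domain, ‖A ⟨ψ, leA ψ.2⟩‖ ^ 2 ≤ e * ‖S ψ‖ ^ 2
  form : ∀ ψ φ : E.domain, ‖inner ℂ (ψ : H) (C ⟨φ, leC φ.2⟩)‖ ≤ √e * ‖S ψ‖ * ‖(φ : H)‖

/-- The block matrix `((E/α, √α C), (√α A, m + E/α))`. -/
def couplingOperator (E C A : H →ₗ.[ℂ] H) (m α : ℝ) : WithLp 2 (H × H) →ₗ.[ℂ] WithLp 2 (H × H) :=
  blockOperator
    (((α⁻¹ : ℝ) : ℂ) • E) (((√α : ℝ) : ℂ) • C) (((√α : ℝ) : ℂ) • A)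
    (((m : ℂ) • (LinearMap.id : H →ₗ[ℂ] H)).toPMap ⊤ + ((α⁻¹ : ℝ) : ℂ) • E)

namespace IsFieldCoupling

variable {E C A : H →ₗ.[ℂ] H} {S : E.domain → H} {b e m α : ℝ} (hK : IsFieldCoupling E C A S b e)

include hK

theorem toLp_mem (ψ φ : E.domain) :
    WithLp.toLp 2 ((ψ : H), (φ : H)) ∈ (couplingOperator E C A m α).domain :=
  ⟨⟨ψ.2, hK.leA ψ.2⟩, ⟨hK.leC φ.2, trivial, φ.2⟩⟩

theorem apply_toLp (ψ φ : E.domain) :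
    couplingOperator E C A m α ⟨_, hK.toLp_mem ψ φ⟩ = WithLp.toLp 2
      (((α⁻¹ : ℝ) : ℂ) • E ψ + ((√α : ℝ) : ℂ) • C ⟨φ, hK.leC φ.2⟩,
        ((√α : ℝ) : ℂ) • A ⟨ψ, hK.leA ψ.2⟩ + ((m : ℂ) • (φ : H) + ((α⁻¹ : ℝ) : ℂ) • E φ)) :=
  rfl

theorem exists_toLp (x : (couplingOperator E C A m α).domain) :
    ∃ ψ φ : E.domain, x = ⟨_, hK.toLp_mem ψ φ⟩ :=
  ⟨⟨x.1.fst, x.2.1.1⟩, ⟨x.1.snd, x.2.2.2.2⟩, rfl⟩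

theorem inner_apply (ψ φ ψ' φ' : E.domain) :
    inner ℂ (WithLp.toLp 2 ((ψ : H), (φ : H)) : WithLp 2 (H × H))
        (couplingOperator E C A m α ⟨_, hK.toLp_mem ψ' φ'⟩) =
      ((α⁻¹ : ℝ) : ℂ) * inner ℂ (S ψ) (S ψ') +
      ((√α : ℝ) : ℂ) * (inner ℂ (ψ : H) (C ⟨φ', hK.leC φ'.2⟩) +
        starRingEnd ℂ (inner ℂ (ψ' : H) (C ⟨φ, hK.leC φ.2⟩))) +
      ((m : ℂ) * inner ℂ (φ : H) (φ' : H) + ((α⁻¹ : ℝ) : ℂ) * inner ℂ (S φ) (S φ')) := by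
  have h1 := hK.adj ⟨ψ', hK.leA ψ'.2⟩ ⟨φ, hK.leC φ.2⟩
  simp only at h1
  rw [hK.apply_toLp, inner_toLp, ← h1, inner_conj_symm, ← hK.inner_sqrt, ← hK.inner_sqrt]
  simp only [inner_add_right, inner_smul_right]
  ring

theorem isFormalAdjoint :
    (couplingOperator E C A m α).IsFormalAdjoint (couplingOperator E C A m α) := by
  intro x y
  obtain ⟨ψ, φ, rfl⟩ := hK.exists_toLp x
  obtain ⟨ψ', φ', rfl⟩ := hK.exists_toLp y
  rw [← inner_conj_symm, hK.inner_apply, hK.inner_apply]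
  simp only [map_add, map_mul, Complex.conj_ofReal, inner_conj_symm]
  ring

theorem inner_apply_self (ψ φ : E.domain) :
    inner ℂ (WithLp.toLp 2 ((ψ : H), (φ : H)) : WithLp 2 (H × H))
        (couplingOperator E C A m α ⟨_, hK.toLp_mem ψ φ⟩) =
      ((α⁻¹ * ‖S ψ‖ ^ 2 + 2 * √α * (inner ℂ (ψ : H) (C ⟨φ, hK.leC φ.2⟩)).re +
        m * ‖(φ : H)‖ ^ 2 + α⁻¹ * ‖S φ‖ ^ 2 : ℝ) : ℂ) := by
  rw [hK.inner_apply, Complex.add_conj]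
  simp only [inner_self_eq_norm_sq_to_K]
  push_cast
  simp only [Complex.coe_algebraMap]
  ring

/-- Completing the square in the quadratic form; this is where the Lamb shift `α² e` comes from. -/
theorem le_form (hα : 0 < α) (ψ φ : E.domain) :
    (m - α ^ 2 * e) * ‖(φ : H)‖ ^ 2 +
        α⁻¹ * (‖S ψ‖ - α * √α * √e * ‖(φ : H)‖) ^ 2 ≤
      α⁻¹ * ‖S ψ‖ ^ 2 + 2 * √α * (inner ℂ (ψ : H) (C ⟨φ, hK.leC φ.2⟩)).re +
        m * ‖(φ : H)‖ ^ 2 + α⁻¹ * ‖S φ‖ ^ 2 := by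
  have h1 := hK.form ψ φ
  have h2 := (abs_le.1 (Complex.abs_re_le_norm (inner ℂ (ψ : H) (C ⟨φ, hK.leC φ.2⟩)))).1
  set s := ‖S ψ‖
  set t := ‖(φ : H)‖
  set z := (inner ℂ (ψ : H) (C ⟨φ, hK.leC φ.2⟩)).re
  have h3 : √e ^ 2 = e := Real.sq_sqrt hK.e_nonneg
  have h4 : √α ^ 2 = α := Real.sq_sqrt hα.le
  have h5 : 0 ≤ √α * (z + √e * s * t) := mul_nonneg (Real.sqrt_nonneg _) (by linarith)
  have h6 : 0 ≤ α⁻¹ * ‖S φ‖ ^ 2 := by positivity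
  have h7 : α⁻¹ * (s - α * √α * √e * t) ^ 2 =
      α⁻¹ * s ^ 2 - 2 * √α * (√e * s * t) + α ^ 2 * e * t ^ 2 := by
    have h8 : α⁻¹ * (s - α * √α * √e * t) ^ 2 = α⁻¹ * s ^ 2 - 2 * (α⁻¹ * α) * √α * (√e * s * t) +
        (α⁻¹ * α) * α * √α ^ 2 * √e ^ 2 * t ^ 2 := by ring
    rw [h8, inv_mul_cancel₀ hα.ne', h4, h3]
    ring
  rw [h7]
  linarith

theorem nonneg (hα : 0 < α) (hm : α ^ 2 * e < m) (x : (couplingOperator E C A m α).domain) :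
    0 ≤ inner ℂ (x : WithLp 2 (H × H)) (couplingOperator E C A m α x) := by
  obtain ⟨ψ, φ, rfl⟩ := hK.exists_toLp x
  rw [hK.inner_apply_self]
  refine Complex.zero_le_real.2 (le_trans ?_ (hK.le_form hα ψ φ))
  have := sub_pos.2 hm
  positivity

theorem eq_zero_of_apply_eq_zero (hα : 0 < α) (hm : α ^ 2 * e < m) {ψ φ : E.domain}
    (h : couplingOperator E C A m α ⟨_, hK.toLp_mem ψ φ⟩ = 0) : S ψ = 0 ∧ (φ : H) = 0 := by
  have h1 := hK.le_form (m := m) hα ψ φ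
  have h2 := hK.inner_apply_self (m := m) (α := α) ψ φ
  rw [h, inner_zero_right] at h2
  rw [Complex.ofReal_eq_zero.1 h2.symm] at h1
  have h3 := sub_pos.2 hm
  have h4 : 0 ≤ (m - α ^ 2 * e) * ‖(φ : H)‖ ^ 2 := by positivity
  have h5 : 0 ≤ α⁻¹ * (‖S ψ‖ - α * √α * √e * ‖(φ : H)‖) ^ 2 := by positivity
  have h6 : ‖(φ : H)‖ = 0 := by
    have : (m - α ^ 2 * e) * ‖(φ : H)‖ ^ 2 = 0 := by linarith
    simpa [h3.ne'] using this
  have h7 : ‖S ψ‖ = 0 := by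
    have : α⁻¹ * (‖S ψ‖ - α * √α * √e * ‖(φ : H)‖) ^ 2 = 0 := by linarith
    rw [h6, mul_zero, sub_zero] at this
    simpa [hα.ne'] using this
  exact ⟨norm_eq_zero.1 h7, norm_eq_zero.1 h6⟩

theorem norm_sqrt_sq_le (ψ : E.domain) : ‖S ψ‖ ^ 2 ≤ ‖(ψ : H)‖ * ‖E ψ‖ := by
  have h := norm_inner_le_norm (𝕜 := ℂ) (ψ : H) (E ψ)
  rw [hK.inner_sqrt, inner_self_eq_norm_sq_to_K] at h
  simpa using h

/-- Self-adjointness: the coupling is infinitesimally small with respect to `E`. The diagonal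
operators `α (E + i α l)⁻¹` serve as approximate resolvents. -/
theorem hasImaginaryResolvents [CompleteSpace H] (hα : 0 < α) :
    HasImaginaryResolvents (couplingOperator E C A m α) := by
  have hE := hK.e_nonneg
  have hb := hK.b_nonneg
  -- `B / |l|` bounds the squared norm of the error of the approximate resolvent
  set B := α * b + 2 * m ^ 2 + 3 * α ^ 2 * e with hB
  have hb0 : 0 ≤ B := by positivity
  refine hasImaginaryResolvents_of_approx (Λ := 4 * B + 1) hK.isFormalAdjoint (by positivity) ?_
  intro l hl
  have hl1 : 1 ≤ |l| := by linarith
  have hl0 : l ≠ 0 := abs_pos.1 (by linarith)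
  obtain ⟨r, hr, -⟩ := exists_linear_resolvent hK.symm
    (mul_ne_zero hα.ne' hl0) (fun y => hK.surj _ (mul_ne_zero hα.ne' hl0) y)
  let R : WithLp 2 (H × H) →ₗ[ℂ] (couplingOperator E C A m α).domain := LinearMap.codRestrict _
    ((WithLp.linearEquiv 2 ℂ (H × H)).symm.toLinearMap ∘ₗ LinearMap.prod
      (E.domain.subtype ∘ₗ ((α : ℂ) • r) ∘ₗ WithLp.fstₗ 2 ℂ H H)
      (E.domain.subtype ∘ₗ ((α : ℂ) • r) ∘ₗ WithLp.sndₗ 2 ℂ H H))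
    (fun y => hK.toLp_mem ((α : ℂ) • r y.fst) ((α : ℂ) • r y.snd))
  refine ⟨R, 1 / 2, by norm_num, fun y => ?_⟩
  obtain ⟨y₁, y₂, rfl⟩ : ∃ y₁ y₂, y = WithLp.toLp 2 (y₁, y₂) := ⟨y.fst, y.snd, rfl⟩
  have hR : R (WithLp.toLp 2 (y₁, y₂)) = ⟨_, hK.toLp_mem ((α : ℂ) • r y₁) ((α : ℂ) • r y₂)⟩ := rfl
  have hb1 : ∀ z, ‖E (r z)‖ ≤ ‖z‖ ∧ α * |l| * ‖(r z : H)‖ ≤ ‖z‖ := by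
    intro z
    have h := norm_sq_add_imaginary hK.symm (α * l) (r z)
    rw [hr] at h
    constructor
    · exact (sq_le_sq₀ (norm_nonneg _) (norm_nonneg _)).1 (by
        rw [h]; exact le_add_of_nonneg_right (by positivity))
    · refine (sq_le_sq₀ (by positivity) (norm_nonneg _)).1 ?_
      rw [h, mul_pow, mul_pow, mul_pow, sq_abs]
      exact le_add_of_nonneg_left (by positivity)
  have hb2 : ∀ z, α ^ 2 * |l| * ‖(r z : H)‖ ^ 2 ≤ ‖z‖ ^ 2 := by
    intro z
    refine le_trans ?_ (pow_le_pow_left₀ (by positivity) (hb1 z).2 2)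
    have : |l| ≤ |l| ^ 2 := by nlinarith
    calc α ^ 2 * |l| * ‖(r z : H)‖ ^ 2 ≤ α ^ 2 * |l| ^ 2 * ‖(r z : H)‖ ^ 2 := by gcongr
      _ = _ := by ring
  have hb3 : ∀ z, α * |l| * ‖S (r z)‖ ^ 2 ≤ ‖z‖ ^ 2 := by
    intro z
    calc α * |l| * ‖S (r z)‖ ^ 2 ≤ α * |l| * (‖(r z : H)‖ * ‖E (r z)‖) := by
          gcongr; exact hK.norm_sqrt_sq_le _
      _ = (α * |l| * ‖(r z : H)‖) * ‖E (r z)‖ := by ring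
      _ ≤ ‖z‖ * ‖z‖ := by
          gcongr
          exacts [(hb1 z).2, (hb1 z).1]
      _ = _ := by ring
  have hαc : (α : ℂ) ≠ 0 := by exact_mod_cast hα.ne'
  have hA := hK.normA (r y₁)
  have hC := hK.normC (r y₂)
  set a := A ⟨r y₁, hK.leA (r y₁).2⟩
  set c := C ⟨r y₂, hK.leC (r y₂).2⟩
  have key : couplingOperator E C A m α (R (WithLp.toLp 2 (y₁, y₂))) +
      (Complex.I * (l : ℂ)) • (R (WithLp.toLp 2 (y₁, y₂)) : WithLp 2 (H × H)) -
        WithLp.toLp 2 (y₁, y₂) =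
      (α : ℂ) • (WithLp.toLp 2 (((√α : ℝ) : ℂ) • c,
        ((√α : ℝ) : ℂ) • a + (m : ℂ) • (r y₂ : H)) : WithLp 2 (H × H)) := by
    have e3 : A ⟨((α : ℂ) • r y₁ : E.domain), hK.leA ((α : ℂ) • r y₁).2⟩ = (α : ℂ) • a := by
      rw [← LinearPMap.map_smul]; rfl
    have e4 : C ⟨((α : ℂ) • r y₂ : E.domain), hK.leC ((α : ℂ) • r y₂).2⟩ = (α : ℂ) • c := by
      rw [← LinearPMap.map_smul]; rfl
    have hcancel : ∀ z : H, ((α⁻¹ : ℝ) : ℂ) • (α : ℂ) • z = z := fun z => by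
      rw [smul_smul, Complex.ofReal_inv, inv_mul_cancel₀ hαc, one_smul]
    rw [hR, hK.apply_toLp, e3, e4, LinearPMap.map_smul, LinearPMap.map_smul, hcancel, hcancel,
      eq_sub_of_add_eq (hr y₁), eq_sub_of_add_eq (hr y₂), ← WithLp.toLp_smul, ← WithLp.toLp_smul,
      ← WithLp.toLp_add, ← WithLp.toLp_sub]
    congr 1
    refine Prod.ext ?_ ?_
    · simp only [Prod.fst_sub, Prod.fst_add, Prod.smul_fst, Submodule.coe_smul]
      push_cast
      module
    · simp only [Prod.snd_sub, Prod.snd_add, Prod.smul_snd, Submodule.coe_smul]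
      push_cast
      module
  rw [key]
  refine (sq_le_sq₀ (norm_nonneg _) (by positivity)).1 ?_
  rw [norm_smul, mul_pow, norm_toLp_sq, mul_pow, norm_toLp_sq, Complex.norm_real, Real.norm_eq_abs,
    sq_abs, norm_smul, Complex.norm_real, Real.norm_eq_abs, mul_pow, sq_abs, Real.sq_sqrt hα.le]
  have hsum : ‖((√α : ℝ) : ℂ) • a + (m : ℂ) • (r y₂ : H)‖ ^ 2 ≤
      2 * (α * ‖a‖ ^ 2) + 2 * (m ^ 2 * ‖(r y₂ : H)‖ ^ 2) := by
    have h := norm_add_le (((√α : ℝ) : ℂ) • a) ((m : ℂ) • (r y₂ : H))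
    refine (pow_le_pow_left₀ (norm_nonneg _) h 2).trans (add_sq_le.trans (le_of_eq ?_))
    rw [norm_smul, norm_smul, Complex.norm_real, Complex.norm_real, Real.norm_eq_abs,
      Real.norm_eq_abs, mul_pow, mul_pow, sq_abs, sq_abs, Real.sq_sqrt hα.le]
    ring
  have hlpos : 0 < |l| := by linarith
  -- after multiplication by `|l|` every term of the error is bounded by the norm of `y`
  have hfin : |l| * (α ^ 2 * (α * ‖c‖ ^ 2 +
      ‖((√α : ℝ) : ℂ) • a + (m : ℂ) • (r y₂ : H)‖ ^ 2)) ≤ B * (‖y₁‖ ^ 2 + ‖y₂‖ ^ 2) := by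
    calc _ ≤ |l| * (α ^ 2 * (α * (b * ‖(r y₂ : H)‖ ^ 2 + e * ‖S (r y₂)‖ ^ 2) +
          (2 * (α * (e * ‖S (r y₁)‖ ^ 2)) + 2 * (m ^ 2 * ‖(r y₂ : H)‖ ^ 2)))) := by
          gcongr
          refine hsum.trans ?_
          gcongr
      _ = (α * b + 2 * m ^ 2) * (α ^ 2 * |l| * ‖(r y₂ : H)‖ ^ 2) +
          α ^ 2 * e * (α * |l| * ‖S (r y₂)‖ ^ 2) +
          2 * α ^ 2 * e * (α * |l| * ‖S (r y₁)‖ ^ 2) := by ring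
      _ ≤ (α * b + 2 * m ^ 2) * ‖y₂‖ ^ 2 + α ^ 2 * e * ‖y₂‖ ^ 2 + 2 * α ^ 2 * e * ‖y₁‖ ^ 2 := by
          gcongr
          exacts [hb2 _, hb3 _, hb3 _]
      _ ≤ _ := by
          have : 0 ≤ (α * b + 2 * m ^ 2 + α ^ 2 * e) * ‖y₁‖ ^ 2 := by positivity
          have : 0 ≤ 2 * α ^ 2 * e * ‖y₂‖ ^ 2 := by positivity
          rw [hB]
          linarith
  have hy : 0 ≤ ‖y₁‖ ^ 2 + ‖y₂‖ ^ 2 := by positivity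
  refine le_of_mul_le_mul_left (hfin.trans ?_) hlpos
  nlinarith

end IsFieldCoupling

end Coupling

/-! ### The Dicke Hamiltonian -/

section Hamiltonian

variable {d : ℕ} {f : OneParticle d} {m α : ℝ}

theorem isFieldCoupling [NeZero d] (hf : FiniteInfraredEnergy f) :
    IsFieldCoupling (fieldEnergy d) (creation f) (annihilation f) sqrtEnergy (‖f‖ ^ 2)
      (infraredEnergy f) where
  symm := fieldEnergy_symm
  surj _ hl y := fieldEnergy_surj hl y
  leC := fieldEnergy_domain_le_creation hf
  leA := fieldEnergy_domain_le_annihilation hf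
  adj := inner_annihilation hf
  inner_sqrt := inner_fieldEnergy
  b_nonneg := by positivity
  e_nonneg := infraredEnergy_nonneg f
  normC φ := norm_creation_sq_le hf φ _
  normA ψ := norm_annihilation_sq_le hf ψ _
  form ψ φ := norm_inner_creation_le hf ψ ⟨φ, _⟩

/-- The ground state `(|0⟩, 0)` of the Dicke Hamiltonian. -/
def groundState (d : ℕ) : State d := WithLp.toLp 2 (vacuum d, 0)

theorem norm_groundState : ‖groundState d‖ = 1 := by
  have h : ‖groundState d‖ ^ 2 = ‖vacuum d‖ ^ 2 + ‖(0 : Fock d)‖ ^ 2 := norm_toLp_sq _ _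
  rw [norm_vacuum, norm_zero] at h
  exact (pow_eq_one_iff_of_nonneg (norm_nonneg _) two_ne_zero).1 (by simpa using h)

theorem exists_hamiltonian_groundState [NeZero d] (hf : FiniteInfraredEnergy f) :
    ∃ h : groundState d ∈ (hamiltonian m f α).domain, hamiltonian m f α ⟨_, h⟩ = 0 := by
  obtain ⟨h1, h2⟩ := exists_fieldEnergy_vacuum (d := d)
  obtain ⟨h3, h4⟩ := exists_annihilation_vacuum hf
  have hK := isFieldCoupling hf
  refine ⟨hK.toLp_mem ⟨vacuum d, h1⟩ 0, (hK.apply_toLp ⟨vacuum d, h1⟩ 0).trans ?_⟩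
  have h6 : creation f ⟨(0 : (fieldEnergy d).domain), hK.leC (0 : (fieldEnergy d).domain).2⟩ = 0 :=
    (creation f).map_zero
  have h7 : annihilation f ⟨vacuum d, hK.leA h1⟩ = 0 := h4
  rw [h2, h6, h7, LinearPMap.map_zero]
  simp only [smul_zero, add_zero, Submodule.coe_zero]
  rfl

theorem kernel_hamiltonian [NeZero d] (hf : FiniteInfraredEnergy f) (hα : 0 < α)
    (hm : lambShift f α < m) :
    kernel (hamiltonian m f α) = Submodule.span ℂ {groundState d} := by
  apply le_antisymm
  · rintro _ ⟨x, hx, rfl⟩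
    have hx0 : hamiltonian m f α x = 0 := hx
    obtain ⟨ψ, φ, rfl⟩ := (isFieldCoupling hf).exists_toLp x
    obtain ⟨h1, h2⟩ := (isFieldCoupling hf).eq_zero_of_apply_eq_zero hα hm hx0
    obtain ⟨c, hc⟩ := Submodule.mem_span_singleton.1 (mem_span_vacuum_of_sqrtEnergy_eq_zero h1)
    refine Submodule.mem_span_singleton.2 ⟨c, ?_⟩
    change c • WithLp.toLp 2 (vacuum d, (0 : Fock d)) = WithLp.toLp 2 ((ψ : Fock d), (φ : Fock d))
    rw [h2, ← hc, ← WithLp.toLp_smul, Prod.smul_mk, smul_zero]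
  · rw [Submodule.span_singleton_le_iff_mem]
    obtain ⟨h1, h2⟩ := exists_hamiltonian_groundState (m := m) (α := α) hf
    exact ⟨⟨_, h1⟩, h2, rfl⟩

theorem inner_hamiltonian_nonneg [NeZero d] (hf : FiniteInfraredEnergy f) (hα : 0 < α)
    (hm : lambShift f α < m) (x : (hamiltonian m f α).domain) :
    0 ≤ inner ℂ (x : State d) (hamiltonian m f α x) :=
  (isFieldCoupling hf).nonneg hα hm x

theorem hamiltonian_hasImaginaryResolvents [NeZero d] (hf : FiniteInfraredEnergy f) (hα : 0 < α) :
    HasImaginaryResolvents (hamiltonian m f α) :=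
  (isFieldCoupling hf).hasImaginaryResolvents hα

end Hamiltonian

/-! ### Infrared estimates -/

section Infrared

variable {d : ℕ}

theorem norm_sq_oneParticle (g : OneParticle d) : ‖g‖ ^ 2 = ∫ x, ‖g x‖ ^ 2 := by
  have h1 : inner ℂ g g = ((‖g‖ ^ 2 : ℝ) : ℂ) := by
    rw [inner_self_eq_norm_sq_to_K]; simp
  rw [L2.inner_def] at h1
  have h2 : ∀ x, inner ℂ (g x) (g x) = ((‖g x‖ ^ 2 : ℝ) : ℂ) := fun x => by
    rw [inner_self_eq_norm_sq_to_K]; simp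
  simp only [h2] at h1
  rw [integral_complex_ofReal] at h1
  exact (Complex.ofReal_injective h1).symm

theorem integrable_norm_sq (f : OneParticle d) : Integrable fun x => ‖f x‖ ^ 2 :=
  (memLp_two_iff_integrable_sq_norm (Lp.aestronglyMeasurable f)).1 (Lp.memLp f)

theorem integrableOn_inv_norm_pow {p : ℕ} (hp : p + 1 ≤ d) (r : ℝ) :
    IntegrableOn (fun x : Momentum d => (‖x‖ ^ p)⁻¹) (Metric.ball 0 r) := by
  have : NeZero d := ⟨by omega⟩
  rw [integrableOn_fun_norm_addHaar volume (f := fun y : ℝ => (y ^ p)⁻¹),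
    finrank_euclideanSpace_fin]
  have h : IntegrableOn (fun y : ℝ => y ^ (d - 1 - p)) (Set.Ioo 0 r) :=
    ((continuous_pow _).integrableOn_Icc (a := 0) (b := r)).mono_set Set.Ioo_subset_Icc_self
  refine h.congr_fun (fun y hy => ?_) measurableSet_Ioo
  have hy0 : y ≠ 0 := hy.1.ne'
  have h1 : d - 1 = (d - 1 - p) + p := by omega
  simp only [smul_eq_mul]
  nth_rewrite 2 [h1]
  rw [pow_add]
  field_simp

/-- The pointwise form of the square-root singularity. -/
theorem SqrtSingularity.norm_sq_le {f : OneParticle d} (hf : SqrtSingularity f) :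
    ∃ K r : ℝ, 0 ≤ K ∧ 0 < r ∧ ∀ᵐ x : Momentum d, ‖x‖ < r → ‖f x‖ ^ 2 ≤ K / ‖x‖ := by
  obtain ⟨K, r, hr, h⟩ := hf
  refine ⟨K ^ 2, r, by positivity, hr, ?_⟩
  filter_upwards [h] with x hx hxr
  refine (pow_le_pow_left₀ (norm_nonneg _) (hx hxr) 2).trans (le_of_eq ?_)
  rw [div_pow, Real.sq_sqrt (norm_nonneg _)]

theorem aestronglyMeasurable_weighted (f : OneParticle d) (p : ℕ) :
    AEStronglyMeasurable (fun x : Momentum d => ‖f x‖ ^ 2 / ‖x‖ ^ p) volume := by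
  have := measurable_oneParticle f
  exact Measurable.aestronglyMeasurable (by fun_prop)

theorem integrable_weighted {f : OneParticle d} (hf : SqrtSingularity f) {p : ℕ}
    (hp : p + 2 ≤ d) : Integrable fun x : Momentum d => ‖f x‖ ^ 2 / ‖x‖ ^ p := by
  have : NeZero d := ⟨by omega⟩
  obtain ⟨K, r, hK, hr, h⟩ := hf.norm_sq_le
  have h1 : Integrable ((Metric.ball 0 r).indicator fun x : Momentum d => K * (‖x‖ ^ (p + 1))⁻¹) :=
    (integrable_indicator_iff Metric.isOpen_ball.measurableSet).2
      ((integrableOn_inv_norm_pow (by omega) r).const_mul K)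
  refine (h1.add ((integrable_norm_sq f).const_mul (r ^ p)⁻¹)).mono'
    (aestronglyMeasurable_weighted f p) ?_
  filter_upwards [h, Measure.ae_ne volume (0 : Momentum d)] with x hx hx0
  have hx1 := norm_pos_iff.2 hx0
  rw [Real.norm_eq_abs, abs_of_nonneg (by positivity), Pi.add_apply]
  by_cases hxr : ‖x‖ < r
  · rw [Set.indicator_of_mem (mem_ball_zero_iff.2 hxr)]
    have h2 : ‖f x‖ ^ 2 / ‖x‖ ^ p ≤ K * (‖x‖ ^ (p + 1))⁻¹ := by
      rw [div_le_iff₀ (by positivity)]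
      refine (hx hxr).trans (le_of_eq ?_)
      rw [pow_succ]
      field_simp
    have : 0 ≤ (r ^ p)⁻¹ * ‖f x‖ ^ 2 := by positivity
    linarith
  · rw [Set.indicator_of_notMem (by simpa using hxr), zero_add, ← div_eq_inv_mul]
    have := not_lt.1 hxr
    gcongr

theorem SqrtSingularity.finiteInfraredEnergy {f : OneParticle d} (hf : SqrtSingularity f)
    (hd : 3 ≤ d) : FiniteInfraredEnergy f := by
  simpa [FiniteInfraredEnergy] using integrable_weighted hf (p := 1) hd

/-- The infrared cutoff `g = |k|⁻¹ 1_{Bᶜ} f`, `h = |k| g`. -/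
theorem exists_cutoff {f : OneParticle d} [NeZero d] (hf : FiniteInfraredEnergy f)
    {B : Set (Momentum d)} (hB : MeasurableSet B)
    (hi : IntegrableOn (fun x : Momentum d => ‖f x‖ ^ 2 / ‖x‖ ^ 2) Bᶜ) :
    ∃ g h : OneParticle d, (∀ᵐ x, h x = (‖x‖ : ℂ) * g x) ∧
      ‖g‖ ^ 2 = ∫ x in Bᶜ, ‖f x‖ ^ 2 / ‖x‖ ^ 2 ∧
      ‖f - h‖ ^ 2 = ∫ x in B, ‖f x‖ ^ 2 ∧
      ‖(infraredEnergy f : ℂ) - inner ℂ f g‖ = ∫ x in B, ‖f x‖ ^ 2 / ‖x‖ := by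
  have hfm := measurable_oneParticle f
  let u : Momentum d → ℂ := Bᶜ.indicator fun x => (‖x‖ : ℂ)⁻¹ * f x
  let v : Momentum d → ℂ := Bᶜ.indicator fun x => f x
  have hu : ∀ x, ‖u x‖ ^ 2 = Bᶜ.indicator (fun x => ‖f x‖ ^ 2 / ‖x‖ ^ 2) x := by
    intro x
    by_cases hx : x ∈ Bᶜ
    · simp only [u, Set.indicator_of_mem hx]
      rw [norm_mul, norm_inv, Complex.norm_real, norm_norm, mul_pow, inv_pow, inv_mul_eq_div]
    · simp only [u, Set.indicator_of_notMem hx]; simp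
  have hum : MemLp u 2 volume := by
    have h1 : Measurable u := Measurable.indicator (by fun_prop) hB.compl
    rw [memLp_two_iff_integrable_sq_norm h1.aestronglyMeasurable]
    simp only [hu]
    exact (integrable_indicator_iff hB.compl).2 hi
  have hvm : MemLp v 2 volume := (Lp.memLp f).indicator hB.compl
  refine ⟨hum.toLp, hvm.toLp, ?_, ?_, ?_, ?_⟩
  · filter_upwards [hum.coeFn_toLp, hvm.coeFn_toLp, Measure.ae_ne volume (0 : Momentum d)]
      with x h1 h2 h3
    have h4 : (‖x‖ : ℂ) ≠ 0 := by exact_mod_cast norm_ne_zero_iff.2 h3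
    rw [h1, h2]
    by_cases hx : x ∈ Bᶜ
    · simp only [u, v, Set.indicator_of_mem hx]
      rw [mul_inv_cancel_left₀ h4]
    · simp only [u, v, Set.indicator_of_notMem hx, mul_zero]
  · rw [norm_sq_oneParticle, ← integral_indicator hB.compl]
    refine integral_congr_ae ?_
    filter_upwards [hum.coeFn_toLp] with x h1
    rw [h1, hu]
  · rw [norm_sq_oneParticle, ← integral_indicator hB]
    refine integral_congr_ae ?_
    filter_upwards [Lp.coeFn_sub f hvm.toLp, hvm.coeFn_toLp] with x h1 h2
    rw [h1, Pi.sub_apply, h2]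
    by_cases hx : x ∈ B
    · simp [v, hx]
    · simp [v, hx]
  · have h1 : inner ℂ f hum.toLp = ((∫ x in Bᶜ, ‖f x‖ ^ 2 / ‖x‖ : ℝ) : ℂ) := by
      rw [L2.inner_def, ← integral_complex_ofReal, ← integral_indicator hB.compl]
      refine integral_congr_ae ?_
      filter_upwards [hum.coeFn_toLp] with x h1
      rw [h1]
      by_cases hx : x ∈ Bᶜ
      · simp only [u, Set.indicator_of_mem hx, RCLike.inner_apply]
        rw [mul_assoc, Complex.mul_conj, Complex.normSq_eq_norm_sq, ← Complex.ofReal_inv,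
          ← Complex.ofReal_mul, inv_mul_eq_div]
      · simp only [u, Set.indicator_of_notMem hx, inner_zero_right]
    have h2 : infraredEnergy f = (∫ x in B, ‖f x‖ ^ 2 / ‖x‖) + ∫ x in Bᶜ, ‖f x‖ ^ 2 / ‖x‖ :=
      (integral_add_compl hB hf).symm
    rw [h1, ← Complex.ofReal_sub, h2, add_sub_cancel_right, Complex.norm_real, Real.norm_eq_abs,
      abs_of_nonneg (integral_nonneg fun x => by positivity)]

/-- The surface measure of the unit sphere of `ℝᵈ`, i.e. `d` times the volume of the unit ball. -/
def sphereArea (d : ℕ) : ℝ := d * (volume : Measure (Momentum d)).real (Metric.ball 0 1)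

theorem sphereArea_nonneg (d : ℕ) : 0 ≤ sphereArea d := by
  unfold sphereArea; positivity

theorem setIntegral_inv_norm_sq_ball {ε : ℝ} (hε : 0 < ε) :
    ∫ x in Metric.ball (0 : Momentum 3) ε, (‖x‖ ^ 2)⁻¹ = sphereArea 3 * ε := by
  have h := integral_fun_norm_addHaar (volume : Measure (Momentum 3))
    ((Set.Iio ε).indicator fun y : ℝ => (y ^ 2)⁻¹)
  have h1 : ∀ x : Momentum 3, (Set.Iio ε).indicator (fun y : ℝ => (y ^ 2)⁻¹) ‖x‖ =
      (Metric.ball (0 : Momentum 3) ε).indicator (fun x => (‖x‖ ^ 2)⁻¹) x := fun x => by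
    simp [Set.indicator]
  simp only [h1] at h
  rw [integral_indicator Metric.isOpen_ball.measurableSet, finrank_euclideanSpace_fin] at h
  have h2 : ∫ y in Set.Ioi (0 : ℝ), y ^ (3 - 1) • (Set.Iio ε).indicator (fun y : ℝ => (y ^ 2)⁻¹) y =
      ∫ y in Set.Ioi (0 : ℝ), (Set.Iio ε).indicator (fun _ => (1 : ℝ)) y := by
    refine setIntegral_congr_fun measurableSet_Ioi fun y hy => ?_
    have hy0 : y ≠ 0 := (Set.mem_Ioi.1 hy).ne'
    by_cases hye : y < ε
    · simp [hye, hy0]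
    · simp [hye]
  rw [h2, setIntegral_indicator measurableSet_Iio, Set.Ioi_inter_Iio] at h
  rw [h, sphereArea]
  simp [hε.le, mul_assoc]

theorem integrableOn_inv_norm_cube_annulus {ε r : ℝ} (hε : 0 < ε) :
    IntegrableOn (fun x : Momentum 3 => (‖x‖ ^ 3)⁻¹) (Metric.ball 0 r \ Metric.ball 0 ε) := by
  have h : IntegrableOn (fun x : Momentum 3 => (ε ^ 3)⁻¹ * (‖x‖ ^ 0)⁻¹) (Metric.ball 0 r) :=
    (integrableOn_inv_norm_pow (by norm_num) r).const_mul _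
  refine (h.mono_set Set.sdiff_subset).mono' (Measurable.aestronglyMeasurable (by fun_prop)) ?_
  refine (ae_restrict_iff' (Metric.isOpen_ball.measurableSet.diff
    Metric.isOpen_ball.measurableSet)).2 (Eventually.of_forall fun x hx => ?_)
  have h1 : ε ≤ ‖x‖ := by simpa using hx.2
  rw [Real.norm_eq_abs, abs_of_nonneg (by positivity), pow_zero, inv_one, mul_one]
  gcongr

theorem setIntegral_inv_norm_cube_annulus {ε r : ℝ} (hε : 0 < ε) (hεr : ε ≤ r) :
    ∫ x in Metric.ball (0 : Momentum 3) r \ Metric.ball 0 ε, (‖x‖ ^ 3)⁻¹ =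
      sphereArea 3 * Real.log (r / ε) := by
  have h := integral_fun_norm_addHaar (volume : Measure (Momentum 3))
    ((Set.Ico ε r).indicator fun y : ℝ => (y ^ 3)⁻¹)
  have h1 : ∀ x : Momentum 3, (Set.Ico ε r).indicator (fun y : ℝ => (y ^ 3)⁻¹) ‖x‖ =
      (Metric.ball (0 : Momentum 3) r \ Metric.ball 0 ε).indicator (fun x => (‖x‖ ^ 3)⁻¹) x :=
    fun x => by simp [Set.indicator, and_comm]
  simp only [h1] at h
  rw [integral_indicator (Metric.isOpen_ball.measurableSet.diff Metric.isOpen_ball.measurableSet),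
    finrank_euclideanSpace_fin] at h
  have h2 : ∫ y in Set.Ioi (0 : ℝ), y ^ (3 - 1) • (Set.Ico ε r).indicator
      (fun y : ℝ => (y ^ 3)⁻¹) y =
      ∫ y in Set.Ioi (0 : ℝ), (Set.Ico ε r).indicator (fun y => y⁻¹) y := by
    refine setIntegral_congr_fun measurableSet_Ioi fun y hy => ?_
    have hy0 : y ≠ 0 := (Set.mem_Ioi.1 hy).ne'
    by_cases hye : y ∈ Set.Ico ε r
    · simp only [Set.indicator_of_mem hye, smul_eq_mul]
      field_simp
    · simp only [Set.indicator_of_notMem hye, smul_zero]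
  have h3 : Set.Ioi (0 : ℝ) ∩ Set.Ico ε r = Set.Ico ε r :=
    Set.inter_eq_right.2 fun y hy => hε.trans_le hy.1
  rw [h2, setIntegral_indicator measurableSet_Ico, h3, integral_Ico_eq_integral_Ioo,
    ← integral_Ioc_eq_integral_Ioo, ← intervalIntegral.integral_of_le hεr,
    integral_inv_of_pos hε (hε.trans_le hεr)] at h
  rw [h, sphereArea]
  simp [mul_assoc]

/-- The rate is at least of order `1/τ`. For `d = 3` the constant comes from
`log τ ≥ log 2 ≥ 1/4`. -/
theorem half_le_mul_adiabaticRate {τ : ℝ} (hτ : 0 < τ) (hd : d = 3 → 2 ≤ τ) (hd3 : 3 ≤ d) :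
    1 / 2 ≤ τ * adiabaticRate d τ := by
  unfold adiabaticRate
  split_ifs with h
  · rw [mul_one_div_cancel hτ.ne']; norm_num
  · have hτ2 := hd (by omega)
    rw [mul_div_cancel₀ _ hτ.ne']
    refine Real.le_sqrt_of_sq_le ?_
    have h1 := Real.log_le_log two_pos hτ2
    have h2 := Real.log_two_gt_d9
    norm_num at h2 ⊢
    linarith

/-- The infrared cutoff adapted to the time scale `τ`: no cutoff is needed for `d > 3`, while for
`d = 3` the momenta in the ball of radius `r/τ` are cut off. In three dimensions `‖g‖²` is of order
`log τ` and the two other quantities are of order `1/τ`. -/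
theorem exists_adapted_cutoff {f : OneParticle d} (hd : 3 ≤ d) (hf : SqrtSingularity f) :
    ∃ M : ℝ, 0 < M ∧ ∀ τ : ℝ, 0 < τ → (d = 3 → 2 ≤ τ) →
      ∃ g h : OneParticle d, (∀ᵐ x, h x = (‖x‖ : ℂ) * g x) ∧
        ‖g‖ ≤ M * (τ * adiabaticRate d τ) ∧ ‖f - h‖ ≤ M * adiabaticRate d τ ∧
        ‖(infraredEnergy f : ℂ) - inner ℂ f g‖ ≤ M * adiabaticRate d τ := by
  have : NeZero d := ⟨by omega⟩
  have hE := hf.finiteInfraredEnergy hd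
  rcases hd.eq_or_lt with h3 | h3
  · subst h3
    obtain ⟨K, r, hK, hr, hbound⟩ := hf.norm_sq_le
    have hS := sphereArea_nonneg 3
    set S := sphereArea 3
    set A := K * S + 2 * (‖f‖ ^ 2 / r ^ 2) with hA
    have hA0 : 0 ≤ A := by positivity
    set L := K * S with hL
    have hL0 : 0 ≤ L := by positivity
    refine ⟨√A + 2 * r * (√L + L) + 1, by positivity, fun τ hτ hτ2 => ?_⟩
    have hτ2 : 2 ≤ τ := hτ2 rfl
    have hρ := half_le_mul_adiabaticRate (d := 3) hτ (fun _ => hτ2) le_rfl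
    have hrate : τ * adiabaticRate 3 τ = √(Real.log τ) := by
      simp [adiabaticRate, mul_div_cancel₀, hτ.ne']
    set ε := r / τ with hε
    have hε0 : 0 < ε := by positivity
    have hεr : ε ≤ r := div_le_self hr.le (by linarith)
    have hε2 : ε ≤ 2 * r * adiabaticRate 3 τ := by
      rw [hε, div_le_iff₀ hτ]
      nlinarith
    have hrate0 : 0 ≤ adiabaticRate 3 τ := by
      by_contra hneg
      nlinarith
    have hlog : 1 / 2 ≤ Real.log τ := by
      have h1 := Real.log_le_log two_pos hτ2
      have h2 := Real.log_two_gt_d9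
      norm_num at h2 ⊢
      linarith
    have hmB : MeasurableSet (Metric.ball (0 : Momentum 3) ε) := Metric.isOpen_ball.measurableSet
    have hmA : MeasurableSet (Metric.ball (0 : Momentum 3) r \ Metric.ball 0 ε) :=
      Metric.isOpen_ball.measurableSet.diff hmB
    -- outside the cutoff: the annulus gives the logarithm
    let F : Momentum 3 → ℝ := (Metric.ball (0 : Momentum 3) r \ Metric.ball 0 ε).indicator
      fun x => K * (‖x‖ ^ 3)⁻¹
    have hF : Integrable F := (integrable_indicator_iff hmA).2
      ((integrableOn_inv_norm_cube_annulus hε0).const_mul K)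
    have hF0 : ∀ x, 0 ≤ F x := fun x => Set.indicator_nonneg (fun x _ => by positivity) x
    have hFint : ∫ x, F x = L * Real.log τ := by
      rw [integral_indicator hmA, integral_const_mul, setIntegral_inv_norm_cube_annulus hε0 hεr,
        hε, div_div_cancel₀ hr.ne', hL, mul_assoc]
    let G : Momentum 3 → ℝ := fun x => F x + (r ^ 2)⁻¹ * ‖f x‖ ^ 2
    have hG : Integrable G := hF.add ((integrable_norm_sq f).const_mul _)
    have hle : ∀ᵐ x ∂(volume.restrict (Metric.ball (0 : Momentum 3) ε)ᶜ),
        ‖f x‖ ^ 2 / ‖x‖ ^ 2 ≤ G x := by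
      refine (ae_restrict_iff' hmB.compl).2 ?_
      filter_upwards [hbound] with x hx hxB
      have hxε : ε ≤ ‖x‖ := by simpa using hxB
      have hx0 := hε0.trans_le hxε
      by_cases hxr : ‖x‖ < r
      · have hxA : x ∈ Metric.ball (0 : Momentum 3) r \ Metric.ball 0 ε :=
          ⟨mem_ball_zero_iff.2 hxr, hxB⟩
        have h1 : F x = K * (‖x‖ ^ 3)⁻¹ := Set.indicator_of_mem hxA _
        have h2 : ‖f x‖ ^ 2 / ‖x‖ ^ 2 ≤ K * (‖x‖ ^ 3)⁻¹ := by
          rw [div_le_iff₀ (by positivity)]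
          refine (hx hxr).trans (le_of_eq ?_)
          field_simp
        have h4 : 0 ≤ (r ^ 2)⁻¹ * ‖f x‖ ^ 2 := by positivity
        simp only [G]
        linarith
      · have h1 := not_lt.1 hxr
        have h2 : ‖f x‖ ^ 2 / ‖x‖ ^ 2 ≤ (r ^ 2)⁻¹ * ‖f x‖ ^ 2 := by
          rw [← div_eq_inv_mul]; gcongr
        simp only [G]
        linarith [hF0 x]
    have hi : IntegrableOn (fun x : Momentum 3 => ‖f x‖ ^ 2 / ‖x‖ ^ 2)
        (Metric.ball (0 : Momentum 3) ε)ᶜ := by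
      refine hG.integrableOn.mono' (aestronglyMeasurable_weighted f 2).restrict ?_
      filter_upwards [hle] with x hx
      rwa [Real.norm_eq_abs, abs_of_nonneg (by positivity)]
    obtain ⟨g, h, h1, h2, h3, h4⟩ := exists_cutoff hE hmB hi
    -- inside the cutoff
    have h5 : ∫ x in Metric.ball (0 : Momentum 3) ε, ‖f x‖ ^ 2 / ‖x‖ ≤ L * ε := by
      have h6 : ∫ x in Metric.ball (0 : Momentum 3) ε, K * (‖x‖ ^ 2)⁻¹ = L * ε := by
        rw [integral_const_mul, setIntegral_inv_norm_sq_ball hε0, hL, mul_assoc]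
      rw [← h6]
      refine setIntegral_mono_ae_restrict hE.integrableOn
        ((integrableOn_inv_norm_pow (by norm_num) ε).const_mul K) ?_
      refine (ae_restrict_iff' hmB).2 ?_
      filter_upwards [hbound, Measure.ae_ne volume (0 : Momentum 3)] with x hx hx0 hxB
      have hx1 := norm_pos_iff.2 hx0
      rw [div_le_iff₀ hx1]
      refine (hx ((mem_ball_zero_iff.1 hxB).trans_le hεr)).trans (le_of_eq ?_)
      field_simp
    have h6 : ∫ x in Metric.ball (0 : Momentum 3) ε, ‖f x‖ ^ 2 ≤ L * ε ^ 2 := by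
      calc ∫ x in Metric.ball (0 : Momentum 3) ε, ‖f x‖ ^ 2
          ≤ ∫ x in Metric.ball (0 : Momentum 3) ε, ε * (‖f x‖ ^ 2 / ‖x‖) := by
            refine setIntegral_mono_ae_restrict (integrable_norm_sq f).integrableOn
              (hE.integrableOn.const_mul ε) ?_
            refine (ae_restrict_iff' hmB).2 ?_
            filter_upwards [Measure.ae_ne volume (0 : Momentum 3)] with x hx0 hxB
            have hx1 := norm_pos_iff.2 hx0
            rw [← mul_div_assoc, le_div_iff₀ hx1, mul_comm]
            exact mul_le_mul_of_nonneg_right (mem_ball_zero_iff.1 hxB).le (by positivity)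
        _ = ε * ∫ x in Metric.ball (0 : Momentum 3) ε, ‖f x‖ ^ 2 / ‖x‖ := integral_const_mul _ _
        _ ≤ ε * (L * ε) := mul_le_mul_of_nonneg_left h5 hε0.le
        _ = L * ε ^ 2 := by ring
    refine ⟨g, h, h1, ?_, ?_, ?_⟩
    · have h7 : ‖g‖ ^ 2 ≤ A * Real.log τ := by
        rw [h2]
        have h8 : ∫ x in (Metric.ball (0 : Momentum 3) ε)ᶜ, ‖f x‖ ^ 2 / ‖x‖ ^ 2 ≤ ∫ x, G x :=
          (setIntegral_mono_ae_restrict hi hG.integrableOn hle).trans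
            (setIntegral_le_integral hG (Eventually.of_forall fun x =>
              add_nonneg (hF0 x) (by positivity)))
        have h9 : ∫ x, G x = L * Real.log τ + ‖f‖ ^ 2 / r ^ 2 := by
          simp only [G]
          rw [integral_add hF ((integrable_norm_sq f).const_mul _), hFint, integral_const_mul,
            ← norm_sq_oneParticle, inv_mul_eq_div]
        have h10 : 0 ≤ ‖f‖ ^ 2 / r ^ 2 := by positivity
        rw [h9] at h8
        refine h8.trans ?_
        rw [hA]
        nlinarith
      have h8 : ‖g‖ ≤ √A * √(Real.log τ) := by
        rw [← Real.sqrt_mul hA0]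
        exact Real.le_sqrt_of_sq_le h7
      rw [hrate]
      refine h8.trans (mul_le_mul_of_nonneg_right ?_ (Real.sqrt_nonneg _))
      have : 0 ≤ 2 * r * (√L + L) := by positivity
      linarith
    · have h7 : ‖f - h‖ ≤ √L * ε := by
        refine (sq_le_sq₀ (norm_nonneg _) (by positivity)).1 ?_
        rw [mul_pow, Real.sq_sqrt hL0, h3]
        exact h6
      refine h7.trans ?_
      have h8 := mul_le_mul_of_nonneg_left hε2 (Real.sqrt_nonneg L)
      have h9 : 0 ≤ (√A + 2 * r * L + 1) * adiabaticRate 3 τ := by positivity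
      linarith
    · rw [h4]
      refine h5.trans ?_
      have h8 := mul_le_mul_of_nonneg_left hε2 hL0
      have h9 : 0 ≤ (√A + 2 * r * √L + 1) * adiabaticRate 3 τ := by positivity
      linarith
  · have hi := integrable_weighted hf (p := 2) h3
    obtain ⟨g, h, h1, h2, h4, h5⟩ := exists_cutoff hE (B := ∅) MeasurableSet.empty
      (by rw [Set.compl_empty]; exact hi.integrableOn)
    refine ⟨‖g‖ + 1, by positivity, fun τ hτ _ => ⟨g, h, h1, ?_, ?_, ?_⟩⟩
    · simp [adiabaticRate, h3, hτ.ne']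
    · have h6 : ‖f - h‖ = 0 := by simpa using h4
      rw [h6]
      simp only [adiabaticRate, h3, if_true]
      positivity
    · rw [h5]
      simp only [adiabaticRate, h3, if_true, Measure.restrict_empty, integral_zero_measure]
      positivity

end Infrared

/-! ### Rotated projections and their adiabatic evolution -/

section Rotation

variable {H : Type*} [NormedAddCommGroup H] [InnerProductSpace ℂ H]

/-- The product rule for real curves of complex linear operators and of vectors. -/
theorem hasDerivWithinAt_clm_apply {U : ℝ → H →L[ℂ] H} {U' : H →L[ℂ] H} {u : ℝ → H} {u' : H}
    {s : Set ℝ} {r : ℝ} (hU : HasDerivWithinAt U U' s r) (hu : HasDerivWithinAt u u' s r) :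
    HasDerivWithinAt (fun t => U t (u t)) (U' (u r) + U r u') s r :=
  ((ContinuousLinearMap.restrictScalarsL ℂ H H ℝ ℝ).hasFDerivAt.comp_hasDerivWithinAt r hU).clm_apply
    hu

theorem hasDerivAt_clm_apply {U : ℝ → H →L[ℂ] H} {U' : H →L[ℂ] H} {u : ℝ → H} {u' : H} {r : ℝ}
    (hU : HasDerivAt U U' r) (hu : HasDerivAt u u' r) :
    HasDerivAt (fun t => U t (u t)) (U' (u r) + U r u') r := by
  rw [← hasDerivWithinAt_univ] at *
  exact hasDerivWithinAt_clm_apply hU hu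

theorem expI_eq_exp_smul (σ : H →L[ℂ] H) (s : ℝ) :
    expI σ s = NormedSpace.exp (s • (Complex.I • σ)) := by
  rw [expI, mul_comm, mul_smul, Complex.coe_smul]

theorem expI_zero (σ : H →L[ℂ] H) : expI σ 0 = 1 := by
  simp [expI]

variable [CompleteSpace H] {σ : H →L[ℂ] H}

theorem I_smul_mem_skewAdjoint (hσ : IsSelfAdjoint σ) :
    Complex.I • σ ∈ skewAdjoint (H →L[ℂ] H) := by
  rw [skewAdjoint.mem_iff, star_smul, hσ.star_eq]
  simp

theorem expI_mem_unitary (hσ : IsSelfAdjoint σ) (s : ℝ) : expI σ s ∈ unitary (H →L[ℂ] H) := by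
  rw [expI_eq_exp_smul]
  exact exp_smul_mem_unitary (I_smul_mem_skewAdjoint hσ) s

theorem hasDerivAt_expI (σ : H →L[ℂ] H) (s : ℝ) :
    HasDerivAt (expI σ) (expI σ s * (Complex.I • σ)) s := by
  have h : expI σ = fun r : ℝ => NormedSpace.exp (r • (Complex.I • σ)) :=
    funext (expI_eq_exp_smul σ)
  rw [h]
  exact hasDerivAt_exp_smul_const _ _

/-- The derivative of `V(s) P V(s)†`, where `V(s) = exp(i s σ)`, is `V(s) [iσ, P] V(s)†`. -/
theorem hasDerivAt_conjugate_expI (hσ : IsSelfAdjoint σ) (P : H →L[ℂ] H) (s : ℝ) :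
    HasDerivAt (fun r => expI σ r * P * star (expI σ r))
      (expI σ s * ((Complex.I • σ) * P - P * (Complex.I • σ)) * star (expI σ s)) s := by
  have hV := hasDerivAt_expI σ s
  refine ((hV.mul_const P).mul hV.star).congr_deriv ?_
  rw [star_mul, skewAdjoint.mem_iff.1 (I_smul_mem_skewAdjoint hσ)]
  noncomm_ring

/-- If `σ` has no diagonal part with respect to `P`, then Kato's generator for the projections
`P(s) = V(s) P V(s)†` is `V(s) (iσP + P iσ) V(s)†`. -/
theorem commutator_conjugate_expI (hσ : IsSelfAdjoint σ) {P : H →L[ℂ] H} (hP : P * P = P)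
    (hPσ : P * (Complex.I • σ) * P = 0) (s : ℝ) :
    (expI σ s * ((Complex.I • σ) * P - P * (Complex.I • σ)) * star (expI σ s)) *
        (expI σ s * P * star (expI σ s)) -
      (expI σ s * P * star (expI σ s)) *
        (expI σ s * ((Complex.I • σ) * P - P * (Complex.I • σ)) * star (expI σ s)) =
      expI σ s * ((Complex.I • σ) * P + P * (Complex.I • σ)) * star (expI σ s) := by
  have hV : star (expI σ s) * expI σ s = 1 := (expI_mem_unitary hσ s).1
  generalize Complex.I • σ = K at *
  generalize expI σ s = V at *
  have h (a b : H →L[ℂ] H) : V * a * star V * (V * b * star V) = V * (a * b) * star V := by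
    calc _ = V * a * (star V * V) * b * star V := by noncomm_ring
      _ = _ := by rw [hV, mul_one]; noncomm_ring
  rw [h, h, ← sub_mul, ← mul_sub]
  congr 2
  calc (K * P - P * K) * P - P * (K * P - P * K)
      = K * (P * P) - 2 • (P * K * P) + (P * P) * K := by noncomm_ring
    _ = _ := by rw [hP, hPσ]; simp

theorem deriv_commutator_conjugate_expI (hσ : IsSelfAdjoint σ) {P : H →L[ℂ] H} (hP : P * P = P)
    (hPσ : P * (Complex.I • σ) * P = 0) (s : ℝ) :
    deriv (fun r => expI σ r * P * star (expI σ r)) s * (expI σ s * P * star (expI σ s)) -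
      (expI σ s * P * star (expI σ s)) * deriv (fun r => expI σ r * P * star (expI σ r)) s =
      expI σ s * ((Complex.I • σ) * P + P * (Complex.I • σ)) * star (expI σ s) := by
  rw [(hasDerivAt_conjugate_expI hσ P s).deriv]
  exact commutator_conjugate_expI hσ hP hPσ s

/-- In the rotating frame Kato's generator does not depend on time, so that the adiabatic evolution
is `V(s) exp(s (iσP + P iσ - iσ))`. -/
theorem exists_isAdiabaticEvolution (hσ : IsSelfAdjoint σ) {P : H →L[ℂ] H} (hP : P * P = P)
    (hPσ : P * (Complex.I • σ) * P = 0) :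
    ∃ U, IsAdiabaticEvolution (fun s => expI σ s * P * star (expI σ s)) U := by
  set K := Complex.I • σ with hK
  refine ⟨fun s => expI σ s * NormedSpace.exp (s • (K * P + P * K - K)), ?_, fun s _ =>
    ⟨(hasDerivAt_conjugate_expI hσ P s).differentiableAt, ?_⟩⟩
  · simp [expI_zero]
  · have hV : star (expI σ s) * expI σ s = 1 := (expI_mem_unitary hσ s).1
    have hG := hasDerivAt_exp_smul_const (𝕂 := ℝ) (K * P + P * K - K) s
    have hcomm : NormedSpace.exp (s • (K * P + P * K - K)) * (K * P + P * K - K) =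
        (K * P + P * K - K) * NormedSpace.exp (s • (K * P + P * K - K)) :=
      (((Commute.refl (K * P + P * K - K)).smul_left s).exp_left).eq
    refine (((hasDerivAt_expI σ s).mul hG).congr_deriv ?_).hasDerivWithinAt
    rw [deriv_commutator_conjugate_expI hσ hP hPσ, hcomm, ← hK]
    change _ = expI σ s * (K * P + P * K) * star (expI σ s) *
      (expI σ s * NormedSpace.exp (s • (K * P + P * K - K)))
    generalize NormedSpace.exp (s • (K * P + P * K - K)) = G
    generalize expI σ s = V at *
    calc V * K * G + V * ((K * P + P * K - K) * G)
        = V * (K * P + P * K) * 1 * G := by noncomm_ring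
      _ = _ := by rw [← hV]; noncomm_ring

/-- Every adiabatic evolution transports a vector `Ω` in the range of `P` to `V(s) Ω`. -/
theorem IsAdiabaticEvolution.apply_eq (hσ : IsSelfAdjoint σ) {P : H →L[ℂ] H} (hP : P * P = P)
    (hPσ : P * (Complex.I • σ) * P = 0) {U : ℝ → H →L[ℂ] H}
    (hU : IsAdiabaticEvolution (fun s => expI σ s * P * star (expI σ s)) U) {Ω : H} (hΩ : P Ω = Ω)
    {s : ℝ} (hs : s ∈ Set.Icc (0 : ℝ) 1) : U s Ω = expI σ s Ω := by
  set L := (Complex.I • σ) * P + P * (Complex.I • σ) with hL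
  have hPσΩ : P ((Complex.I • σ) Ω) = 0 := by
    have h := DFunLike.congr_fun hPσ Ω
    simpa [hΩ] using h
  have hLΩ : L Ω = (Complex.I • σ) Ω := by
    simp only [hL, add_apply, mul_apply_eq_comp, hΩ, hPσΩ,
      add_zero]
  have hlip (r : ℝ) :
      LipschitzWith ‖L‖₊ fun x : H => (expI σ r * L * star (expI σ r)) x := by
    refine LipschitzWith.of_dist_le_mul fun x y => ?_
    rw [dist_eq_norm, dist_eq_norm, ← map_sub, mul_apply_eq_comp,
      mul_apply_eq_comp, norm_unitary_apply (expI_mem_unitary hσ r)]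
    refine (L.le_opNorm _).trans (le_of_eq ?_)
    rw [norm_unitary_apply (Unitary.star_mem (expI_mem_unitary hσ r))]
    rfl
  have hUd (r : ℝ) (hr : r ∈ Set.Icc (0 : ℝ) 1) : HasDerivWithinAt (fun r => U r Ω)
      ((expI σ r * L * star (expI σ r)) (U r Ω)) (Set.Icc 0 1) r := by
    have h := (hU.2 r hr).2
    rw [deriv_commutator_conjugate_expI hσ hP hPσ, ← hL] at h
    simpa using hasDerivWithinAt_clm_apply h (hasDerivWithinAt_const r _ Ω)
  have hVd (r : ℝ) : HasDerivAt (fun r => expI σ r Ω)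
      ((expI σ r * L * star (expI σ r)) (expI σ r Ω)) r := by
    have h := hasDerivAt_clm_apply (hasDerivAt_expI σ r) (hasDerivAt_const r Ω)
    have h1 : star (expI σ r) (expI σ r Ω) = Ω := unitary_adjoint_apply (expI_mem_unitary hσ r) Ω
    rw [mul_apply_eq_comp, mul_apply_eq_comp, h1, hLΩ]
    simpa using h
  refine ODE_solution_unique (v := fun r x => (expI σ r * L * star (expI σ r)) x) hlip
    (fun r hr => (hUd r hr).continuousWithinAt)
    (fun r hr => (hUd r (Set.Ico_subset_Icc_self hr)).mono_of_mem_nhdsWithin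
      (Icc_mem_nhdsGE_of_mem hr))
    (fun r _ => (hVd r).continuousAt.continuousWithinAt)
    (fun r _ => (hVd r).hasDerivWithinAt) ?_ hs
  simp [hU.1, expI_zero]

/-! ### The Schrödinger evolution of a rotated Hamiltonian -/

/-- In the rotating frame the Hamiltonian is `τ T + σ`, which does not depend on time. -/
theorem exists_isSchrodingerEvolution {T : H →ₗ.[ℂ] H} (hT : HasImaginaryResolvents T)
    (hσ : IsSelfAdjoint σ) {τ : ℝ} (hτ : 0 < τ) :
    ∃ U, IsSchrodingerEvolution (fun s => conjugate (expI σ s) T) τ U := by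
  have hsymm : ∀ x y : H, inner ℂ (σ x) y = inner ℂ x (σ y) :=
    (ContinuousLinearMap.isSelfAdjoint_iff_isSymmetric.1 hσ)
  obtain ⟨G, hG0, hGu, hG⟩ := (hT.smul_add_bounded hτ.ne' hsymm).exists_unitary_group
  refine ⟨fun s => expI σ s * G s, ?_, fun s _ => ⟨mul_mem (expI_mem_unitary hσ s) (hGu s),
    fun ψ hψ => ?_⟩⟩
  · simp [expI_zero, hG0]
  · have hψ' : ψ ∈ T.domain := by
      have h := mem_domain_conjugate.1 hψ
      simpa [expI_zero, ← ContinuousLinearMap.star_eq_adjoint] using h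
    obtain ⟨hmem, hder⟩ := hG s ⟨ψ, hψ', trivial⟩
    obtain ⟨hmem', hval⟩ := exists_conjugate_apply (expI_mem_unitary hσ s) T ⟨_, hmem.1⟩
    refine ⟨hmem', ?_⟩
    refine HasDerivAt.hasDerivWithinAt ?_
    refine (hasDerivAt_clm_apply (hasDerivAt_expI σ s) hder).congr_deriv (Eq.trans ?_ (congrArg _ hval.symm))
    have hsum : ((τ : ℂ) • T + (σ.toLinearMap).toPMap ⊤) ⟨G s ψ, hmem⟩ =
        (τ : ℂ) • T ⟨G s ψ, hmem.1⟩ + σ (G s ψ) := rfl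
    simp only [hsum, mul_apply_eq_comp, smul_apply, map_smul, map_add, smul_add, smul_smul]
    module

end Rotation

/-! ### The adiabatic estimate -/

section Estimate

variable {H : Type*} [NormedAddCommGroup H] [InnerProductSpace ℂ H]

/-- A curve whose derivative pushes it outwards with speed at most `R` grows at most linearly. -/
theorem norm_le_of_re_inner_deriv_le {u u' : ℝ → H} {R : ℝ}
    (hu : ∀ s ∈ Set.Icc (0 : ℝ) 1, HasDerivWithinAt u (u' s) (Set.Icc 0 1) s)
    (hR : ∀ s ∈ Set.Icc (0 : ℝ) 1, (inner ℂ (u s) (u' s)).re ≤ R * ‖u s‖) (hR0 : 0 ≤ R)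
    {s : ℝ} (hs : s ∈ Set.Icc (0 : ℝ) 1) : ‖u s‖ ≤ ‖u 0‖ + R * s := by
  let _ : InnerProductSpace ℝ H := InnerProductSpace.rclikeToReal ℂ H
  refine le_of_forall_pos_le_add fun ε hε => ?_
  -- compare `‖u‖²` with the square of a strictly steeper affine function
  let b : ℝ → ℝ := fun t => ‖u 0‖ + ε / 2 + (R + ε / 2) * t
  have hb (t : ℝ) : HasDerivAt b (R + ε / 2) t := by
    simpa [b] using ((hasDerivAt_id t).const_mul (R + ε / 2)).const_add (‖u 0‖ + ε / 2)
  have hb0 (t : ℝ) (ht : t ∈ Set.Icc (0 : ℝ) 1) : 0 < b t := by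
    have := ht.1
    positivity
  have hd (t : ℝ) (ht : t ∈ Set.Icc (0 : ℝ) 1) :
      HasDerivWithinAt (fun t => ‖u t‖ ^ 2) (2 * inner ℝ (u t) (u' t)) (Set.Icc 0 1) t :=
    HasDerivWithinAt.norm_sq (F := H) (hu t ht)
  have hle : ‖u s‖ ^ 2 ≤ b s ^ 2 := by
    refine image_le_of_deriv_right_lt_deriv_boundary (B := fun t => b t ^ 2)
      (fun t ht => (hd t ht).continuousWithinAt)
      (fun t ht => (hd t (Set.Ico_subset_Icc_self ht)).mono_of_mem_nhdsWithin
        (Icc_mem_nhdsGE_of_mem ht)) ?_ (fun t => (hb t).pow 2) (fun t ht heq => ?_) hs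
    · simp only [b, mul_zero, add_zero]
      gcongr
      linarith
    · have ht' := Set.Ico_subset_Icc_self ht
      have hbt := hb0 t ht'
      have hnorm : ‖u t‖ = b t := (sq_eq_sq₀ (norm_nonneg _) hbt.le).1 heq
      have h1 := hR t ht'
      rw [hnorm] at h1
      rw [real_inner_eq_re_inner ℂ]
      simp only [RCLike.re_to_complex, Nat.cast_ofNat]
      nlinarith
  have h2 := (sq_le_sq₀ (norm_nonneg _) (hb0 s hs).le).1 hle
  have h3 : ε / 2 * s ≤ ε / 2 := mul_le_of_le_one_right (by positivity) hs.2
  simp only [b] at h2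
  linarith

variable [CompleteSpace H] {σ : H →L[ℂ] H}

/-- If `Ξ` nearly solves `T Ξ = -σ Ω`, then `V(s) (Ω + Ξ/τ)` nearly solves the Schrödinger equation
of the Hamiltonians `V(s) T V(s)†`, with an error of order `‖Ξ‖/τ + ‖T Ξ + σ Ω‖`. No gap is needed:
the self-adjointness of the Hamiltonians controls the growth of this error. -/
theorem IsSchrodingerEvolution.norm_sub_le {T : H →ₗ.[ℂ] H} (hT : HasImaginaryResolvents T)
    (hσ : IsSelfAdjoint σ) (hσn : ∀ x, ‖σ x‖ = ‖x‖) {τ : ℝ} (hτ : 0 < τ) {U : ℝ → H →L[ℂ] H}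
    (hU : IsSchrodingerEvolution (fun s => conjugate (expI σ s) T) τ U) {Ω Ξ : T.domain}
    {err : H} (hΩ : T Ω = 0) (hΞ : T Ξ = -σ (Ω : H) + err) {s : ℝ} (hs : s ∈ Set.Icc (0 : ℝ) 1) :
    ‖expI σ s (Ω : H) - U s (Ω : H)‖ ≤ 3 * (‖(Ξ : H)‖ / τ) + ‖err‖ := by
  have hVn (r : ℝ) (x : H) : ‖expI σ r x‖ = ‖x‖ := norm_unitary_apply (expI_mem_unitary hσ r) x
  set ε : ℝ := ‖(Ξ : H)‖ / τ with hε
  have hε0 : 0 ≤ ε := by positivity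
  let w : T.domain := Ω + ((τ⁻¹ : ℝ) : ℂ) • Ξ
  have hTw : T w = ((τ⁻¹ : ℝ) : ℂ) • (-σ (Ω : H) + err) := by
    rw [T.map_add, T.map_smul, hΩ, hΞ, zero_add]
  let res : ℝ → H := fun r =>
    expI σ r (Complex.I • σ (((τ⁻¹ : ℝ) : ℂ) • (Ξ : H)) + Complex.I • err)
  have hnormΞ : ‖((τ⁻¹ : ℝ) : ℂ) • (Ξ : H)‖ = ε := by
    rw [norm_smul, Complex.norm_real, Real.norm_eq_abs, abs_of_pos (inv_pos.2 hτ), hε,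
      div_eq_inv_mul]
  have hres (r : ℝ) : ‖res r‖ ≤ ε + ‖err‖ := by
    rw [hVn]
    refine (norm_add_le _ _).trans (le_of_eq ?_)
    rw [norm_smul, norm_smul, hσn, hnormΞ, Complex.norm_I, one_mul, one_mul]
  have hΩ0 : (Ω : H) ∈ (conjugate (expI σ 0) T).domain := by
    rw [mem_domain_conjugate, expI_zero, ← ContinuousLinearMap.star_eq_adjoint, star_one]
    exact Ω.2
  let u : ℝ → H := fun r => U r (Ω : H) - expI σ r (w : H)
  have hu (r : ℝ) (hr : r ∈ Set.Icc (0 : ℝ) 1) : ∃ h : u r ∈ (conjugate (expI σ r) T).domain,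
      HasDerivWithinAt u ((-Complex.I * (τ : ℂ)) • conjugate (expI σ r) T ⟨u r, h⟩ - res r)
        (Set.Icc 0 1) r := by
    obtain ⟨h1, hd1⟩ := (hU.2 r hr).2 Ω hΩ0
    obtain ⟨h2, hv2⟩ := exists_conjugate_apply (expI_mem_unitary hσ r) T w
    refine ⟨Submodule.sub_mem _ h1 h2, ?_⟩
    have hd2 := (hasDerivAt_clm_apply (hasDerivAt_expI σ r)
      (hasDerivAt_const r (w : H))).hasDerivWithinAt (s := Set.Icc 0 1)
    refine (hd1.sub hd2).congr_deriv ?_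
    have h3 : conjugate (expI σ r) T ⟨u r, Submodule.sub_mem _ h1 h2⟩ =
        conjugate (expI σ r) T ⟨U r (Ω : H), h1⟩ - expI σ r (T w) := by
      rw [← hv2]
      exact (conjugate (expI σ r) T).toFun.map_sub ⟨_, h1⟩ ⟨_, h2⟩
    have hτI : (-Complex.I * (τ : ℂ)) * ((τ⁻¹ : ℝ) : ℂ) = -Complex.I := by
      rw [mul_assoc, ← Complex.ofReal_mul, mul_inv_cancel₀ hτ.ne', Complex.ofReal_one, mul_one]
    rw [h3, hTw, smul_sub, ← map_smul, smul_smul, hτI]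
    have hw : (w : H) = (Ω : H) + ((τ⁻¹ : ℝ) : ℂ) • (Ξ : H) := rfl
    simp only [res, hw, mul_apply_eq_comp, smul_apply, map_smul, map_add, map_neg, smul_add,
      smul_neg, map_zero, add_zero]
    module
  have hre (r : ℝ) (hr : r ∈ Set.Icc (0 : ℝ) 1) :
      ∃ u', HasDerivWithinAt u u' (Set.Icc 0 1) r ∧
        (inner ℂ (u r) u').re ≤ (ε + ‖err‖) * ‖u r‖ := by
    obtain ⟨h, hd⟩ := hu r hr
    refine ⟨_, hd, ?_⟩
    have h1 := inner_self_im_eq_zero (hT.conjugate (expI_mem_unitary hσ r)).symm ⟨u r, h⟩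
    have h2 : (inner ℂ (u r)
        ((-Complex.I * (τ : ℂ)) • conjugate (expI σ r) T ⟨u r, h⟩)).re = 0 := by
      rw [inner_smul_right]
      simp [Complex.mul_re, h1]
    rw [inner_sub_right, Complex.sub_re, h2, zero_sub]
    calc -(inner ℂ (u r) (res r)).re ≤ ‖inner ℂ (u r) (res r)‖ :=
          (neg_le_abs _).trans (Complex.abs_re_le_norm _)
      _ ≤ ‖u r‖ * ‖res r‖ := norm_inner_le_norm _ _
      _ ≤ (ε + ‖err‖) * ‖u r‖ := by rw [mul_comm]; gcongr; exact hres r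
  choose! u' hu' hu'R using hre
  have hgrow : ‖u s‖ ≤ ‖u 0‖ + (ε + ‖err‖) * s :=
    norm_le_of_re_inner_deriv_le hu' hu'R (by positivity) hs
  have hu0 : ‖u 0‖ = ε := by
    have : u 0 = -(((τ⁻¹ : ℝ) : ℂ) • (Ξ : H)) := by
      simp only [u, w, hU.1, expI_zero, one_apply_eq_self, Submodule.coe_add, Submodule.coe_smul]
      abel
    rw [this, norm_neg, hnormΞ]
  have hsplit : expI σ s (Ω : H) - U s (Ω : H) = -u s - expI σ s (((τ⁻¹ : ℝ) : ℂ) • (Ξ : H)) := by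
    simp only [u, w, Submodule.coe_add, Submodule.coe_smul, map_add]
    abel
  have h1 : (ε + ‖err‖) * s ≤ ε + ‖err‖ := mul_le_of_le_one_right (by positivity) hs.2
  calc ‖expI σ s (Ω : H) - U s (Ω : H)‖ ≤ ‖u s‖ + ε := by
        rw [hsplit]
        refine (_root_.norm_sub_le _ _).trans (le_of_eq ?_)
        rw [norm_neg, hVn, hnormΞ]
    _ ≤ 3 * ε + ‖err‖ := by linarith

end Estimate

/-! ### The rotated Dicke Hamiltonians -/

section RotatedHamiltonian

variable {d : ℕ} {f : OneParticle d} {m α : ℝ}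

theorem sigmaX_toLp (a b : Fock d) :
    sigmaX d (WithLp.toLp 2 (a, b)) = WithLp.toLp 2 (b, a) :=
  rfl

theorem norm_sigmaX_apply (x : State d) : ‖sigmaX d x‖ = ‖x‖ :=
  LinearIsometryEquiv.norm_map _ x

theorem isSelfAdjoint_sigmaX (d : ℕ) : IsSelfAdjoint (sigmaX d) := by
  refine ContinuousLinearMap.isSelfAdjoint_iff_isSymmetric.2 fun x y => ?_
  change inner ℂ (WithLp.toLp 2 (x.snd, x.fst)) (WithLp.toLp 2 (y.fst, y.snd)) =
    inner ℂ (WithLp.toLp 2 (x.fst, x.snd)) (WithLp.toLp 2 (y.snd, y.fst))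
  rw [inner_toLp, inner_toLp, add_comm]

theorem rotation_mem_unitary (d : ℕ) (s : ℝ) :
    rotation d s ∈ unitary (State d →L[ℂ] State d) :=
  expI_mem_unitary (isSelfAdjoint_sigmaX d) s

theorem inner_groundState_sigmaX : inner ℂ (groundState d) (sigmaX d (groundState d)) = 0 := by
  rw [groundState, sigmaX_toLp, inner_toLp, inner_zero_left, inner_zero_right, add_zero]

/-- The projection on the ground state of the Dicke Hamiltonian. -/
def vacuumProjection (d : ℕ) : State d →L[ℂ] State d :=
  (Submodule.span ℂ {groundState d}).starProjection

theorem vacuumProjection_apply (x : State d) :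
    vacuumProjection d x = inner ℂ (groundState d) x • groundState d :=
  Submodule.starProjection_unit_singleton ℂ norm_groundState x

theorem vacuumProjection_groundState : vacuumProjection d (groundState d) = groundState d := by
  rw [vacuumProjection_apply, inner_self_eq_norm_sq_to_K, norm_groundState]
  simp

theorem vacuumProjection_mul_self : vacuumProjection d * vacuumProjection d = vacuumProjection d :=
  Submodule.isIdempotentElem_starProjection _

theorem vacuumProjection_sigmaX :
    vacuumProjection d * (Complex.I • sigmaX d) * vacuumProjection d = 0 := by
  ext1 x
  simp only [mul_apply_eq_comp, smul_apply, vacuumProjection_apply, map_smul,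
    inner_groundState_sigmaX, zero_smul, zero_apply, smul_zero]

variable [NeZero d]

theorem kernel_rotatedHamiltonian (hf : FiniteInfraredEnergy f) (hα : 0 < α)
    (hm : lambShift f α < m) (s : ℝ) :
    kernel (rotatedHamiltonian m f α s) = Submodule.span ℂ {rotation d s (groundState d)} :=
  kernel_conjugate (rotation_mem_unitary d s) (kernel_hamiltonian hf hα hm)

theorem isSelfAdjoint_rotatedHamiltonian (hf : FiniteInfraredEnergy f) (hα : 0 < α) (s : ℝ) :
    IsSelfAdjoint (rotatedHamiltonian m f α s) :=
  ((hamiltonian_hasImaginaryResolvents hf hα).conjugate (rotation_mem_unitary d s)).isSelfAdjoint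

theorem inner_rotatedHamiltonian_nonneg (hf : FiniteInfraredEnergy f) (hα : 0 < α)
    (hm : lambShift f α < m) (s : ℝ) (ψ : (rotatedHamiltonian m f α s).domain) :
    0 ≤ inner ℂ (ψ : State d) (rotatedHamiltonian m f α s ψ) := by
  have h := inner_hamiltonian_nonneg hf hα hm ⟨_, ψ.2⟩
  exact h.trans_eq (ContinuousLinearMap.adjoint_inner_left _ _ _)

theorem groundProjection_eq (hf : FiniteInfraredEnergy f) (hα : 0 < α) (hm : lambShift f α < m) :
    groundProjection m f α =
      fun s => rotation d s * vacuumProjection d * star (rotation d s) := by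
  funext s
  have hV := rotation_mem_unitary d s
  have hcl : (kernel (rotatedHamiltonian m f α s)).topologicalClosure =
      Submodule.span ℂ {rotation d s (groundState d)} := by
    rw [kernel_rotatedHamiltonian hf hα hm]
    exact (Submodule.closed_of_finiteDimensional _).submodule_topologicalClosure_eq
  ext1 x
  have h1 : groundProjection m f α s x =
      (Submodule.span ℂ {rotation d s (groundState d)}).starProjection x := by
    unfold groundProjection
    congr 2
  rw [h1, Submodule.starProjection_unit_singleton ℂ
    ((norm_unitary_apply hV _).trans norm_groundState)]
  rw [mul_apply_eq_comp, mul_apply_eq_comp, vacuumProjection_apply, map_smul,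
    ContinuousLinearMap.star_eq_adjoint, ContinuousLinearMap.adjoint_inner_right]

/-! ### A cutoff first-order correction -/

/-- The first-order correction `(m - α²𝓔)⁻¹ (α^{3/2} a†(g) |0⟩, -|0⟩)` to the ground state. With
`|k| g = f` it would solve `H_D Ξ = -σ (|0⟩, 0)`; that `g = f/|k|` need not be square integrable is
the origin of the logarithm in three dimensions. -/
def correction (m : ℝ) (f : OneParticle d) (α : ℝ) (g : OneParticle d) : State d :=
  WithLp.toLp 2 ((((m - lambShift f α)⁻¹ * (α * √α) : ℝ) : ℂ) • oneBoson g,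
    -(((m - lambShift f α)⁻¹ : ℝ) : ℂ) • vacuum d)

theorem norm_toLp_le {H : Type*} [NormedAddCommGroup H] (a b : H) :
    ‖(WithLp.toLp 2 (a, b) : WithLp 2 (H × H))‖ ≤ ‖a‖ + ‖b‖ := by
  refine (sq_le_sq₀ (norm_nonneg _) (by positivity)).1 ?_
  rw [norm_toLp_sq]
  nlinarith [norm_nonneg a, norm_nonneg b]

omit [NeZero d] in
theorem norm_correction_le (hα : 0 < α) (hm : lambShift f α < m) (g : OneParticle d) :
    ‖correction m f α g‖ ≤ (m - lambShift f α)⁻¹ * (1 + α * √α * ‖g‖) := by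
  have hβ : 0 < (m - lambShift f α)⁻¹ := inv_pos.2 (sub_pos.2 hm)
  refine (norm_toLp_le _ _).trans (le_of_eq ?_)
  rw [norm_smul, norm_smul, norm_neg, Complex.norm_real, Complex.norm_real, norm_oneBoson,
    norm_vacuum, Real.norm_of_nonneg hβ.le, Real.norm_of_nonneg (by positivity)]
  ring

/-- The correction solves `H_D Ξ = -σ (|0⟩, 0)` up to an error that is small when `h = |k| g`
approximates `f` and `⟨f|g⟩` approximates `𝓔`. -/
theorem exists_hamiltonian_correction (hf : FiniteInfraredEnergy f) (hα : 0 < α)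
    (hm : lambShift f α < m) {g h : OneParticle d} (hgh : ∀ᵐ x, h x = (‖x‖ : ℂ) * g x) :
    ∃ (hΞ : correction m f α g ∈ (hamiltonian m f α).domain) (err : State d),
      hamiltonian m f α ⟨_, hΞ⟩ = -sigmaX d (groundState d) + err ∧
      ‖err‖ ≤ (m - lambShift f α)⁻¹ *
        (√α * ‖f - h‖ + α ^ 2 * ‖(infraredEnergy f : ℂ) - inner ℂ f g‖) := by
  obtain ⟨hg, hEg⟩ := exists_fieldEnergy_oneBoson hgh
  obtain ⟨hv, hEv⟩ := exists_fieldEnergy_vacuum (d := d)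
  obtain ⟨hc, hCv⟩ := exists_creation_vacuum f
  obtain ⟨ha, hAg⟩ := exists_annihilation_oneBoson hf g
  have hK := isFieldCoupling hf
  have hβ0 : 0 < m - lambShift f α := sub_pos.2 hm
  set β : ℝ := (m - lambShift f α)⁻¹ with hβ
  have hβpos : 0 < β := inv_pos.2 hβ0
  let ψ : (fieldEnergy d).domain := ((β * (α * √α) : ℝ) : ℂ) • ⟨oneBoson g, hg⟩
  let φ : (fieldEnergy d).domain := -((β : ℝ) : ℂ) • ⟨vacuum d, hv⟩
  have hC : creation f ⟨φ, hK.leC φ.2⟩ = -((β : ℝ) : ℂ) • oneBoson f := by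
    rw [← hCv]
    exact (creation f).map_smul _ ⟨vacuum d, hc⟩
  have hA : annihilation f ⟨ψ, hK.leA ψ.2⟩ =
      ((β * (α * √α) : ℝ) : ℂ) • (inner ℂ f g : ℂ) • vacuum d := by
    rw [← hAg]
    exact (annihilation f).map_smul _ ⟨oneBoson g, ha⟩
  have hEψ : fieldEnergy d ψ = ((β * (α * √α) : ℝ) : ℂ) • oneBoson h := by
    rw [← hEg]
    exact (fieldEnergy d).map_smul _ ⟨oneBoson g, hg⟩
  have hEφ : fieldEnergy d φ = 0 := by
    have := (fieldEnergy d).map_smul (-((β : ℝ) : ℂ)) ⟨vacuum d, hv⟩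
    rwa [hEv, smul_zero] at this
  -- the lower component misses `f - |k| g`, the upper one `𝓔 - ⟨f|g⟩`
  refine ⟨hK.toLp_mem ψ φ, WithLp.toLp 2 (-((β * √α : ℝ) : ℂ) • oneBoson (f - h),
    -((β * α ^ 2 : ℝ) : ℂ) • ((infraredEnergy f : ℂ) - inner ℂ f g) • vacuum d), ?_, ?_⟩
  · refine (hK.apply_toLp ψ φ).trans ?_
    have hα0 : (α : ℂ) ≠ 0 := Complex.ofReal_ne_zero.2 hα.ne'
    have hsq : ((√α : ℝ) : ℂ) * ((√α : ℝ) : ℂ) = α := by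
      rw [← Complex.ofReal_mul, Real.mul_self_sqrt hα.le]
    have hβm : (β : ℂ) * ((m : ℂ) - (α : ℂ) ^ 2 * infraredEnergy f) = 1 := by
      have : β * (m - α ^ 2 * infraredEnergy f) = 1 := inv_mul_cancel₀ hβ0.ne'
      exact_mod_cast this
    have hφ : (φ : Fock d) = -((β : ℝ) : ℂ) • vacuum d := rfl
    rw [hC, hA, hEψ, hEφ, hφ, groundState, sigmaX_toLp, ← WithLp.toLp_neg, ← WithLp.toLp_add,
      oneBoson_sub]
    congr 1
    simp only [Prod.neg_mk, Prod.mk_add_mk, Prod.mk.injEq, neg_zero, zero_add, smul_zero, add_zero]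
    push_cast
    constructor
    · match_scalars <;> field_simp
    · match_scalars
      linear_combination (β : ℂ) * α * inner ℂ f g * hsq - hβm
  · refine (norm_toLp_le _ _).trans (le_of_eq ?_)
    rw [norm_smul, norm_smul, norm_smul, norm_neg, norm_neg, Complex.norm_real, Complex.norm_real,
      norm_oneBoson, norm_vacuum, Real.norm_of_nonneg (by positivity),
      Real.norm_of_nonneg (by positivity)]
    ring

/-- The distance of two evolutions on the ground state is a distance of vectors, since the
projection on the ground state has rank one. -/
theorem norm_mul_groundProjection_zero_le (hf : FiniteInfraredEnergy f) (hα : 0 < α)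
    (hm : lambShift f α < m) (W : State d →L[ℂ] State d) :
    ‖W * groundProjection m f α 0‖ ≤ ‖W (groundState d)‖ := by
  refine ContinuousLinearMap.opNorm_le_bound _ (norm_nonneg _) fun x => ?_
  have h0 : groundProjection m f α 0 = vacuumProjection d := by
    rw [groundProjection_eq hf hα hm]
    simp only [rotation, expI_zero, one_mul]
    exact (congrArg (vacuumProjection d * ·) (star_one _)).trans (mul_one _)
  rw [h0, mul_apply_eq_comp, vacuumProjection_apply, map_smul, norm_smul, mul_comm]
  gcongr
  have h := norm_inner_le_norm (𝕜 := ℂ) (groundState d) x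
  rwa [norm_groundState, one_mul] at h

end RotatedHamiltonian

/-- The norm `x` of the correction and the norm `y` of its error, inserted into the estimate of the
Schrödinger evolution. -/
theorem adiabatic_bound {α β τ ρ M x y u v w : ℝ} (hα : 0 < α) (hβ : 0 < β) (hτ : 0 < τ)
    (hM : 0 < M) (hρ : 1 / 2 ≤ τ * ρ) (hx : x ≤ β * (1 + α * √α * u)) (hu : u ≤ M * (τ * ρ))
    (hy : y ≤ β * (√α * v + α ^ 2 * w)) (hv : v ≤ M * ρ) (hw : w ≤ M * ρ) :
    3 * (x / τ) + y ≤ (6 + 4 * M * (√α + α ^ 2)) * β * ρ := by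
  have hρ0 : 0 < ρ := pos_of_mul_pos_right (lt_of_lt_of_le (by norm_num) hρ) hτ.le
  -- `α^{3/2}` lies between `√α` and `α²`
  have hα32 : α * √α ≤ √α + α ^ 2 := by
    rcases le_total α 1 with h1 | h1
    · have := mul_le_of_le_one_left (Real.sqrt_nonneg α) h1
      have := sq_nonneg α
      linarith
    · have h2 : √α ≤ α := Real.sqrt_le_self_iff.2 (Or.inr h1)
      have := mul_le_mul_of_nonneg_left h2 hα.le
      have := Real.sqrt_nonneg α
      linarith
  have hMρ : 0 ≤ M * ρ := by positivity
  have hxτ : x / τ ≤ β * (2 * ρ + (√α + α ^ 2) * (M * ρ)) := by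
    rw [div_le_iff₀ hτ]
    calc x ≤ β * (1 + α * √α * u) := hx
      _ ≤ β * (2 * (τ * ρ) + α * √α * (M * (τ * ρ))) := by gcongr; linarith
      _ = β * (2 * ρ + α * √α * (M * ρ)) * τ := by ring
      _ ≤ β * (2 * ρ + (√α + α ^ 2) * (M * ρ)) * τ := by gcongr
  have hy' : y ≤ β * ((√α + α ^ 2) * (M * ρ)) := by
    refine hy.trans ?_
    rw [add_mul]
    gcongr
  calc _ ≤ 3 * (β * (2 * ρ + (√α + α ^ 2) * (M * ρ))) + β * ((√α + α ^ 2) * (M * ρ)) := by gcongr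
    _ = _ := by ring

end Dicke

end

theorem mainTheorem1 :
    ∃ c : ℝ, 0 < c ∧ ∀ (d : ℕ), 3 ≤ d → ∀ f : Dicke.OneParticle d, Dicke.SqrtSingularity f →
      ∃ C : ℝ, 0 < C ∧ ∀ m α : ℝ, 0 < α → Dicke.lambShift f α < m →
        -- the spectrum of each `H_D(s)` starts at zero, and `V(s) (|0⟩, 0)` is its ground state
        (∀ s : ℝ,
          IsSelfAdjoint (Dicke.rotatedHamiltonian m f α s) ∧
          (∀ ψ : (Dicke.rotatedHamiltonian m f α s).domain,
            0 ≤ inner ℂ (ψ : Dicke.State d) (Dicke.rotatedHamiltonian m f α s ψ)) ∧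
          Dicke.kernel (Dicke.rotatedHamiltonian m f α s) =
            Submodule.span ℂ {Dicke.rotation d s (WithLp.toLp 2 (Dicke.vacuum d, 0))}) ∧
        -- both evolutions exist
        (∃ U_A, Dicke.IsAdiabaticEvolution (Dicke.groundProjection m f α) U_A) ∧
        (∀ τ : ℝ, 0 < τ →
          ∃ U_τ, Dicke.IsSchrodingerEvolution (Dicke.rotatedHamiltonian m f α) τ U_τ) ∧
        -- and they are close on the ground state, on the time scale set by `m - α² 𝓔`
        (∀ (U_A : ℝ → Dicke.State d →L[ℂ] Dicke.State d) (τ : ℝ)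
            (U_τ : ℝ → Dicke.State d →L[ℂ] Dicke.State d),
          Dicke.IsAdiabaticEvolution (Dicke.groundProjection m f α) U_A →
          0 < τ → (d = 3 → 2 ≤ τ) →
          Dicke.IsSchrodingerEvolution (Dicke.rotatedHamiltonian m f α) τ U_τ →
          ∀ s ∈ Set.Icc (0 : ℝ) 1,
            ‖(U_A s - U_τ s) * Dicke.groundProjection m f α 0‖ ≤
              (c + C * (√α + α ^ 2)) / (m - Dicke.lambShift f α) * Dicke.adiabaticRate d τ) := by
  refine ⟨6, by norm_num, fun d hd f hsing => ?_⟩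
  have : NeZero d := ⟨by omega⟩
  have hf := hsing.finiteInfraredEnergy hd
  obtain ⟨M, hM, hcut⟩ := Dicke.exists_adapted_cutoff hd hsing
  refine ⟨4 * M, by positivity, fun m α hα hm => ⟨fun s =>
    ⟨Dicke.isSelfAdjoint_rotatedHamiltonian hf hα s,
      Dicke.inner_rotatedHamiltonian_nonneg hf hα hm s,
      Dicke.kernel_rotatedHamiltonian hf hα hm s⟩, ?_, fun τ hτ =>
    Dicke.exists_isSchrodingerEvolution (Dicke.hamiltonian_hasImaginaryResolvents hf hα)
      (Dicke.isSelfAdjoint_sigmaX d) hτ, fun U_A τ U_τ hA hτ hτ2 hU s hs => ?_⟩⟩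
  · rw [Dicke.groundProjection_eq hf hα hm]
    exact Dicke.exists_isAdiabaticEvolution (Dicke.isSelfAdjoint_sigmaX d)
      Dicke.vacuumProjection_mul_self Dicke.vacuumProjection_sigmaX
  · rw [Dicke.groundProjection_eq hf hα hm] at hA
    obtain ⟨g, h, hgh, hg, hfh, hinner⟩ := hcut τ hτ hτ2
    obtain ⟨hΞ, err, hHΞ, herr⟩ := Dicke.exists_hamiltonian_correction hf hα hm hgh
    obtain ⟨hΩ, hHΩ⟩ := Dicke.exists_hamiltonian_groundState (m := m) (α := α) hf
    have hest := Dicke.IsSchrodingerEvolution.norm_sub_le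
      (Dicke.hamiltonian_hasImaginaryResolvents hf hα) (Dicke.isSelfAdjoint_sigmaX d)
      Dicke.norm_sigmaX_apply hτ hU hHΩ hHΞ hs
    have hAΩ := Dicke.IsAdiabaticEvolution.apply_eq (Dicke.isSelfAdjoint_sigmaX d)
      Dicke.vacuumProjection_mul_self Dicke.vacuumProjection_sigmaX hA
      Dicke.vacuumProjection_groundState hs
    refine (Dicke.norm_mul_groundProjection_zero_le hf hα hm _).trans ?_
    rw [sub_apply, hAΩ]
    refine hest.trans ?_
    have hΞn := Dicke.norm_correction_le hα hm g
    have hρ := Dicke.half_le_mul_adiabaticRate hτ hτ2 hd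
    have hβ : 0 < (m - Dicke.lambShift f α)⁻¹ := inv_pos.2 (sub_pos.2 hm)
    rw [div_eq_mul_inv _ (m - Dicke.lambShift f α)]
    exact Dicke.adiabatic_bound hα hβ hτ hM hρ hΞn hg herr hfh hinner
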